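/- **Conventions.** Let $K$ be a field. For a graded vector space $V=\bigoplus_{i\in\mathbb Z}V_i$, $V[k]$ is $V$ with the grading $V[k]_i=V_{i+k}$. Elements are homogeneous where their degrees occur. For homogeneous elements of degrees $x_1,\dots,x_n$, $\varepsilon(x_1\dots x_n;\,x_{i_1}\dots x_{i_n})$ is the Koszul sign of the rearrangement, i.e. the product of $(-1)^{x_ix_j}$ over all pairs put out of order. Let $a,b\in\mathbb Z$ and let $(\mathcal A,\cdot,[\ ,\ ],d)$ be a differential graded $(a,b)$-algebra over $K$: a graded vector space with a product of degree $a$, a bracket of degree $b$ and a map $d$ of degree $1$ such that, $|\alpha|$ being the degree in $\mathcal A$, - $\alpha\cdot\beta=(-1)^{(|\alpha|+a)(|\beta|+a)}\beta\cdot\alpha$ and $\alpha\cdot(\beta\cdot\gamma)=(\alpha\cdot\beta)\cdot\gamma$; - $[\alpha,\beta]=-(-1)^{(|\alpha|+b)(|\beta|+b)}[\beta,\alpha]$ and $(-1)^{(|\alpha|+b)(|\gamma|+b)}[[\alpha,\beta],\gamma]+(-1)^{(|\beta|+b)(|\alpha|+b)}[[\beta,\gamma],\alpha]+(-1)^{(|\gamma|+b)(|\beta|+b)}[[\gamma,\alpha],\beta]=0$;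 - $[\alpha,\beta\cdot\gamma]=[\alpha,\beta]\cdot\gamma+(-1)^{(|\beta|+a)(|\alpha|+b)}\beta\cdot[\alpha,\gamma]$; - $d^2=0$, $d(\alpha\cdot\beta)=d\alpha\cdot\beta+(-1)^{|\alpha|+a}\alpha\cdot d\beta$ and $d[\alpha,\beta]=[d\alpha,\beta]+(-1)^{|\alpha|+b}[\alpha,d\beta]$. On $\mathcal A[-a+1]$ write $\alpha$ also for the degree $|\alpha|+a-1$ of $\alpha$, and put $\mu(\alpha,\beta)=(-1)^{\alpha}\alpha\cdot\beta$ and $\ell(\alpha,\beta)=(-1)^{(b-a+1)\alpha}[\alpha,\beta]$. A $(p,q)$-shuffle is a permutation $\sigma$ of $\{1,\dots,p+q\}$ with $\sigma(1)<\dots<\sigma(p)$ and $\sigma(p+1)<\dots<\sigma(p+q)$; write $\varepsilon_\alpha(\sigma^{-1})=\varepsilon(\alpha_1\dots\alpha_{p+q};\,\alpha_{\sigma^{-1}(1)}\dots\alpha_{\sigma^{-1}(p+q)})$. Let $\mathcal H=\bigoplus_{n\ge1}\mathcal A[-a+1]^{\otimes n}/\mathrm{Sh}_n$, where $\mathrm{Sh}_n$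 is the span of all signed shuffle products $\sum_{\sigma}\varepsilon_\alpha(\sigma^{-1})\,\alpha_{\sigma^{-1}(1)}\otimes\dots\otimes\alpha_{\sigma^{-1}(n)}$ with $p+q=n$, $p,q\ge1$ and $\sigma$ running over the $(p,q)$-shuffles. Classes are written $\alpha_1\underline\otimes\cdots\underline\otimes\alpha_n$ and have degree $\alpha_1+\dots+\alpha_n$. Put $$D(\alpha_1\underline\otimes\cdots\underline\otimes\alpha_n)=\sum_{k\le n}(-1)^{\sum_{i<k}\alpha_i}\alpha_1\underline\otimes\cdots\underline\otimes d\alpha_k\underline\otimes\cdots\underline\otimes\alpha_n+\sum_{k<n}(-1)^{\sum_{i<k}\alpha_i}\alpha_1\underline\otimes\cdots\underline\otimes\mu(\alpha_k,\alpha_{k+1})\underline\otimes\cdots\underline\otimes\alpha_n$$ and, for $X=\alpha_1\underline\otimes\cdots\underline\otimes\alpha_p$ and $Y=\alpha_{p+1}\underline\otimes\cdots\underline\otimes\alpha_{p+q}$, $$\ell_2(X,Y)=\sum_{\sigma,\,k}\varepsilon_\alpha(\sigma^{-1})(-1)^{(b-a+1)\sum_{s<k}\alpha_{\sigma^{-1}(s)}}\,\alpha_{\sigma^{-1}(1)}\underline\otimes\cdots\underline\otimes\ell(\alpha_{\sigma^{-1}(k)},\alpha_{\sigma^{-1}(k+1)})\underline\otimes\cdots\underline\otimes\alpha_{\sigma^{-1}(p+q)},$$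 summed over the $(p,q)$-shuffles $\sigma$ and the $k$ with $\sigma^{-1}(k)\le p<\sigma^{-1}(k+1)$. For $X\in\mathcal H$ homogeneous, let $x'$ be its degree in $\mathcal H[a-b-1]$ and $x''=x'-1$ its degree in $\mathcal H[a-b]$, and put $\ell'_2(X,Y)=(-1)^{(a-b-1)x'}\ell_2(X,Y)$ and $\ell''_2(X,Y)=(-1)^{x''}\ell'_2(X,Y)$. For a graded space $W$ let $S^+(W)=\bigoplus_{n\ge1}S^n(W)$ be its graded symmetric space ($X\cdot Y=(-1)^{|X||Y|}Y\cdot X$), with the coproduct $\Delta(X_1\dots X_n)=\sum_{I\sqcup J=\{1,\dots,n\},\ I,J\ne\emptyset}\varepsilon(x_1\dots x_n;x_Ix_J)\,X_I\otimes X_J$. On $S^+(\mathcal H[a-b])$ put $$m(X_1\dots X_n)=\sum_i\varepsilon(x''_1\dots x''_n;\,x''_ix''_1\dots\widehat{i}\dots x''_n)\,D(X_i).X_1\dots\widehat i\dots X_n,$$ $$\ell''(X_1\dots X_n)=\sum_{i<j}\varepsilon(x''_1\dots x''_n;\,x''_ix''_jx''_1\dots\widehat{ij}\dots x''_n)\,\ell''_2(X_i,X_j).X_1\dots\widehat{ij}\dots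 X_n$$ and $Q=m+\ell''$. **Proposition.** The space $\mathcal H[a-b]$ is graded, and the operators $D,\ell_2,\ell'_2,\ell''_2$ on $\mathcal H$ and $m,\ell''$ on $S^+(\mathcal H[a-b])$ are well defined by these formulas. On $\mathcal H[a-b]$, $\ell''_2$ and $D$ have degree $1$, and for all homogeneous $X,Y,Z$: 1. $\ell''_2(X,Y)=(-1)^{x''y''}\ell''_2(Y,X)$; 2. $(-1)^{x''z''}\ell''_2(\ell''_2(X,Y),Z)+(-1)^{y''x''}\ell''_2(\ell''_2(Y,Z),X)+(-1)^{z''y''}\ell''_2(\ell''_2(Z,X),Y)=0$; 3. $D(\ell''_2(X,Y))=-\ell''_2(DX,Y)+(-1)^{1+x''}\ell''_2(X,DY)$. Consequently $m$ and $\ell''$ are coderivations of degree $1$ of $(S^+(\mathcal H[a-b]),\Delta)$ with $m\circ m=0$ and $\ell''\circ\ell''=0$, and $(S^+(\mathcal H[a-b]),\Delta,Q)$ is an $L_\infty$ algebra: $\Delta$ is well defined, of degree $0$, graded cocommutative and coassociative on the graded space $S^+(\mathcal H[a-b])$, and $Q$ has degree $1$ and satisfies $(Q\otimes id+id\otimes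 Q)\circ\Delta=\Delta\circ Q$ and $Q^2=0$. -/

import Mathlib

open scoped TensorProduct

namespace ABHomotopy

/-! ### Graded vector spaces, Koszul signs -/

section Graded

variable {K : Type*} [Field K]

/-- The shifted grading: `V[k]` is the space `V` with the grading `V[k]_i = V_{i+k}`. -/
def shift {V : Type*} [AddCommGroup V] [Module K V] (gr : ℤ → Submodule K V) (k : ℤ) :
    ℤ → Submodule K V :=
  fun i => gr (i + k)

/-- Homogeneous elements, recorded with their degree: `x.1` is the degree of `x.2`. -/
abbrev Homog {V : Type*} [AddCommGroup V] [Module K V] (gr : ℤ → Submodule K V) : Type _ :=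
  Σ i : ℤ, gr i

/-- The linear map `F` with `F (g w) = f w` for all `w`, for a family `g` that spans `M` (so that
there is at most one such map). If there is none, the value is the junk map `0`. This only
gives names to the operators that are prescribed by their values on a spanning family; that they
exist and take the prescribed values is never assumed, it is part of the conclusion of the theorem
(`WellDefined`, `IsLInfinity.coproduct_apply`), or follows, for `signTwist` and
`flip`, from the directness of the grading, which is also part of the conclusion. -/
noncomputable def linearExt {M N : Type*} [AddCommGroup M] [Module K M] [AddCommGroup N]
    [Module K N] {ι : Type*} (g : ι → M) (f : ι → N) : M →ₗ[K] N :=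
  open Classical in
  if h : ∃ F : M →ₗ[K] N, ∀ w, F (g w) = f w then h.choose else 0

theorem linearExt_apply {M N : Type*} [AddCommGroup M] [Module K M] [AddCommGroup N]
    [Module K N] {ι : Type*} {g : ι → M} {f : ι → N}
    (h : ∃ F : M →ₗ[K] N, ∀ w, F (g w) = f w) (w : ι) :
    linearExt (K := K) g f (g w) = f w := by
  unfold linearExt
  rw [dif_pos h]
  exact h.choose_spec w

/-- For a linear map `f` on a graded space and an integer `c`, the map
`X ↦ (-1)^{c |X|} f(X)` (`X` homogeneous). -/
noncomputable def signTwist {M N : Type*} [AddCommGroup M] [Module K M] [AddCommGroup N]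
    [Module K N] (gr : ℤ → Submodule K M) (c : ℤ) (f : M →ₗ[K] N) : M →ₗ[K] N :=
  linearExt (fun X : Homog gr => (X.2 : M)) (fun X => (c * X.1).negOnePow • f X.2)

/-- The graded flip `X ⊗ Y ↦ (-1)^{|X||Y|} Y ⊗ X`. -/
noncomputable def flip {M : Type*} [AddCommGroup M] [Module K M] (gr : ℤ → Submodule K M) :
    M ⊗[K] M →ₗ[K] M ⊗[K] M :=
  linearExt (fun p : Homog gr × Homog gr => (p.1.2 : M) ⊗ₜ[K] (p.2.2 : M))
    (fun p => (p.1.1 * p.2.1).negOnePow • ((p.2.2 : M) ⊗ₜ[K] (p.1.2 : M)))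

/-- The Koszul sign `ε(x_1 … x_n ; x_{i_1} … x_{i_n})` of the rearrangement of homogeneous elements
of degrees `deg 0, …, deg (n-1)` into the order `i_1, …, i_n`: each pair that
is put out of order contributes `(-1)` to the product of its degrees. -/
def koszulSign {n : ℕ} (deg : Fin n → ℤ) : List (Fin n) → ℤˣ
  | [] => 1
  | i :: l => ((l.filter (fun j => j < i)).map (fun j => (deg i * deg j).negOnePow)).prod *
      koszulSign deg l

end Graded

section Tensors

variable {K : Type*} [Field K] {V : Type*} [AddCommGroup V] [Module K V]

/-- The degrees of a word of homogeneous elements. -/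
def degs {gr : ℤ → Submodule K V} {n : ℕ} (α : Fin n → Homog gr) : Fin n → ℤ :=
  fun i => (α i).1

/-- The letters `α_{i_1}, …, α_{i_r}` of a word `α`, for a list `i_1, …, i_r` of places. -/
def letters {gr : ℤ → Submodule K V} {n : ℕ} (α : Fin n → Homog gr) (idx : List (Fin n)) :
    List V :=
  idx.map (fun i => ((α i).2 : V))

/-- The letters of `α` at the places `idx`, except that the block of `r` letters that starts at
position `k` (counted from `0`) is replaced by the single letter `x`. -/
def replaceBlock {gr : ℤ → Submodule K V} {n : ℕ} (α : Fin n → Homog gr) (idx : List (Fin n))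
    (k r : ℕ) (x : V) : List V :=
  letters α (idx.take k) ++ x :: letters α (idx.drop (k + r))

/-- The tensor `v_1 ⊗ … ⊗ v_n` in the tensor algebra of `V`. -/
noncomputable def tens (l : List V) : TensorAlgebra K V :=
  (l.map (TensorAlgebra.ι K)).prod

/-- `σ` is a `(p,q)`-shuffle: it is increasing on the first `p` and on the last `q` places. -/
def IsShuffle (p q : ℕ) (σ : Equiv.Perm (Fin (p + q))) : Prop :=
  ∀ i j : Fin (p + q), i < j → ((j : ℕ) < p ∨ p ≤ (i : ℕ)) → σ i < σ j

/-- The signed shuffle product of two tensors of homogeneous elements. With `γ` the concatenation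
of `α` and `β`, it is the sum over all shuffles `σ` of
`ε(σ⁻¹) γ_{σ⁻¹(1)} ⊗ … ⊗ γ_{σ⁻¹(p+q)}`. -/
noncomputable def bat {gr : ℤ → Submodule K V} {p q : ℕ} (α : Fin p → Homog gr)
    (β : Fin q → Homog gr) : TensorAlgebra K V :=
  open Classical in
  ∑ σ : Equiv.Perm (Fin (p + q)) with IsShuffle p q σ,
    koszulSign (degs (Fin.append α β)) (List.ofFn σ.symm) •
      tens (letters (Fin.append α β) (List.ofFn σ.symm))

/-- The subspace of the tensor algebra spanned by the scalars and by the shuffle products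
of tensors of positive length. -/
noncomputable def shuffleSubmodule (gr : ℤ → Submodule K V) : Submodule K (TensorAlgebra K V) :=
  Submodule.span K ({1} ∪ {t | ∃ (p q : ℕ) (α : Fin p → Homog gr) (β : Fin q → Homog gr),
    1 ≤ p ∧ 1 ≤ q ∧ t = bat α β})

/-- The space `⊗̲⁺ V = ⨁_{n ≥ 1} (V^{⊗ n} / ∑_{p+q=n, p,q≥1} Im bat_{p,q})`. As the tensor algebra
is the direct sum of the scalars and of the `V^{⊗ n}` with `n ≥ 1`, dividing it by the scalars
and by the shuffles gives this space. -/
abbrev Packets (gr : ℤ → Submodule K V) : Type _ :=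
  TensorAlgebra K V ⧸ shuffleSubmodule gr

/-- The class `v_1 ⊗̲ … ⊗̲ v_n` (it is zero for `n = 0`). -/
noncomputable def packet (gr : ℤ → Submodule K V) (l : List V) : Packets gr :=
  Submodule.Quotient.mk (tens l)

/-- The class `α_1 ⊗̲ … ⊗̲ α_n` of a word of homogeneous elements. -/
noncomputable def packetOf {gr : ℤ → Submodule K V} {n : ℕ} (α : Fin n → Homog gr) :
    Packets gr :=
  packet gr (letters α (List.finRange n))

/-- The grading of `⊗̲⁺ V` by the sum of the degrees of the letters. -/
noncomputable def packetGr (gr : ℤ → Submodule K V) (x : ℤ) : Submodule K (Packets gr) :=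
  Submodule.span K {X | ∃ (n : ℕ) (α : Fin n → Homog gr), ∑ i, degs α i = x ∧ X = packetOf α}

end Tensors

/-! ### The graded symmetric coalgebra and `L∞` algebras -/

section Symmetric

variable {K : Type*} [Field K] {W : Type*} [AddCommGroup W] [Module K W]

/-- The subspace of the tensor algebra spanned by the scalars and by the elements
`u ⊗ x ⊗ y ⊗ v - (-1)^{|x||y|} u ⊗ y ⊗ x ⊗ v`, where `u`, `v` are tensors and `x`, `y` are
homogeneous. -/
noncomputable def symSubmodule (gr : ℤ → Submodule K W) : Submodule K (TensorAlgebra K W) :=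
  Submodule.span K ({1} ∪ {t | ∃ (u v : List W) (x y : Homog gr),
    t = tens (u ++ (x.2 : W) :: (y.2 : W) :: v) -
      (x.1 * y.1).negOnePow • tens (u ++ (y.2 : W) :: (x.2 : W) :: v)})

/-- The graded symmetric space `S⁺(W) = ⨁_{n ≥ 1} Sⁿ(W)`: the tensor algebra without
its scalars, divided by graded commutativity. -/
abbrev SymPlus (gr : ℤ → Submodule K W) : Type _ :=
  TensorAlgebra K W ⧸ symSubmodule gr

/-- The product `X_1 … X_n` in `S⁺(W)` (it is zero for `n = 0`). -/
noncomputable def symProd (gr : ℤ → Submodule K W) (l : List W) : SymPlus gr :=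
  Submodule.Quotient.mk (tens l)

/-- The product `X_{i_1} … X_{i_r}` of homogeneous elements. -/
noncomputable def symProdOf {gr : ℤ → Submodule K W} {n : ℕ} (X : Fin n → Homog gr)
    (idx : List (Fin n)) : SymPlus gr :=
  symProd gr (letters X idx)

/-- The grading of `S⁺(W)` by the sum of the degrees of the factors. -/
noncomputable def symGr (gr : ℤ → Submodule K W) (x : ℤ) : Submodule K (SymPlus gr) :=
  Submodule.span K {s | ∃ (n : ℕ) (X : Fin n → Homog gr),
    ∑ i, degs X i = x ∧ s = symProdOf X (List.finRange n)}

/-- The elements of a set of places, in increasing order. -/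
def places {n : ℕ} (I : Finset (Fin n)) : List (Fin n) :=
  (List.finRange n).filter (fun i => i ∈ I)

/-- The value `∑_{I ⊔ J = {1..n}, I, J ≠ ∅} ε(x_1 … x_n ; x_I x_J) X_I ⊗ X_J` of the
coproduct on `X_1 … X_n`. -/
noncomputable def coproductFormula {gr : ℤ → Submodule K W} {n : ℕ} (X : Fin n → Homog gr) :
    SymPlus gr ⊗[K] SymPlus gr :=
  ∑ I : Finset (Fin n) with I ≠ ∅ ∧ Iᶜ ≠ ∅,
    koszulSign (degs X) (places I ++ places Iᶜ) •
      (symProdOf X (places I) ⊗ₜ[K] symProdOf X (places Iᶜ))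

/-- The coproduct `Δ` of `S⁺(W)`. -/
noncomputable def coproduct (gr : ℤ → Submodule K W) :
    SymPlus gr →ₗ[K] SymPlus gr ⊗[K] SymPlus gr :=
  linearExt (fun X : (Σ n : ℕ, Fin n → Homog gr) => symProdOf X.2 (List.finRange X.1))
    (fun X => coproductFormula X.2)

/-- The value `∑_i ε(x_1 … x_n ; x_i x_1 … î … x_n) D(X_i).X_1 … î … X_n` on `X_1 … X_n`
of the extension of a linear map `D`. -/
noncomputable def extendOneFormula {gr : ℤ → Submodule K W} (D : W →ₗ[K] W) {n : ℕ}
    (X : Fin n → Homog gr) : SymPlus gr :=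
  ∑ i : Fin n, koszulSign (degs X) (i :: places {i}ᶜ) •
    symProd gr (D (X i).2 :: letters X (places {i}ᶜ))

/-- The extension to `S⁺(W)` of a linear map `D` on `W`. -/
noncomputable def extendOne (gr : ℤ → Submodule K W) (D : W →ₗ[K] W) :
    SymPlus gr →ₗ[K] SymPlus gr :=
  linearExt (fun X : (Σ n : ℕ, Fin n → Homog gr) => symProdOf X.2 (List.finRange X.1))
    (fun X => extendOneFormula D X.2)

/-- The value `∑_{i<j} ε(x_1 … x_n ; x_i x_j x_1 … î … ĵ … x_n) B(X_i,X_j).X_1 … î … ĵ … X_n` on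
`X_1 … X_n` of the extension of a bilinear map `B`. -/
noncomputable def extendTwoFormula {gr : ℤ → Submodule K W} (B : W →ₗ[K] W →ₗ[K] W) {n : ℕ}
    (X : Fin n → Homog gr) : SymPlus gr :=
  ∑ i : Fin n, ∑ j : Fin n with i < j,
    koszulSign (degs X) (i :: j :: places {i, j}ᶜ) •
      symProd gr (B (X i).2 (X j).2 :: letters X (places {i, j}ᶜ))

/-- The extension to `S⁺(W)` of a bilinear map `B` on `W`. -/
noncomputable def extendTwo (gr : ℤ → Submodule K W) (B : W →ₗ[K] W →ₗ[K] W) :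
    SymPlus gr →ₗ[K] SymPlus gr :=
  linearExt (fun X : (Σ n : ℕ, Fin n → Homog gr) => symProdOf X.2 (List.finRange X.1))
    (fun X => extendTwoFormula B X.2)

/-- `F` is a coderivation of degree `1` of `(S⁺(W), Δ)`:
`(F ⊗ id + id ⊗ F) ∘ Δ = Δ ∘ F`, where `(id ⊗ F)(X ⊗ Y) = (-1)^{|X|} X ⊗ F(Y)`. -/
structure IsCoderivation (gr : ℤ → Submodule K W) (F : SymPlus gr →ₗ[K] SymPlus gr) : Prop where
  degree_one : ∀ (i : ℤ), ∀ X ∈ symGr gr i, F X ∈ symGr gr (i + 1)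
  coleibniz : (TensorProduct.map F LinearMap.id +
      TensorProduct.map (signTwist (symGr gr) 1 LinearMap.id) F) ∘ₗ coproduct gr =
    coproduct gr ∘ₗ F

/-- `(S⁺(W), Δ, Q)` is an `L∞` algebra: `S⁺(W)` is a graded space, `Δ` is well defined on it by its
formula, of degree `0`, graded cocommutative and coassociative, and `Q` is a coderivation
of degree `1` and of square zero. -/
structure IsLInfinity (gr : ℤ → Submodule K W) (Q : SymPlus gr →ₗ[K] SymPlus gr) : Prop where
  graded : DirectSum.IsInternal (symGr gr)
  coproduct_apply : ∀ (n : ℕ) (X : Fin n → Homog gr),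
    coproduct gr (symProdOf X (List.finRange n)) = coproductFormula X
  coproduct_degree : ∀ (k : ℤ), ∀ X ∈ symGr gr k, coproduct gr X ∈
    Submodule.span K {t | ∃ (i j : ℤ) (Y Z : SymPlus gr),
      Y ∈ symGr gr i ∧ Z ∈ symGr gr j ∧ i + j = k ∧ t = Y ⊗ₜ[K] Z}
  cocommutative : flip (symGr gr) ∘ₗ coproduct gr = coproduct gr
  coassociative : (TensorProduct.assoc K (SymPlus gr) (SymPlus gr) (SymPlus gr)).toLinearMap ∘ₗ
      TensorProduct.map (coproduct gr) LinearMap.id ∘ₗ coproduct gr =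
    TensorProduct.map LinearMap.id (coproduct gr) ∘ₗ coproduct gr
  coderivation : IsCoderivation gr Q
  sq_zero : Q ∘ₗ Q = 0

end Symmetric

/-! ### Differential graded `(a,b)`-algebras and the operators on `H = ⊗̲⁺ A[-a+1]` -/

/-- A differential graded `(a,b)`-algebra: a graded vector space `A` with a product of degree `a`,
a bracket of degree `b` and a differential of degree `1` such that `A[-a]` is a
graded commutative associative differential algebra, `A[-b]` is a graded Lie differential algebra,
and the bracket acts by graded derivations of the product. -/
structure DiffABAlgebra (K A : Type*) [Field K] [AddCommGroup A] [Module K A] (a b : ℤ) where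
  gr : ℤ → Submodule K A
  graded : DirectSum.IsInternal gr
  mul : A →ₗ[K] A →ₗ[K] A
  br : A →ₗ[K] A →ₗ[K] A
  d : A →ₗ[K] A
  mul_mem : ∀ {i j : ℤ} {x y : A}, x ∈ gr i → y ∈ gr j → mul x y ∈ gr (i + j + a)
  br_mem : ∀ {i j : ℤ} {x y : A}, x ∈ gr i → y ∈ gr j → br x y ∈ gr (i + j + b)
  d_mem : ∀ {i : ℤ} {x : A}, x ∈ gr i → d x ∈ gr (i + 1)
  mul_comm : ∀ {i j : ℤ} {x y : A}, x ∈ gr i → y ∈ gr j →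
    mul x y = ((i + a) * (j + a)).negOnePow • mul y x
  mul_assoc : ∀ x y z : A, mul x (mul y z) = mul (mul x y) z
  br_antisymm : ∀ {i j : ℤ} {x y : A}, x ∈ gr i → y ∈ gr j →
    br x y = -(((i + b) * (j + b)).negOnePow • br y x)
  jacobi : ∀ {i j k : ℤ} {x y z : A}, x ∈ gr i → y ∈ gr j → z ∈ gr k →
    ((i + b) * (k + b)).negOnePow • br (br x y) z +
      ((j + b) * (i + b)).negOnePow • br (br y z) x +
      ((k + b) * (j + b)).negOnePow • br (br z x) y = 0
  leibniz : ∀ {i j : ℤ} {x y : A} (z : A), x ∈ gr i → y ∈ gr j →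
    br x (mul y z) = mul (br x y) z + ((j + a) * (i + b)).negOnePow • mul y (br x z)
  d_d : ∀ x : A, d (d x) = 0
  d_mul : ∀ {i : ℤ} {x : A} (y : A), x ∈ gr i →
    d (mul x y) = mul (d x) y + (i + a).negOnePow • mul x (d y)
  d_br : ∀ {i : ℤ} {x : A} (y : A), x ∈ gr i →
    d (br x y) = br (d x) y + (i + b).negOnePow • br x (d y)

namespace DiffABAlgebra

variable {K A : Type*} [Field K] [AddCommGroup A] [Module K A] {a b : ℤ}

/-- The grading of `A[-a+1]`, that is, by `dg(α) = |α| + a - 1`. -/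
def grV (P : DiffABAlgebra K A a b) : ℤ → Submodule K A :=
  shift P.gr (-a + 1)

/-- The product `μ(α,β) = (-1)^{dg α} α.β` on `A[-a+1]`. -/
def mu (P : DiffABAlgebra K A a b) (x y : Homog P.grV) : A :=
  x.1.negOnePow • P.mul x.2 y.2

/-- The bracket `ℓ(α,β) = (-1)^{(b-a+1) dg α} [α,β]` on `A[-a+1]`. -/
def ell (P : DiffABAlgebra K A a b) (x y : Homog P.grV) : A :=
  ((b - a + 1) * x.1).negOnePow • P.br x.2 y.2

/-- The space `H = ⊗̲⁺ A[-a+1]`. -/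
abbrev H (P : DiffABAlgebra K A a b) : Type _ := Packets P.grV

/-- The value of `D = d_1 + μ_1` on `α_1 ⊗̲ … ⊗̲ α_n`. -/
noncomputable def DFormula (P : DiffABAlgebra K A a b) {n : ℕ} (α : Fin n → Homog P.grV) : P.H :=
  (∑ k : Fin n, (∑ i : Fin n with i < k, degs α i).negOnePow •
    packet P.grV (replaceBlock α (List.finRange n) k 1 (P.d (α k).2))) +
  ∑ k : Fin n, ∑ k' : Fin n with k.val + 1 = k'.val,
    (∑ i : Fin n with i < k, degs α i).negOnePow •
      packet P.grV (replaceBlock α (List.finRange n) k 2 (P.mu (α k) (α k')))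

/-- The differential `D = d_1 + μ_1` of `H`. -/
noncomputable def D (P : DiffABAlgebra K A a b) : P.H →ₗ[K] P.H :=
  linearExt (fun α : (Σ n : ℕ, Fin n → Homog P.grV) => packetOf α.2) (fun α => P.DFormula α.2)

/-- The value of `ℓ_2` on two packets. With `γ` the concatenation of `α` and `β`, it is the sum
over the `(p,q)`-shuffles `σ` and the `k` with `σ⁻¹(k) ≤ p < σ⁻¹(k+1)` of
`ε(σ⁻¹) (-1)^{(b-a+1) ∑_{s<k} γ_{σ⁻¹(s)}}
  γ_{σ⁻¹(1)} ⊗̲ … ⊗̲ ℓ(γ_{σ⁻¹(k)}, γ_{σ⁻¹(k+1)}) ⊗̲ … ⊗̲ γ_{σ⁻¹(p+q)}`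
(places are counted from `0` in the code). -/
noncomputable def ell2Formula (P : DiffABAlgebra K A a b) {p q : ℕ} (α : Fin p → Homog P.grV)
    (β : Fin q → Homog P.grV) : P.H :=
  open Classical in
  ∑ σ : Equiv.Perm (Fin (p + q)) with IsShuffle p q σ,
    ∑ k : Fin (p + q),
      ∑ k' : Fin (p + q) with
          k.val + 1 = k'.val ∧ (σ.symm k).val < p ∧ p ≤ (σ.symm k').val,
        (koszulSign (degs (Fin.append α β)) (List.ofFn σ.symm) *
          ((b - a + 1) * ∑ s : Fin (p + q) with s < k,
            degs (Fin.append α β) (σ.symm s)).negOnePow) •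
        packet P.grV (replaceBlock (Fin.append α β) (List.ofFn σ.symm) k 2
          (P.ell (Fin.append α β (σ.symm k)) (Fin.append α β (σ.symm k'))))

/-- The bracket `ℓ_2` of `H`, of degree `b - a + 1`. -/
noncomputable def ell2 (P : DiffABAlgebra K A a b) : P.H →ₗ[K] P.H →ₗ[K] P.H :=
  linearExt (fun α : (Σ n : ℕ, Fin n → Homog P.grV) => packetOf α.2) (fun α =>
    linearExt (fun β : (Σ n : ℕ, Fin n → Homog P.grV) => packetOf β.2) (fun β =>
      P.ell2Formula α.2 β.2))

/-- The grading of `H[a-b-1]`, by `x' = dg(X) - a + b + 1`. -/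
noncomputable def gr' (P : DiffABAlgebra K A a b) : ℤ → Submodule K P.H :=
  shift (packetGr P.grV) (a - b - 1)

/-- The grading of `H[a-b]`, by `x'' = dg(X) - a + b`. -/
noncomputable def gr'' (P : DiffABAlgebra K A a b) : ℤ → Submodule K P.H :=
  shift (packetGr P.grV) (a - b)

/-- The bracket `ℓ'_2(X,Y) = (-1)^{(a-b-1) x'} ℓ_2(X,Y)` of `H[a-b-1]`. -/
noncomputable def ell2' (P : DiffABAlgebra K A a b) : P.H →ₗ[K] P.H →ₗ[K] P.H :=
  signTwist P.gr' (a - b - 1) P.ell2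

/-- The bracket `ℓ''_2(X,Y) = (-1)^{x''} ℓ'_2(X,Y)` of `H[a-b]`. -/
noncomputable def ell2'' (P : DiffABAlgebra K A a b) : P.H →ₗ[K] P.H →ₗ[K] P.H :=
  signTwist P.gr'' 1 P.ell2'

/-- The operator `m` of `S⁺(H[a-b])`, which extends `D`. -/
noncomputable def m (P : DiffABAlgebra K A a b) : SymPlus P.gr'' →ₗ[K] SymPlus P.gr'' :=
  extendOne P.gr'' P.D

/-- The operator `ℓ''` of `S⁺(H[a-b])`, which extends `ℓ''_2`. -/
noncomputable def l'' (P : DiffABAlgebra K A a b) : SymPlus P.gr'' →ₗ[K] SymPlus P.gr'' :=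
  extendTwo P.gr'' P.ell2''

/-- `Q = m + ℓ''`. -/
noncomputable def Q (P : DiffABAlgebra K A a b) : SymPlus P.gr'' →ₗ[K] SymPlus P.gr'' :=
  P.m + P.l''

/-- The operators that are prescribed by a formula are well defined: `H` is a graded space, `D` and
`ℓ_2` have the prescribed values on packets, `ℓ'_2` and `ℓ''_2` are the prescribed multiples
of `ℓ_2`, and `m` and `ℓ''` have the prescribed values on products. -/
structure WellDefined (P : DiffABAlgebra K A a b) : Prop where
  graded : DirectSum.IsInternal P.gr''
  D_apply : ∀ (n : ℕ) (α : Fin n → Homog P.grV), P.D (packetOf α) = P.DFormula α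
  ell2_apply : ∀ (p q : ℕ) (α : Fin p → Homog P.grV) (β : Fin q → Homog P.grV),
    P.ell2 (packetOf α) (packetOf β) = P.ell2Formula α β
  ell2'_apply : ∀ (x' : ℤ), ∀ X ∈ P.gr' x', ∀ Y : P.H,
    P.ell2' X Y = ((a - b - 1) * x').negOnePow • P.ell2 X Y
  ell2''_apply : ∀ (x'' : ℤ), ∀ X ∈ P.gr'' x'', ∀ Y : P.H,
    P.ell2'' X Y = x''.negOnePow • P.ell2' X Y
  m_apply : ∀ (n : ℕ) (X : Fin n → Homog P.gr''),
    P.m (symProdOf X (List.finRange n)) = extendOneFormula P.D X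
  l''_apply : ∀ (n : ℕ) (X : Fin n → Homog P.gr''),
    P.l'' (symProdOf X (List.finRange n)) = extendTwoFormula P.ell2'' X

end DiffABAlgebra

end ABHomotopy

set_option linter.unusedSimpArgs false
set_option linter.unnecessarySeqFocus false
set_option linter.unusedVariables false

/-! Most of the work takes place in the full tensor algebra T(V) of V = `A[-a+1]`, before dividing
by shuffles. Put k = b - a and β(x,y) = (-1)^x [x,y]. In the degrees of V the axioms of A say that d
and μ have degree 1, and that β is graded symmetric of degree 1 once degrees are shifted by k
(`LetterOps`). Three operations on T(V) are defined by recursion on first letters: the shuffle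
product `sh`, the bar differential `tD` built from d and μ, and the bracket `tB`, which shuffles two
words and contracts by β one adjacent pair coming from both.

The identities `tD_tD_wd`, `tD_sh_wd`, `tB_sh_wd`, `tB_comm_wd`, `tD_tB_wd` and `jacobi_wd` are
proved by induction on words. After expanding by the recursions, the terms in which a leading letter
stays untouched in front are the induction hypotheses, and what is left over reduces to identities
between letters: associativity and commutativity of μ, the Leibniz rules, the symmetry and the
Jacobi identity of β. The square-zero, Leibniz and Jacobi identities already hold on T(V). The
shuffle quotient matters because `tD` and `tB` are derivations of `sh`, hence preserve the span of
shuffles of nonempty words and descend to `pD` and `pB`.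

The formulas of the statement, sums over permutations with Koszul signs, satisfy the same recursions
(`applyAll_add_contract`, `sum_shufs_contract`). The successive sign twists then collapse to the
single relation that the bracket of `H[a-b]` is the negative of `pB` (`ell2''_eq`).

The second half uses only a differential and a graded symmetric bracket of degree 1 with their
identities (`ShiftedLie`). On the unital graded symmetric algebra, m, ad x and ℓ'' satisfy
recursions F(xY) = G(x)Y ± xF(Y), with G(x) respectively multiplication by Dx, the operator y ↦
B(x,y) followed by multiplication, and ad x itself. Induction gives m² = 0, mℓ'' + ℓ''m = 0 and ℓ''²
= 0. Letters are primitive for the coproduct, so multiplication by a letter obeys the co-Leibniz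
rule, and that rule propagates through the recursion (`IsExt.onTwo_coprodS`). Dividing by the unit
turns the unital coproduct into the reduced one of the statement. -/

namespace ABHomotopy

/-! ### Signs -/

section Sign

variable (K : Type*) [Field K]

/-- The sign `(-1)^n` as a scalar. -/
def sg (n : ℤ) : K := ((n.negOnePow : ℤ) : K)

theorem sg_add (m n : ℤ) : sg K (m + n) = sg K m * sg K n := by
  simp [sg, Int.negOnePow_add]

@[simp] theorem sg_zero : sg K 0 = 1 := by simp [sg]

@[simp] theorem sg_one : sg K 1 = -1 := by simp [sg]

theorem sg_mul_self (n : ℤ) : sg K n * sg K n = 1 := by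
  rw [← sg_add, sg, Int.negOnePow_even _ ⟨n, rfl⟩]; simp

theorem sg_sq (n : ℤ) : sg K n ^ 2 = 1 := by rw [pow_two, sg_mul_self]

theorem sg_cube (n : ℤ) : sg K n ^ 3 = sg K n := by rw [pow_succ, sg_sq, one_mul]

theorem sg_pow_four (n : ℤ) : sg K n ^ 4 = 1 := by rw [pow_succ, sg_cube, sg_mul_self]

theorem sg_self_mul (n : ℤ) : sg K (n * n) = sg K n := by
  simp [sg, Int.negOnePow_mul_self]

/-- Lets equalities of exponents be checked exhaustively in `ZMod 2`. -/
theorem sg_congr {m n : ℤ} (h : (m : ZMod 2) = n) : sg K m = sg K n := by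
  have h2 : m.negOnePow = n.negOnePow := by
    rw [Int.negOnePow_eq_iff, ← ZMod.intCast_eq_zero_iff_even]
    push_cast
    rw [h, sub_self]
  rw [sg, h2, sg]

variable {K}

/-- The definitions act by units of ℤ. Signs taken in K can be compared by `match_scalars` and
`ring_nf`, so every sign is converted. -/
theorem negOnePow_smul {M : Type*} [AddCommGroup M] [Module K M] (n : ℤ) (x : M) :
    n.negOnePow • x = sg K n • x := by
  rw [sg, Int.cast_smul_eq_zsmul, Units.smul_def]

end Sign

/-! ### Linear maps on graded spaces -/

section ByDegree

variable {K : Type*} [Field K] {V M : Type*} [AddCommGroup V] [Module K V] [AddCommGroup M]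
  [Module K M] {gr : ℤ → Submodule K V}

/-- The linear map that is `f i` on the component of degree `i`. -/
noncomputable def byDegree {M : Type*} [AddCommMonoid M] [Module K M]
    (h : DirectSum.IsInternal gr) (f : ℤ → V →ₗ[K] M) : V →ₗ[K] M :=
  (DirectSum.toModule K ℤ M fun i => (f i) ∘ₗ (gr i).subtype) ∘ₗ
    (LinearEquiv.ofBijective (DirectSum.coeLinearMap gr) h).symm.toLinearMap

theorem byDegree_apply {M : Type*} [AddCommMonoid M] [Module K M] (h : DirectSum.IsInternal gr) (f : ℤ → V →ₗ[K] M) {i : ℤ} {x : V}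
    (hx : x ∈ gr i) : byDegree h f x = f i x := by
  have : (LinearEquiv.ofBijective (DirectSum.coeLinearMap gr) h).symm x =
      DirectSum.lof K ℤ (fun i => gr i) i ⟨x, hx⟩ := by
    rw [LinearEquiv.symm_apply_eq]
    exact (DirectSum.coeLinearMap_lof gr i ⟨x, hx⟩).symm
  simp [byDegree, this]

theorem induction_homog (h : DirectSum.IsInternal gr) {p : V → Prop}
    (h0 : p 0) (hadd : ∀ x y, p x → p y → p (x + y)) (hp : ∀ i, ∀ x ∈ gr i, p x) (x : V) :
    p x := by
  have hx : x ∈ ⨆ i, gr i := by rw [h.submodule_iSup_eq_top]; trivial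
  exact Submodule.iSup_induction gr (motive := p) hx hp h0 hadd

theorem ext_homog (h : DirectSum.IsInternal gr) {f g : V →ₗ[K] M}
    (hfg : ∀ i, ∀ x ∈ gr i, f x = g x) : f = g := by
  ext x
  exact induction_homog h (by simp) (fun x y hx hy => by simp [hx, hy]) hfg x

/-- An element of `gr i` lying in the sum of the other components is both fixed and killed by `p i`,
hence zero. -/
theorem isInternal_of_proj {gr : ℤ → Submodule K V} (p : ℤ → V →ₗ[K] V)
    (hp : ∀ i, ∀ x ∈ gr i, p i x = x) (hp' : ∀ i j, i ≠ j → ∀ x ∈ gr i, p j x = 0)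
    (hs : ⨆ i, gr i = ⊤) : DirectSum.IsInternal gr := by
  rw [DirectSum.isInternal_submodule_iff_iSupIndep_and_iSup_eq_top]
  refine ⟨fun i => ?_, hs⟩
  rw [Submodule.disjoint_def]
  intro x hx hx'
  have : (⨆ j, ⨆ (_ : j ≠ i), gr j) ≤ LinearMap.ker (p i) :=
    iSup₂_le fun j hj y hy => hp' j i hj y hy
  rw [← hp i x hx]
  exact this hx'

theorem isInternal_shift (h : DirectSum.IsInternal gr) (k : ℤ) :
    DirectSum.IsInternal (shift gr k) := by
  rw [DirectSum.isInternal_submodule_iff_iSupIndep_and_iSup_eq_top] at h ⊢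
  refine ⟨h.1.comp (add_left_injective k), ?_⟩
  rw [← h.2]
  exact (Equiv.addRight k).iSup_comp (g := gr)

/-- The map `X ↦ (-1)^{k |X|} X`. -/
noncomputable def sgn (h : DirectSum.IsInternal gr) (k : ℤ) : V →ₗ[K] V :=
  byDegree h fun i => sg K (k * i) • LinearMap.id

theorem sgn_apply (h : DirectSum.IsInternal gr) (k : ℤ) {i : ℤ} {x : V} (hx : x ∈ gr i) :
    sgn h k x = sg K (k * i) • x := by
  rw [sgn, byDegree_apply h _ hx]; simp

theorem signTwist_eq (h : DirectSum.IsInternal gr) (c : ℤ) (f : V →ₗ[K] M) :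
    signTwist gr c f = f ∘ₗ sgn h c := by
  have hex : ∃ F : V →ₗ[K] M, ∀ X : Homog gr, F (X.2 : V) = (c * X.1).negOnePow • f X.2 :=
    ⟨f ∘ₗ sgn h c, fun X => by simp [sgn_apply h c X.2.2, negOnePow_smul (K := K)]⟩
  refine ext_homog h fun i x hx => ?_
  have := linearExt_apply hex ⟨i, x, hx⟩
  simp only at this
  rw [signTwist, this]
  simp [sgn_apply h c hx, negOnePow_smul (K := K)]

/-- A spanning family admits at most one candidate, so exhibiting a linear map with the prescribed
values identifies the operator and excludes the default value 0. -/
theorem linearExt_eq {N ι : Type*} [AddCommGroup N] [Module K N] {g : ι → V} {f : ι → N}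
    (hg : Submodule.span K (Set.range g) = ⊤) (F : V →ₗ[K] N) (hF : ∀ w, F (g w) = f w) :
    linearExt g f = F := by
  refine LinearMap.ext_on hg ?_
  rintro _ ⟨w, rfl⟩
  rw [linearExt_apply ⟨F, hF⟩ w, hF]

end ByDegree

/-! ### Recursion in the tensor algebra -/

section Tensor

variable {K : Type*} [Field K] {V : Type*} [AddCommGroup V] [Module K V]

/-- Left multiplication by a letter. -/
noncomputable def lmul (K : Type*) [Field K] {V : Type*} [AddCommGroup V] [Module K V] :
    V →ₗ[K] TensorAlgebra K V →ₗ[K] TensorAlgebra K V :=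
  LinearMap.mul K (TensorAlgebra K V) ∘ₗ TensorAlgebra.ι K

@[simp] theorem lmul_apply (x : V) (t : TensorAlgebra K V) :
    lmul K x t = TensorAlgebra.ι K x * t := rfl

/-- The linear map `F` with `F 1 = m` and `F (x t) = g x (F t)`. -/
noncomputable def fold {M : Type*} [AddCommGroup M] [Module K M] (g : V →ₗ[K] M →ₗ[K] M) (m : M) :
    TensorAlgebra K V →ₗ[K] M :=
  (LinearMap.applyₗ m) ∘ₗ (TensorAlgebra.lift K (A := Module.End K M) g).toLinearMap

section fold
variable {M : Type*} [AddCommGroup M] [Module K M] (g : V →ₗ[K] M →ₗ[K] M) (m : M)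

@[simp] theorem fold_one : fold g m 1 = m := by
  simp [fold]

@[simp] theorem fold_ι_mul (x : V) (t : TensorAlgebra K V) :
    fold g m (TensorAlgebra.ι K x * t) = g x (fold g m t) := by
  simp [fold]

end fold

/-- The elements whose left multiplication preserves `p` include scalars and letters and are closed
under sums and products, so they are everything. Apply this to 1. -/
theorem tensor_induction {p : TensorAlgebra K V → Prop} (h1 : p 1)
    (hadd : ∀ s t, p s → p t → p (s + t)) (hsmul : ∀ (r : K) t, p t → p (r • t))
    (hι : ∀ x t, p t → p (TensorAlgebra.ι K x * t)) (t : TensorAlgebra K V) : p t := by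
  have : ∀ s t : TensorAlgebra K V, p t → p (s * t) := by
    intro s
    induction s using TensorAlgebra.induction with
    | algebraMap r => intro t ht; rw [← Algebra.smul_def]; exact hsmul r t ht
    | ι x => exact hι x
    | mul a b ha hb => intro t ht; rw [mul_assoc]; exact ha _ (hb _ ht)
    | add a b ha hb => intro t ht; rw [add_mul]; exact hadd _ _ (ha _ ht) (hb _ ht)
  simpa using this t 1 h1

section para
variable {M : Type*} [AddCommGroup M] [Module K M] (ρ : V →ₗ[K] M →ₗ[K] M)
  (q : M × (V →ₗ[K] TensorAlgebra K V →ₗ[K] M))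

/-- The recursion step of `para`. -/
noncomputable def paraStep : V →ₗ[K]
    (TensorAlgebra K V × ((M × (V →ₗ[K] TensorAlgebra K V →ₗ[K] M)) →ₗ[K] M)) →ₗ[K]
    (TensorAlgebra K V × ((M × (V →ₗ[K] TensorAlgebra K V →ₗ[K] M)) →ₗ[K] M)) :=
  -- The state at a tensor t is t itself together with the value as a linear function of (m, G).
  -- Carrying t lets G see the tail. Keeping (m, G) variable makes the result linear in the data, as
  -- the nested recursions for shuffle and bracket require.
  LinearMap.mk₂ K (fun x s => (TensorAlgebra.ι K x * s.1,
      ρ x ∘ₗ s.2 + LinearMap.applyₗ s.1 ∘ₗ LinearMap.applyₗ x ∘ₗ LinearMap.snd K _ _))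
      (fun x y s => by
        ext : 1
        · simp [add_mul]
        · ext : 1 <;> ext <;> simp; abel)
      (fun r x s => by
        ext : 1
        · simp
        · ext : 1 <;> ext <;> simp)
      (fun x s t => by
        ext : 1
        · simp [mul_add]
        · ext : 1 <;> ext <;> simp; abel)
      (fun r x s => by
        ext : 1
        · simp
        · ext : 1 <;> ext <;> simp)

theorem paraStep_apply (x : V)
    (s : TensorAlgebra K V × ((M × (V →ₗ[K] TensorAlgebra K V →ₗ[K] M)) →ₗ[K] M)) :
    paraStep ρ x s = (TensorAlgebra.ι K x * s.1,
      ρ x ∘ₗ s.2 + LinearMap.applyₗ s.1 ∘ₗ LinearMap.applyₗ x ∘ₗ LinearMap.snd K _ _) := rfl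

/-- The linear map `F` with `F 1 = m` and `F (x t) = ρ x (F t) + G x t`, as a linear function
of `(m, G)`. -/
noncomputable def para :
    (M × (V →ₗ[K] TensorAlgebra K V →ₗ[K] M)) →ₗ[K] TensorAlgebra K V →ₗ[K] M :=
  LinearMap.flip (LinearMap.snd K _ _ ∘ₗ fold (paraStep ρ) (1, LinearMap.fst K _ _))

@[simp] theorem para_one : para ρ q 1 = q.1 := by
  simp [para]

theorem fold_paraStep_fst (t : TensorAlgebra K V) :
    (fold (paraStep ρ) (1, LinearMap.fst K _ _) t).1 = t := by
  induction t using tensor_induction with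
  | h1 => simp
  | hadd s t hs ht => simp [hs, ht]
  | hsmul r t ht => simp [ht]
  | hι x t ht => simp [paraStep_apply, ht]

@[simp] theorem para_ι_mul (x : V) (t : TensorAlgebra K V) :
    para ρ q (TensorAlgebra.ι K x * t) = ρ x (para ρ q t) + q.2 x t := by
  simp only [para, LinearMap.flip_apply, LinearMap.comp_apply, fold_ι_mul]
  simp [paraStep_apply, fold_paraStep_fst]

end para

/-! ### Words -/

section Words

variable {gr : ℤ → Submodule K V}

/-- The tensor of a word of homogeneous letters. -/
noncomputable def wd (l : List (Homog gr)) : TensorAlgebra K V :=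
  tens (l.map fun x => (x.2 : V))

/-- The degree of a word of homogeneous letters. -/
def wdeg (l : List (Homog gr)) : ℤ := (l.map fun x => x.1).sum

@[simp] theorem tens_nil : tens ([] : List V) = (1 : TensorAlgebra K V) := rfl

@[simp] theorem tens_cons (x : V) (l : List V) :
    tens (x :: l) = TensorAlgebra.ι K x * tens l := by simp [tens]

@[simp] theorem wd_nil : wd ([] : List (Homog gr)) = 1 := rfl

@[simp] theorem wd_cons (x : Homog gr) (l : List (Homog gr)) :
    wd (x :: l) = TensorAlgebra.ι K (x.2 : V) * wd l := by simp [wd]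

@[simp] theorem wdeg_nil : wdeg ([] : List (Homog gr)) = 0 := rfl

@[simp] theorem wdeg_cons (x : Homog gr) (l : List (Homog gr)) :
    wdeg (x :: l) = x.1 + wdeg l := by simp [wdeg]

variable (gr)

/-- The grading of the tensor algebra by the sum of the degrees of the letters. -/
def Tgr (n : ℤ) : Submodule K (TensorAlgebra K V) :=
  Submodule.span K {t | ∃ l : List (Homog gr), wdeg l = n ∧ t = wd l}

variable {gr}

theorem wd_mem (l : List (Homog gr)) : wd l ∈ Tgr gr (wdeg l) :=
  Submodule.subset_span ⟨l, rfl, rfl⟩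

theorem one_mem_Tgr : (1 : TensorAlgebra K V) ∈ Tgr gr 0 :=
  wd_mem (gr := gr) []

theorem ι_mul_mem {i n : ℤ} {x : V} {t : TensorAlgebra K V} (hx : x ∈ gr i) (ht : t ∈ Tgr gr n) :
    TensorAlgebra.ι K x * t ∈ Tgr gr (i + n) := by
  have : Tgr gr n ≤ (Tgr gr (i + n)).comap (lmul K x) := by
    refine Submodule.span_le.2 ?_
    rintro _ ⟨l, rfl, rfl⟩
    refine Submodule.subset_span ⟨⟨i, x, hx⟩ :: l, by simp, by simp⟩
  exact this ht

theorem span_words (h : DirectSum.IsInternal gr) :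
    Submodule.span K (Set.range (wd (gr := gr))) = ⊤ := by
  rw [eq_top_iff]
  rintro t -
  induction t using tensor_induction with
  | h1 => exact Submodule.subset_span ⟨[], rfl⟩
  | hadd s t hs ht => exact add_mem hs ht
  | hsmul r t ht => exact Submodule.smul_mem _ _ ht
  | hι x t ht =>
    induction x using induction_homog h with
    | h0 => simp
    | hadd x y hx hy => rw [map_add, add_mul]; exact add_mem hx hy
    | hp i x hx =>
      have : Submodule.span K (Set.range (wd (gr := gr))) ≤
          (Submodule.span K (Set.range (wd (gr := gr)))).comap (lmul K x) := by
        refine Submodule.span_le.2 ?_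
        rintro _ ⟨l, rfl⟩
        exact Submodule.subset_span ⟨⟨i, x, hx⟩ :: l, by simp⟩
      exact this ht

theorem ext_words {M : Type*} [AddCommGroup M] [Module K M] (h : DirectSum.IsInternal gr)
    {F G : TensorAlgebra K V →ₗ[K] M} (hFG : ∀ l : List (Homog gr), F (wd l) = G (wd l)) :
    F = G := by
  refine LinearMap.ext_on (span_words h) ?_
  rintro _ ⟨l, rfl⟩
  exact hFG l

theorem eq_on_Tgr {M : Type*} [AddCommGroup M] [Module K M]
    {F G : TensorAlgebra K V →ₗ[K] M} {n : ℤ}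
    (hFG : ∀ l : List (Homog gr), wdeg l = n → F (wd l) = G (wd l)) {t : TensorAlgebra K V}
    (ht : t ∈ Tgr gr n) : F t = G t := by
  refine LinearMap.eqOn_span (s := {t | ∃ l : List (Homog gr), wdeg l = n ∧ t = wd l}) ?_ ht
  rintro _ ⟨l, hl, rfl⟩
  exact hFG l hl

theorem mem_of_words {M : Type*} [AddCommGroup M] [Module K M]
    {F : TensorAlgebra K V →ₗ[K] M} {N : Submodule K M} {n : ℤ}
    (hF : ∀ l : List (Homog gr), wdeg l = n → F (wd l) ∈ N) {t : TensorAlgebra K V}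
    (ht : t ∈ Tgr gr n) : F t ∈ N := by
  have : Tgr gr n ≤ N.comap F := by
    refine Submodule.span_le.2 ?_
    rintro _ ⟨l, hl, rfl⟩
    exact hF l hl
  exact this ht

theorem iSup_Tgr (h : DirectSum.IsInternal gr) : ⨆ n, Tgr gr n = ⊤ := by
  rw [eq_top_iff, ← span_words h, Submodule.span_le]
  rintro _ ⟨l, rfl⟩
  exact Submodule.mem_iSup_of_mem _ (wd_mem l)

/-- The family of the homogeneous components of a tensor. -/
noncomputable def comps (h : DirectSum.IsInternal gr) :
    TensorAlgebra K V →ₗ[K] (ℤ → TensorAlgebra K V) :=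
  fold (byDegree h fun i => LinearMap.mk₂ K (fun x f n => TensorAlgebra.ι K x * f (n - i))
    (fun x y f => by ext; simp [add_mul]) (fun r x f => by ext; simp)
    (fun x f g => by ext; simp [mul_add]) (fun r x f => by ext; simp)) (Pi.single 0 1)

theorem comps_wd (h : DirectSum.IsInternal gr) (l : List (Homog gr)) :
    comps h (wd l) = Pi.single (wdeg l) (wd l) := by
  induction l with
  | nil => simp [comps]
  | cons x l ih =>
    rw [comps] at ih ⊢
    rw [wd_cons, fold_ι_mul, ih, byDegree_apply h _ x.2.2]
    ext n
    by_cases hn : n = x.1 + wdeg l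
    · subst hn; simp
    · have : n - x.1 ≠ wdeg l := fun h => hn (by omega)
      simp [hn, this]

/-- A quotient of the tensor algebra by homogeneous relations is graded. -/
theorem isInternal_quotient (h : DirectSum.IsInternal gr) (R : Set (TensorAlgebra K V))
    (hR : ∀ r ∈ R, ∃ n, r ∈ Tgr gr n) :
    DirectSum.IsInternal fun n => (Tgr gr n).map (Submodule.span K R).mkQ := by
  have key : ∀ i n, ∀ t ∈ Tgr gr n, comps h t i = if i = n then t else 0 := by
    intro i n t ht
    split_ifs with hi
    · subst hi
      refine eq_on_Tgr (F := LinearMap.proj i ∘ₗ comps h) (G := LinearMap.id) ?_ ht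
      rintro l rfl
      simp [comps_wd]
    · refine eq_on_Tgr (F := LinearMap.proj i ∘ₗ comps h) (G := 0) ?_ ht
      rintro l rfl
      simp [comps_wd, hi]
  -- The components of a homogeneous relation are the relation itself and zeros, so each component
  -- projection descends to the quotient.
  have hN : ∀ i, Submodule.span K R ≤
      LinearMap.ker ((Submodule.span K R).mkQ ∘ₗ LinearMap.proj i ∘ₗ comps h) := by
    intro i
    refine Submodule.span_le.2 fun r hr => ?_
    obtain ⟨n, hn⟩ := hR r hr
    simp only [SetLike.mem_coe, LinearMap.mem_ker, LinearMap.comp_apply, LinearMap.proj_apply,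
      key i n r hn]
    split_ifs
    · simpa using Submodule.subset_span hr
    · simp
  refine isInternal_of_proj (fun i => Submodule.liftQ _ _ (hN i)) ?_ ?_ ?_
  · rintro i _ ⟨t, ht, rfl⟩
    simp [key i i t ht]
  · rintro i j hij _ ⟨t, ht, rfl⟩
    simp [key j i t ht, hij.symm]
  · rw [← Submodule.map_iSup, iSup_Tgr h, Submodule.map_top, Submodule.range_mkQ]

theorem isInternal_Tgr (h : DirectSum.IsInternal gr) : DirectSum.IsInternal (Tgr gr) := by
  refine isInternal_of_proj (fun i => LinearMap.proj i ∘ₗ comps h) ?_ ?_ (iSup_Tgr h)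
  · intro i t ht
    refine eq_on_Tgr (F := LinearMap.proj i ∘ₗ comps h) (G := LinearMap.id) ?_ ht
    rintro l rfl
    simp [comps_wd]
  · intro i j hij t ht
    refine eq_on_Tgr (F := LinearMap.proj j ∘ₗ comps h) (G := 0) ?_ ht
    rintro l rfl
    simp [comps_wd, hij.symm]

end Words

end Tensor

/-! ### The signed shuffle product on the tensor algebra. -/

section Shuffle

variable {K : Type*} [Field K] {V : Type*} [AddCommGroup V] [Module K V]
  {gr : ℤ → Submodule K V}

/-- The recursion step of the shuffle product: insertion of a letter on the right hand side. -/
noncomputable def shStep (h : DirectSum.IsInternal gr) (j : ℤ) :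
    V →ₗ[K] (TensorAlgebra K V →ₗ[K] TensorAlgebra K V) →ₗ[K]
      (TensorAlgebra K V →ₗ[K] TensorAlgebra K V) :=
  -- Here `φ` plays the role of X ↦ X ⧢ Y, and the result is X ↦ X ⧢ bY, by recursion on X. At X = 1
  -- only b in front of Y remains. The sign operator acts on the whole word aX that b overtakes.
  LinearMap.mk₂ K (fun b φ => para (lmul K) (TensorAlgebra.ι K b * φ 1,
      (lmul K).compr₂ (lmul K b ∘ₗ φ ∘ₗ sgn (isInternal_Tgr h) j)))
    (fun b b' φ => by
      rw [← map_add]; congr 1; ext <;> simp [add_mul])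
    (fun r b φ => by
      rw [← map_smul]; congr 1; ext <;> simp)
    (fun b φ φ' => by
      rw [← map_add]; congr 1; ext <;> simp [mul_add])
    (fun r b φ => by
      rw [← map_smul]; congr 1; ext <;> simp)

/-- The signed shuffle product. -/
noncomputable def sh (h : DirectSum.IsInternal gr) :
    TensorAlgebra K V →ₗ[K] TensorAlgebra K V →ₗ[K] TensorAlgebra K V :=
  (fold (byDegree h (shStep h)) LinearMap.id).flip

variable (h : DirectSum.IsInternal gr)

@[simp] theorem sh_one_right (X : TensorAlgebra K V) : sh h X 1 = X := by
  simp [sh]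

@[simp] theorem sh_one_left (Y : TensorAlgebra K V) : sh h 1 Y = Y := by
  have : sh h 1 = LinearMap.id := by
    refine ext_words h fun l => ?_
    induction l with
    | nil => simp
    | cons x l ih =>
      simp only [sh, LinearMap.flip_apply] at ih
      simp [sh, byDegree_apply h _ x.2.2, shStep, ih]
  rw [this]; rfl

/-- A shuffle starts with a or with b, and in the second case b has passed all of aX. With the unit
rules, this recursion is the working description of the product. -/
theorem sh_cons {i m j : ℤ} {a b : V} {X : TensorAlgebra K V} (ha : a ∈ gr i) (hX : X ∈ Tgr gr m)
    (hb : b ∈ gr j) (Y : TensorAlgebra K V) :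
    sh h (TensorAlgebra.ι K a * X) (TensorAlgebra.ι K b * Y) =
      TensorAlgebra.ι K a * sh h X (TensorAlgebra.ι K b * Y) +
        sg K (j * (i + m)) •
          (TensorAlgebra.ι K b * sh h (TensorAlgebra.ι K a * X) Y) := by
  simp [sh, byDegree_apply h _ hb, shStep, sgn_apply _ _ (ι_mul_mem ha hX)]

theorem Tgr_cast {m n : ℤ} {X : TensorAlgebra K V} (hX : X ∈ Tgr gr m) (e : m = n) :
    X ∈ Tgr gr n := e ▸ hX

theorem bilin_mem {F : TensorAlgebra K V →ₗ[K] TensorAlgebra K V →ₗ[K] TensorAlgebra K V}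
    {c : ℤ} (hF : ∀ u v : List (Homog gr), F (wd u) (wd v) ∈ Tgr gr (wdeg u + wdeg v + c))
    {m n : ℤ} {X Y : TensorAlgebra K V}
    (hX : X ∈ Tgr gr m) (hY : Y ∈ Tgr gr n) : F X Y ∈ Tgr gr (m + n + c) := by
  refine mem_of_words (F := F.flip Y) ?_ hX
  rintro u rfl
  refine mem_of_words (F := F (wd u)) ?_ hY
  rintro v rfl
  exact hF u v

theorem eq_on_Tgr₂ {M : Type*} [AddCommGroup M] [Module K M]
    {F G : TensorAlgebra K V →ₗ[K] TensorAlgebra K V →ₗ[K] M} {m n : ℤ}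
    (hF : ∀ u v : List (Homog gr), wdeg u = m → wdeg v = n → F (wd u) (wd v) = G (wd u) (wd v))
    {X Y : TensorAlgebra K V}
    (hX : X ∈ Tgr gr m) (hY : Y ∈ Tgr gr n) : F X Y = G X Y := by
  refine eq_on_Tgr (F := F.flip Y) (G := G.flip Y) ?_ hX
  intro u hu
  refine eq_on_Tgr (F := F (wd u)) (G := G (wd u)) ?_ hY
  intro v hv
  exact hF u v hu hv

theorem sh_mem {m n : ℤ} {X Y : TensorAlgebra K V} (hX : X ∈ Tgr gr m) (hY : Y ∈ Tgr gr n) :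
    sh h X Y ∈ Tgr gr (m + n) := by
  rw [← add_zero (m + n)]
  refine bilin_mem (F := sh h) ?_ hX hY
  intro u v
  rw [add_zero]
  induction u generalizing v with
  | nil => simpa using wd_mem v
  | cons a u ihu =>
    induction v with
    | nil => simpa using wd_mem (a :: u)
    | cons b v ihv =>
      rw [wd_cons, wd_cons, sh_cons h a.2.2 (wd_mem u) b.2.2, ← wd_cons, ← wd_cons]
      refine add_mem ?_ (Submodule.smul_mem _ _ ?_)
      · exact Tgr_cast (ι_mul_mem a.2.2 (ihu (b :: v))) (by simp; ring)
      · exact Tgr_cast (ι_mul_mem b.2.2 ihv) (by simp; ring)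

/-- Exchanging the two words exchanges the two terms of the recursion. -/
theorem sh_comm_wd (u v : List (Homog gr)) :
    sh h (wd u) (wd v) = sg K (wdeg u * wdeg v) • sh h (wd v) (wd u) := by
  induction u generalizing v with
  | nil => simp
  | cons a u ihu =>
    induction v with
    | nil => simp
    | cons b v ihv =>
      have e1 := ihu (b :: v)
      simp only [wd_cons, wdeg_cons] at e1 ihv ⊢
      rw [sh_cons h a.2.2 (wd_mem u) b.2.2, sh_cons h b.2.2 (wd_mem v) a.2.2, e1, ihv]
      simp only [mul_smul_comm, smul_add, smul_smul]
      -- Every remaining coefficient is a product of signs. Expanding exponents with `sg_add` into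
      -- signs of monomials and cancelling even powers decides equality. The same normalization
      -- closes the later sign computations.
      match_scalars <;>
      · try simp only [sg_add, add_mul, mul_add]
        ring_nf
        try simp only [sg_sq, sg_cube]
        try ring_nf

theorem sh_comm {m n : ℤ} {X Y : TensorAlgebra K V} (hX : X ∈ Tgr gr m) (hY : Y ∈ Tgr gr n) :
    sh h X Y = sg K (m * n) • sh h Y X := by
  refine eq_on_Tgr₂ (F := sh h) (G := sg K (m * n) • (sh h).flip) ?_ hX hY
  rintro u v rfl rfl
  simpa using sh_comm_wd h u v

/-- The terms are grouped by the letter a, b or c that comes first. Each group is an induction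
hypothesis with that letter in front. -/
theorem sh_assoc_wd (u v w : List (Homog gr)) :
    sh h (sh h (wd u) (wd v)) (wd w) = sh h (wd u) (sh h (wd v) (wd w)) := by
  induction u generalizing v w with
  | nil => simp
  | cons a u ihu =>
    induction v generalizing w with
    | nil => simp
    | cons b v ihv =>
      induction w with
      | nil => simp
      | cons c w ihw =>
        have e1 := congrArg (lmul K (a.2 : V)) (ihu (b :: v) (c :: w))
        have e2 := congrArg (lmul K (b.2 : V)) (ihv (c :: w))
        have e3 := congrArg (lmul K (c.2 : V)) ihw
        have hu := wd_mem u
        have hv := wd_mem v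
        have hw := wd_mem w
        have hau := ι_mul_mem a.2.2 hu
        have hbv := ι_mul_mem b.2.2 hv
        have hcw := ι_mul_mem c.2.2 hw
        simp only [wd_cons, wdeg_cons, lmul_apply] at e1 e2 e3 hau hbv hcw ⊢
        simp only [sh_cons h a.2.2 hu b.2.2, sh_cons h b.2.2 hv c.2.2, map_add, map_smul,
          LinearMap.add_apply, LinearMap.smul_apply,
          sh_cons h a.2.2 (sh_mem h hu hbv) c.2.2, sh_cons h b.2.2 (sh_mem h hau hv) c.2.2,
          sh_cons h a.2.2 hu c.2.2, mul_add, smul_add, mul_smul_comm] at e1 e2 e3 ⊢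
        -- The coefficients are the signs for moving b past au, and c past au and bv.
        linear_combination (norm := skip) e1 + sg K (b.1 * (a.1 + wdeg u)) • e2 +
          sg K (c.1 * (a.1 + wdeg u + b.1 + wdeg v)) • e3
        match_scalars <;>
        · try simp only [sg_add, add_mul, mul_add]
          ring_nf
          try simp only [sg_sq, sg_cube]
          try ring_nf

theorem sh_assoc (X Y Z : TensorAlgebra K V) : sh h (sh h X Y) Z = sh h X (sh h Y Z) := by
  have : (sh h).compr₂ (sh h) =
      (LinearMap.llcomp K _ _ _).flip (sh h) ∘ₗ (LinearMap.llcomp K _ _ _) ∘ₗ sh h := by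
    refine ext_words h fun u => ext_words h fun v => ext_words h fun w => ?_
    simpa using sh_assoc_wd h u v w
  simpa using congr($this X Y Z)

end Shuffle

/-! ### The bar differential and the bracket on the tensor algebra. -/

section Operations

variable {K : Type*} [Field K] {V : Type*} [AddCommGroup V] [Module K V]

/-- A graded space with a differential, a product of degree `1` and a bracket of degree `1` for
the grading shifted by `k`. These are the operations on letters that extend to words. -/
structure LetterOps (gr : ℤ → Submodule K V) (k : ℤ) where
  graded : DirectSum.IsInternal gr
  d : V →ₗ[K] V
  μ : V →ₗ[K] V →ₗ[K] V
  β : V →ₗ[K] V →ₗ[K] V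
  d_mem : ∀ {i : ℤ} {x : V}, x ∈ gr i → d x ∈ gr (i + 1)
  μ_mem : ∀ {i j : ℤ} {x y : V}, x ∈ gr i → y ∈ gr j → μ x y ∈ gr (i + j + 1)
  β_mem : ∀ {i j : ℤ} {x y : V}, x ∈ gr i → y ∈ gr j → β x y ∈ gr (i + j + k + 1)
  d_d : ∀ x : V, d (d x) = 0
  μ_comm : ∀ {i j : ℤ} {x y : V}, x ∈ gr i → y ∈ gr j → μ x y = -(sg K (i * j) • μ y x)
  μ_assoc : ∀ {i : ℤ} {x : V} (y z : V), x ∈ gr i → μ (μ x y) z = -(sg K i • μ x (μ y z))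
  d_μ : ∀ {i : ℤ} {x : V} (y : V), x ∈ gr i → d (μ x y) = -μ (d x) y - sg K i • μ x (d y)
  β_comm : ∀ {i j : ℤ} {x y : V}, x ∈ gr i → y ∈ gr j →
    β x y = sg K ((i + k) * (j + k)) • β y x
  d_β : ∀ {i : ℤ} {x : V} (y : V), x ∈ gr i →
    d (β x y) = -β (d x) y - sg K (i + k) • β x (d y)
  β_μ : ∀ {i j : ℤ} {x y : V} (z : V), x ∈ gr i → y ∈ gr j →
    β x (μ y z) = sg K (i + k + 1) • μ (β x y) z + sg K ((j + 1) * (i + k + 1)) • μ y (β x z)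
  jacobi : ∀ {i j l : ℤ} {x y z : V}, x ∈ gr i → y ∈ gr j → z ∈ gr l →
    sg K ((i + k) * (l + k)) • β (β x y) z + sg K ((j + k) * (i + k)) • β (β y z) x +
      sg K ((l + k) * (j + k)) • β (β z x) y = 0

namespace LetterOps

variable {gr : ℤ → Submodule K V} {k : ℤ} (O : LetterOps gr k)

/-- Multiplication of the first letter of a tensor by a letter. -/
noncomputable def merge : V →ₗ[K] TensorAlgebra K V →ₗ[K] TensorAlgebra K V :=
  (para 0 ∘ₗ LinearMap.inr K _ _ ∘ₗ LinearMap.llcomp K _ _ _ (lmul K)) ∘ₗ O.μ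

@[simp] theorem merge_one (a : V) : O.merge a 1 = 0 := by simp [merge]

@[simp] theorem merge_ι_mul (a b : V) (X : TensorAlgebra K V) :
    O.merge a (TensorAlgebra.ι K b * X) = TensorAlgebra.ι K (O.μ a b) * X := by simp [merge]

/-- The differential of the tensor algebra that is induced by `d` and `μ`. -/
noncomputable def tD : TensorAlgebra K V →ₗ[K] TensorAlgebra K V :=
  para (lmul K ∘ₗ sgn O.graded 1) (0, lmul K ∘ₗ O.d + O.merge)

@[simp] theorem tD_one : O.tD 1 = 0 := by simp [tD]

theorem tD_cons {i : ℤ} {a : V} (ha : a ∈ gr i) (X : TensorAlgebra K V) :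
    O.tD (TensorAlgebra.ι K a * X) = TensorAlgebra.ι K (O.d a) * X +
      sg K i • (TensorAlgebra.ι K a * O.tD X) + O.merge a X := by
  simp [tD, sgn_apply _ _ ha]
  abel

/-- The inhomogeneous part of the recursion of the bracket of tensors in the second argument. -/
noncomputable def brNew (j : ℤ) :
    V →ₗ[K] TensorAlgebra K V →ₗ[K] (TensorAlgebra K V →ₗ[K] TensorAlgebra K V) :=
  LinearMap.mk₂ K (fun b Y => para (lmul K ∘ₗ sgn O.graded 1) (0,
      (LinearMap.mk₂ K (fun a X => TensorAlgebra.ι K (O.β a b) *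
          sh O.graded (sgn (isInternal_Tgr O.graded) (j + k) X) Y)
        (fun a a' X => by simp [add_mul]) (fun r a X => by simp)
        (fun a X X' => by simp [mul_add]) (fun r a X => by simp))))
    (fun b b' Y => by rw [← map_add]; congr 1; ext <;> simp [add_mul])
    (fun r b Y => by rw [← map_smul]; congr 1; ext <;> simp)
    (fun b Y Y' => by rw [← map_add]; congr 1; ext <;> simp [mul_add])
    (fun r b Y => by rw [← map_smul]; congr 1; ext <;> simp)

/-- The homogeneous part of the recursion of the bracket of tensors in the second argument. -/
noncomputable def brOld (j : ℤ) :
    V →ₗ[K] (TensorAlgebra K V →ₗ[K] TensorAlgebra K V) →ₗ[K]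
      (TensorAlgebra K V →ₗ[K] TensorAlgebra K V) :=
  LinearMap.mk₂ K (fun b φ => para (lmul K ∘ₗ sgn O.graded 1) (0,
      (lmul K).compr₂ (sg K (j * (k + 1)) •
        (lmul K b ∘ₗ φ ∘ₗ sgn (isInternal_Tgr O.graded) j))))
    (fun b b' Y => by rw [← map_add]; congr 1; ext <;> simp [add_mul])
    (fun r b Y => by rw [← map_smul]; congr 1; ext <;> simp [smul_comm r])
    (fun b Y Y' => by rw [← map_add]; congr 1; ext <;> simp [mul_add])
    (fun r b Y => by rw [← map_smul]; congr 1; ext <;> simp [smul_comm r])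

/-- The bracket of the tensor algebra that is induced by `β`. -/
noncomputable def tB :
    TensorAlgebra K V →ₗ[K] TensorAlgebra K V →ₗ[K] TensorAlgebra K V :=
  (para (byDegree O.graded O.brOld) (0, byDegree O.graded O.brNew)).flip

@[simp] theorem tB_one_right (X : TensorAlgebra K V) : O.tB X 1 = 0 := by simp [tB]

@[simp] theorem tB_one_left (Y : TensorAlgebra K V) : O.tB 1 Y = 0 := by
  have : O.tB 1 = 0 := by
    refine ext_words O.graded fun l => ?_
    cases l with
    | nil => simp
    | cons x l =>
      simp [tB, byDegree_apply O.graded _ x.2.2, brOld, brNew]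
  rw [this]; rfl

/-- Either the two leading letters are contracted and the tails shuffled, or a, respectively b,
stays in front. Moving b in front takes it past aX and past the bracket of degree k + 1. The sign
for a is that of a degree-one operation, because the factor (-1)^{k deg} of the first argument is
split off from `tB`. -/
theorem tB_cons {i m j : ℤ} {a b : V} {X : TensorAlgebra K V} (ha : a ∈ gr i) (hX : X ∈ Tgr gr m)
    (hb : b ∈ gr j) (Y : TensorAlgebra K V) :
    O.tB (TensorAlgebra.ι K a * X) (TensorAlgebra.ι K b * Y) =
      sg K (m * (j + k)) • (TensorAlgebra.ι K (O.β a b) * sh O.graded X Y) +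
      sg K i • (TensorAlgebra.ι K a * O.tB X (TensorAlgebra.ι K b * Y)) +
        sg K (j * (i + m + k + 1)) •
          (TensorAlgebra.ι K b * O.tB (TensorAlgebra.ι K a * X) Y) := by
  have key : ∀ X', O.tB X' (TensorAlgebra.ι K b * Y) =
      O.brOld j b (O.tB.flip Y) X' + O.brNew j b Y X' := by
    intro X'
    simp [tB, byDegree_apply _ _ hb]
  rw [key, key X]
  simp only [brOld, brNew, LinearMap.mk₂_apply, para_ι_mul, LinearMap.comp_apply,
    sgn_apply _ _ ha, sgn_apply _ _ hX, sgn_apply _ _ (ι_mul_mem ha hX), LinearMap.compr₂_apply,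
    lmul_apply, map_smul, LinearMap.smul_apply, mul_smul_comm, smul_mul_assoc, one_mul, mul_add,
    LinearMap.flip_apply]
  match_scalars <;>
  · try simp only [sg_add, add_mul, mul_add]
    try ring_nf

theorem merge_mem {i m : ℤ} {a : V} {X : TensorAlgebra K V} (ha : a ∈ gr i) (hX : X ∈ Tgr gr m) :
    O.merge a X ∈ Tgr gr (i + m + 1) := by
  refine mem_of_words (F := O.merge a) ?_ hX
  rintro l rfl
  cases l with
  | nil => simp
  | cons b l =>
    rw [wd_cons, merge_ι_mul]
    exact Tgr_cast (ι_mul_mem (O.μ_mem ha b.2.2) (wd_mem l)) (by simp; ring)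

theorem tD_mem {m : ℤ} {X : TensorAlgebra K V} (hX : X ∈ Tgr gr m) : O.tD X ∈ Tgr gr (m + 1) := by
  refine mem_of_words (F := O.tD) ?_ hX
  rintro l rfl
  clear hX
  induction l with
  | nil => simp
  | cons a l ih =>
    rw [wd_cons, O.tD_cons a.2.2]
    refine add_mem (add_mem ?_ (Submodule.smul_mem _ _ ?_)) ?_
    · exact Tgr_cast (ι_mul_mem (O.d_mem a.2.2) (wd_mem l)) (by simp; ring)
    · exact Tgr_cast (ι_mul_mem a.2.2 ih) (by simp; ring)
    · exact Tgr_cast (O.merge_mem a.2.2 (wd_mem l)) (by simp)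

theorem tB_mem {m n : ℤ} {X Y : TensorAlgebra K V} (hX : X ∈ Tgr gr m) (hY : Y ∈ Tgr gr n) :
    O.tB X Y ∈ Tgr gr (m + n + (k + 1)) := by
  refine bilin_mem (F := O.tB) ?_ hX hY
  intro u v
  induction u generalizing v with
  | nil => simp
  | cons a u ihu =>
    induction v with
    | nil => simp
    | cons b v ihv =>
      rw [wd_cons, wd_cons, O.tB_cons a.2.2 (wd_mem u) b.2.2, ← wd_cons, ← wd_cons]
      refine add_mem (add_mem (Submodule.smul_mem _ _ ?_) (Submodule.smul_mem _ _ ?_))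
        (Submodule.smul_mem _ _ ?_)
      · exact Tgr_cast (ι_mul_mem (O.β_mem a.2.2 b.2.2) (sh_mem _ (wd_mem u) (wd_mem v)))
          (by simp; ring)
      · exact Tgr_cast (ι_mul_mem a.2.2 (ihu (b :: v))) (by simp; ring)
      · exact Tgr_cast (ι_mul_mem b.2.2 ihv) (by simp; ring)

/-- The contracted term is symmetric by `β_comm` and commutativity of the shuffle of the tails. The
other two terms of the recursion are exchanged. -/
theorem tB_comm_wd (u v : List (Homog gr)) :
    O.tB (wd u) (wd v) = sg K ((wdeg u + k) * (wdeg v + k)) • O.tB (wd v) (wd u) := by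
  induction u generalizing v with
  | nil => simp
  | cons a u ihu =>
    induction v with
    | nil => simp
    | cons b v ihv =>
      have e1 := ihu (b :: v)
      simp only [wd_cons, wdeg_cons] at e1 ihv ⊢
      rw [O.tB_cons a.2.2 (wd_mem u) b.2.2, O.tB_cons b.2.2 (wd_mem v) a.2.2, e1, ihv,
        sh_comm_wd, O.β_comm a.2.2 b.2.2]
      simp only [mul_smul_comm, smul_add, smul_smul, map_smul, smul_mul_assoc]
      match_scalars <;>
      · try simp only [sg_add, add_mul, mul_add, sg_one, sg_self_mul]
        ring_nf
        try simp only [sg_sq, sg_cube]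
        try ring_nf

theorem tB_comm {m n : ℤ} {X Y : TensorAlgebra K V} (hX : X ∈ Tgr gr m) (hY : Y ∈ Tgr gr n) :
    O.tB X Y = sg K ((m + k) * (n + k)) • O.tB Y X := by
  refine eq_on_Tgr₂ (F := O.tB) (G := sg K ((m + k) * (n + k)) • O.tB.flip) ?_ hX hY
  rintro u v rfl rfl
  simpa using O.tB_comm_wd u v

end LetterOps
end Operations

/-! ### Square zero, and the derivation rules over the shuffle product. -/

section Operations

variable {K : Type*} [Field K] {V : Type*} [AddCommGroup V] [Module K V]

namespace LetterOps

variable {gr : ℤ → Submodule K V} {k : ℤ} (O : LetterOps gr k)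

/-- Only the first letter of X is involved, where this is associativity of μ. On the empty word both
sides vanish. -/
theorem merge_merge {i : ℤ} {a : V} (ha : a ∈ gr i) (b : V) (X : TensorAlgebra K V) :
    O.merge (O.μ a b) X = -(sg K i • O.merge a (O.merge b X)) := by
  have : O.merge (O.μ a b) = -(sg K i • (O.merge a ∘ₗ O.merge b)) := by
    refine ext_words O.graded fun l => ?_
    cases l with
    | nil => simp
    | cons c l => simp [O.μ_assoc b c.2 ha]
  simp [this]

theorem tD_tD_wd (u : List (Homog gr)) : O.tD (O.tD (wd u)) = 0 := by
  induction u with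
  | nil => simp
  | cons a u ih =>
    -- These are the terms of the square in which a is multiplied with its neighbour. They cancel by
    -- `d_μ` and associativity. The others cancel by d² = 0 and induction.
    have e : O.tD (O.merge a.2 (wd u)) + O.merge (O.d a.2) (wd u) +
        sg K a.1 • O.merge a.2 (O.tD (wd u)) = 0 := by
      cases u with
      | nil => simp
      | cons b u =>
        simp only [wd_cons, merge_ι_mul, O.tD_cons (O.μ_mem a.2.2 b.2.2), O.tD_cons b.2.2,
          map_add, map_smul, O.merge_merge a.2.2, O.d_μ _ a.2.2, map_sub, map_neg]
        simp only [sub_mul, add_mul, neg_mul, smul_mul_assoc, merge_ι_mul, smul_add, smul_neg]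
        match_scalars <;>
        · try simp only [sg_add, add_mul, mul_add, sg_one, sg_self_mul]
          try ring_nf
          try simp only [sg_sq, sg_cube]
          try ring_nf
    simp only [wd_cons, O.tD_cons a.2.2, map_add, map_smul, O.tD_cons (O.d_mem a.2.2), ih,
      O.d_d, map_zero, zero_mul, mul_zero] at e ⊢
    linear_combination (norm := skip) e
    match_scalars <;>
    · try simp only [sg_add, add_mul, mul_add, sg_one, sg_self_mul]
      try ring_nf
      try simp only [sg_sq, sg_cube]
      try ring_nf

/-- The first letter of the shuffle is that of u or is b. In the first case the result consists of
the shuffles of `merge a u` with bY whose first letter is not b, hence the difference. In the second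
case a is multiplied with b. The lemma `merge_sh_right` is the mirror image. -/
theorem merge_sh_left {i j : ℤ} {a b : V} (u : List (Homog gr)) (ha : a ∈ gr i) (hb : b ∈ gr j)
    (Y : TensorAlgebra K V) :
    O.merge a (sh O.graded (wd u) (TensorAlgebra.ι K b * Y)) =
      sh O.graded (O.merge a (wd u)) (TensorAlgebra.ι K b * Y) -
        sg K (j * (i + wdeg u + 1)) •
          (TensorAlgebra.ι K b * sh O.graded (O.merge a (wd u)) Y) +
        sg K (j * wdeg u) • (TensorAlgebra.ι K (O.μ a b) * sh O.graded (wd u) Y) := by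
  cases u with
  | nil => simp
  | cons a' u =>
    simp only [wd_cons, wdeg_cons, merge_ι_mul, sh_cons O.graded a'.2.2 (wd_mem u) hb,
      sh_cons O.graded (O.μ_mem ha a'.2.2) (wd_mem u) hb, map_add, map_smul]
    match_scalars <;>
    · try simp only [sg_add, add_mul, mul_add, sg_one, sg_self_mul]
      try ring_nf

theorem merge_sh_right {i j m : ℤ} {a b : V} {X : TensorAlgebra K V} (v : List (Homog gr))
    (ha : a ∈ gr i) (hX : X ∈ Tgr gr m) (hb : b ∈ gr j) :
    O.merge b (sh O.graded (TensorAlgebra.ι K a * X) (wd v)) =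
      TensorAlgebra.ι K (O.μ b a) * sh O.graded X (wd v) + sg K ((j + 1) * (i + m)) •
        (sh O.graded (TensorAlgebra.ι K a * X) (O.merge b (wd v)) -
          TensorAlgebra.ι K a * sh O.graded X (O.merge b (wd v))) := by
  cases v with
  | nil => simp
  | cons b' v =>
    simp only [wd_cons, wdeg_cons, merge_ι_mul, sh_cons O.graded ha hX b'.2.2,
      sh_cons O.graded ha hX (O.μ_mem hb b'.2.2), map_add, map_smul]
    match_scalars <;>
    · try simp only [sg_add, add_mul, mul_add, sg_one, sg_self_mul]
      try ring_nf
      try simp only [sg_sq, sg_cube]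
      try ring_nf

/-- The products μ(a,b) and μ(b,a) of letters from different words arise from shuffles that differ
by a transposition, and they cancel by commutativity of μ. Products within one word give the right
hand side. -/
theorem tD_sh_wd (u v : List (Homog gr)) :
    O.tD (sh O.graded (wd u) (wd v)) =
      sh O.graded (O.tD (wd u)) (wd v) + sg K (wdeg u) • sh O.graded (wd u) (O.tD (wd v)) := by
  induction u generalizing v with
  | nil => simp
  | cons a u ihu =>
    induction v with
    | nil => simp
    | cons b v ihv =>
      have e1 := congrArg (lmul K (a.2 : V)) (ihu (b :: v))
      have e2 := congrArg (lmul K (b.2 : V)) ihv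
      have ha := a.2.2
      have hb := b.2.2
      have hu := wd_mem u
      have hDu := O.tD_mem hu
      have hau := ι_mul_mem ha hu
      have m1 := O.merge_sh_left u ha hb (wd v)
      have m2 := O.merge_sh_right v ha hu hb
      simp only [wd_cons, wdeg_cons, lmul_apply] at e1 e2 m1 m2 ⊢
      simp only [sh_cons O.graded ha hu hb, O.tD_cons ha, O.tD_cons hb, m1, m2,
        sh_cons O.graded (O.d_mem ha) hu hb, sh_cons O.graded ha hDu hb,
        sh_cons O.graded ha hu (O.d_mem hb), map_add, map_smul, LinearMap.add_apply,
        LinearMap.smul_apply, mul_add, smul_add, mul_smul_comm, O.μ_comm hb ha, map_neg,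
        neg_mul, smul_mul_assoc] at e1 e2 ⊢
      linear_combination (norm := skip) sg K a.1 • e1 +
        (sg K (b.1 * (a.1 + wdeg u)) * sg K b.1) • e2
      match_scalars <;>
      · try simp only [sg_add, add_mul, mul_add, sg_one, sg_self_mul]
        try ring_nf
        try simp only [sg_sq, sg_cube]
        try ring_nf

/-- Each contraction pairs a letter of w with a letter of either u or v, and the remaining letters
are only shuffled. -/
theorem tB_sh_wd (u v w : List (Homog gr)) :
    O.tB (sh O.graded (wd u) (wd v)) (wd w) =
      sg K (wdeg u) • sh O.graded (wd u) (O.tB (wd v) (wd w)) +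
        sg K (wdeg v * (wdeg w + k)) • sh O.graded (O.tB (wd u) (wd w)) (wd v) := by
  induction u generalizing v w with
  | nil => simp
  | cons a u ihu =>
    induction v generalizing w with
    | nil => simp
    | cons b v ihv =>
      induction w with
      | nil => simp
      | cons c w ihw =>
        have e1 := congrArg (lmul K (a.2 : V)) (ihu (b :: v) (c :: w))
        have e2 := congrArg (lmul K (b.2 : V)) (ihv (c :: w))
        have e3 := congrArg (lmul K (c.2 : V)) ihw
        have ha := a.2.2
        have hb := b.2.2
        have hc := c.2.2
        have hu := wd_mem u
        have hv := wd_mem v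
        have hw := wd_mem w
        have hau := ι_mul_mem ha hu
        have hbv := ι_mul_mem hb hv
        have hcw := ι_mul_mem hc hw
        -- Tails of contracted terms are triple shuffles. Associativity and commutativity bring them
        -- to one order so that they can be matched.
        have s1 : sh O.graded (sh O.graded (wd u) (wd w)) (TensorAlgebra.ι K (b.2 : V) * wd v) =
            sg K ((b.1 + wdeg v) * wdeg w) •
              sh O.graded (sh O.graded (wd u) (TensorAlgebra.ι K (b.2 : V) * wd v)) (wd w) := by
          rw [sh_assoc, sh_comm O.graded hw hbv, map_smul, sh_assoc, mul_comm]
        have s2 := sh_assoc O.graded (TensorAlgebra.ι K (a.2 : V) * wd u) (wd v) (wd w)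
        simp only [wd_cons, wdeg_cons, lmul_apply] at e1 e2 e3 ⊢
        simp only [sh_cons O.graded ha hu hb, O.tB_cons hb hv hc, O.tB_cons ha hu hc,
          map_add, map_smul, LinearMap.add_apply, LinearMap.smul_apply,
          O.tB_cons ha (sh_mem O.graded hu hbv) hc, O.tB_cons hb (sh_mem O.graded hau hv) hc,
          sh_cons O.graded ha hu (O.β_mem hb hc), sh_cons O.graded ha hu hb,
          sh_cons O.graded ha hu hc,
          sh_cons O.graded (O.β_mem ha hc) (sh_mem O.graded hu hw) hb,
          sh_cons O.graded ha (O.tB_mem hu hcw) hb,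
          sh_cons O.graded hc (O.tB_mem hau hw) hb,
          s1, s2, mul_add, smul_add, mul_smul_comm] at e1 e2 e3 ⊢
        linear_combination (norm := skip) sg K a.1 • e1 +
          (sg K (b.1 * (a.1 + wdeg u)) * sg K b.1) • e2 +
          sg K (c.1 * (a.1 + wdeg u + b.1 + wdeg v + k + 1)) • e3
        match_scalars <;>
        · try simp only [sg_add, add_mul, mul_add, sg_one, sg_self_mul]
          try ring_nf
          try simp only [sg_sq, sg_cube]
          try ring_nf

end LetterOps
end Operations

/-! ### Compatibility of bracket and differential, and the Jacobi identity. -/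

section Operations

variable {K : Type*} [Field K] {V : Type*} [AddCommGroup V] [Module K V]

namespace LetterOps

variable {gr : ℤ → Submodule K V} {k : ℤ} (O : LetterOps gr k)

theorem β_μ_left {i j l : ℤ} {x y z : V} (hx : x ∈ gr i) (hy : y ∈ gr j) (hz : z ∈ gr l) :
    O.β (O.μ x y) z =
      sg K ((i + j + 1 + k) * (l + k) + (l + k + 1) + (l + k) * (i + k)) • O.μ (O.β x z) y +
      sg K ((i + j + 1 + k) * (l + k) + (i + 1) * (l + k + 1) + (l + k) * (j + k)) •
        O.μ x (O.β y z) := by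
  rw [O.β_comm (O.μ_mem hx hy) hz, O.β_μ y hz hx, O.β_comm hz hx, O.β_comm hz hy]
  simp only [map_smul, LinearMap.smul_apply, smul_add, smul_smul, sg_add, mul_assoc]

/-- Collects the terms of `tD` applied to a bracket in which the leading letter produced by the
bracket is multiplied with its neighbour. The Leibniz rules in both arguments turn them into
contractions with μ(a,a') or μ(b,b'). The products of a with b cancel by commutativity. On the
right, the terms in which b, respectively a, stays in front are subtracted, since induction accounts
for them. -/
theorem merge_tB {i j : ℤ} {a b : V} (u v : List (Homog gr)) (ha : a ∈ gr i) (hb : b ∈ gr j) :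
    sg K (wdeg u * (j + k)) • O.merge (O.β a b) (sh O.graded (wd u) (wd v)) +
      sg K i • O.merge a (O.tB (wd u) (TensorAlgebra.ι K b * wd v)) +
      sg K (j * (i + wdeg u + k + 1)) • O.merge b (O.tB (TensorAlgebra.ι K a * wd u) (wd v)) =
    -(O.tB (O.merge a (wd u)) (TensorAlgebra.ι K b * wd v) -
      sg K (j * (i + wdeg u + k)) • (TensorAlgebra.ι K b * O.tB (O.merge a (wd u)) (wd v))) -
    sg K (i + wdeg u + k) • (O.tB (TensorAlgebra.ι K a * wd u) (O.merge b (wd v)) -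
      sg K i • (TensorAlgebra.ι K a * O.tB (wd u) (O.merge b (wd v)))) := by
  cases u with
  | nil =>
    cases v with
    | nil => simp
    | cons b' v =>
      have hb' := b'.2.2
      simp only [wd_nil, wdeg_nil, wd_cons, merge_ι_mul, sh_one_left, tB_one_left, merge_one,
        O.tB_cons ha one_mem_Tgr hb', O.tB_cons ha one_mem_Tgr (O.μ_mem hb hb'), map_add,
        map_smul, map_zero, LinearMap.zero_apply, mul_zero, smul_zero, add_zero, zero_add,
        sub_zero, neg_zero, zero_sub, O.β_μ _ ha hb, add_mul, smul_mul_assoc]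
      match_scalars <;>
      · try simp only [sg_add, add_mul, mul_add, sg_one, sg_zero, sg_self_mul]
        try ring_nf
        try simp only [sg_zero, sg_sq, sg_cube, sg_pow_four]
        try ring_nf
  | cons a' u =>
    have ha' := a'.2.2
    have hu := wd_mem u
    cases v with
    | nil =>
      simp only [wd_nil, wdeg_nil, wd_cons, wdeg_cons, merge_ι_mul, sh_one_right, tB_one_right,
        merge_one, O.tB_cons ha' hu hb, O.tB_cons (O.μ_mem ha ha') hu hb, map_add,
        map_smul, map_zero, LinearMap.zero_apply, mul_zero, smul_zero, add_zero, zero_add,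
        sub_zero, neg_zero, zero_sub, O.β_μ_left ha ha' hb, add_mul, smul_mul_assoc]
      match_scalars <;>
      · try simp only [sg_add, add_mul, mul_add, sg_one, sg_zero, sg_self_mul]
        try ring_nf
        try simp only [sg_zero, sg_sq, sg_cube, sg_pow_four]
        try ring_nf
    | cons b' v =>
      have hb' := b'.2.2
      have hau := ι_mul_mem ha' hu
      simp only [wd_cons, wdeg_cons, merge_ι_mul, O.tB_cons ha' hu hb,
        O.tB_cons (O.μ_mem ha ha') hu hb, O.tB_cons ha hau (O.μ_mem hb hb'),
        O.tB_cons ha hau hb', O.tB_cons (O.μ_mem ha ha') hu hb', O.tB_cons ha' hu hb',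
        O.tB_cons ha' hu (O.μ_mem hb hb'), sh_cons O.graded ha' hu hb', map_add,
        map_smul, O.β_μ _ ha hb, O.β_μ_left ha ha' hb, add_mul, smul_mul_assoc, mul_add,
        smul_add, mul_smul_comm, O.μ_comm hb ha, map_neg, neg_mul]
      match_scalars <;>
      · try simp only [sg_add, add_mul, mul_add, sg_one, sg_zero, sg_self_mul]
        try ring_nf
        try simp only [sg_zero, sg_sq, sg_cube, sg_pow_four]
        try ring_nf

/-- The contracted pair is handled by `d_β`, its shuffled tail by `tD_sh_wd`, the products with a
leading letter by `merge_tB`, and the terms with a or b untouched in front by induction. -/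
theorem tD_tB_wd (u v : List (Homog gr)) :
    O.tD (O.tB (wd u) (wd v)) =
      -O.tB (O.tD (wd u)) (wd v) - sg K (wdeg u + k) • O.tB (wd u) (O.tD (wd v)) := by
  induction u generalizing v with
  | nil => simp
  | cons a u ihu =>
    induction v with
    | nil => simp
    | cons b v ihv =>
      have e1 := congrArg (lmul K (a.2 : V)) (ihu (b :: v))
      have e2 := congrArg (lmul K (b.2 : V)) ihv
      have ha := a.2.2
      have hb := b.2.2
      have hu := wd_mem u
      have hDu := O.tD_mem hu
      have hau := ι_mul_mem ha hu
      have m1 := O.merge_tB u v ha hb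
      simp only [wd_cons, wdeg_cons, lmul_apply] at e1 e2 m1 ⊢
      simp only [O.tB_cons ha hu hb, O.tD_cons ha, O.tD_cons hb, O.tD_cons (O.β_mem ha hb),
        O.tB_cons (O.d_mem ha) hu hb, O.tB_cons ha hDu hb, O.d_β _ ha, O.tD_sh_wd,
        O.tB_cons ha hu (O.d_mem hb), map_add, map_smul, map_sub, map_neg, LinearMap.add_apply,
        LinearMap.smul_apply, mul_add, smul_add, smul_sub, smul_neg, mul_smul_comm, add_mul,
        sub_mul, mul_sub, mul_neg, neg_mul, smul_mul_assoc] at e1 e2 ⊢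
      linear_combination (norm := skip) m1 + (sg K a.1 * sg K a.1) • e1 +
        (sg K (b.1 * (a.1 + wdeg u + k + 1)) * sg K b.1) • e2
      match_scalars <;>
      · try simp only [sg_add, add_mul, mul_add, sg_one, sg_zero, sg_self_mul]
        try ring_nf
        try simp only [sg_zero, sg_sq, sg_cube, sg_pow_four]
        try ring_nf

/-- Terms with an untouched leading letter are the induction hypotheses. Terms contracting all three
leading letters form the Jacobi identity of β times the triple shuffle of the tails. Where two
leading letters are contracted and the second contraction happens in the tails, `tB_sh_wd` splits
the term, and the pieces cancel between cyclic permutations. -/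
theorem jacobi_wd (u v w : List (Homog gr)) :
    sg K ((wdeg u + k) * (wdeg w + k)) • O.tB (O.tB (wd u) (wd v)) (wd w) +
      sg K ((wdeg v + k) * (wdeg u + k)) • O.tB (O.tB (wd v) (wd w)) (wd u) +
      sg K ((wdeg w + k) * (wdeg v + k)) • O.tB (O.tB (wd w) (wd u)) (wd v) = 0 := by
  induction u generalizing v w with
  | nil => simp
  | cons a u ihu =>
    induction v generalizing w with
    | nil => simp
    | cons b v ihv =>
      induction w with
      | nil => simp
      | cons c w ihw =>
        have e1 := congrArg (lmul K (a.2 : V)) (ihu (b :: v) (c :: w))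
        have e2 := congrArg (lmul K (b.2 : V)) (ihv (c :: w))
        have e3 := congrArg (lmul K (c.2 : V)) ihw
        have ha := a.2.2
        have hb := b.2.2
        have hc := c.2.2
        have hu := wd_mem u
        have hv := wd_mem v
        have hw := wd_mem w
        have hau := ι_mul_mem ha hu
        have hbv := ι_mul_mem hb hv
        have hcw := ι_mul_mem hc hw
        have b1 := O.tB_sh_wd u v (c :: w)
        have b2 := O.tB_sh_wd v w (a :: u)
        have b3 := O.tB_sh_wd w u (b :: v)
        -- The facts `q`, `r` and `n` put inner brackets, shuffles with a bracket, and triple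
        -- shuffles into a common order, so that equal terms become syntactically equal.
        have q1 := O.tB_comm hcw hu
        have q2 := O.tB_comm hau hv
        have q3 := O.tB_comm hbv hw
        have r1 := sh_comm O.graded hu (O.tB_mem hv hcw)
        have r2 := sh_comm O.graded hv (O.tB_mem hw hau)
        have r3 := sh_comm O.graded hw (O.tB_mem hu hbv)
        have n1 := sh_comm O.graded (sh_mem O.graded hv hw) hu
        have n2 := sh_comm O.graded hw (sh_mem O.graded hu hv)
        rw [← sh_assoc] at n1 n2
        have j1 := congrArg (fun x => TensorAlgebra.ι K x *
          sh O.graded (sh O.graded (wd u) (wd v)) (wd w)) (O.jacobi ha hb hc)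
        simp only [wd_cons, wdeg_cons, lmul_apply, map_zero, zero_mul] at e1 e2 e3 j1 b1 b2 b3 ⊢
        simp only [O.tB_cons ha hu hb, O.tB_cons hb hv hc, O.tB_cons hc hw ha,
          map_add, map_smul, LinearMap.add_apply, LinearMap.smul_apply,
          O.tB_cons (O.β_mem ha hb) (sh_mem O.graded hu hv) hc,
          O.tB_cons (O.β_mem hb hc) (sh_mem O.graded hv hw) ha,
          O.tB_cons (O.β_mem hc ha) (sh_mem O.graded hw hu) hb,
          O.tB_cons ha (O.tB_mem hu hbv) hc, O.tB_cons hb (O.tB_mem hau hv) hc,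
          O.tB_cons hb (O.tB_mem hv hcw) ha, O.tB_cons hc (O.tB_mem hbv hw) ha,
          O.tB_cons hc (O.tB_mem hw hau) hb, O.tB_cons ha (O.tB_mem hcw hu) hb,
          b1, b2, b3] at e1 e2 e3 j1 ⊢
        simp only [q1, q2, q3, r1, r2, r3, n1, n2, O.β_comm hb ha, O.β_comm hc hb, O.β_comm ha hc,
          map_add, map_smul, LinearMap.add_apply, LinearMap.smul_apply,
          add_mul, smul_mul_assoc, mul_add, smul_add, mul_smul_comm] at e1 e2 e3 j1 ⊢
        linear_combination (norm := skip) sg K (a.1 * (c.1 + wdeg w + k)) • e1 +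
          sg K (b.1 * (a.1 + wdeg u + k)) • e2 + sg K (c.1 * (b.1 + wdeg v + k)) • e3 +
          sg K ((a.1 + wdeg u + k) * (c.1 + wdeg w + k) + (a.1 + k) * (c.1 + k) +
            wdeg u * (b.1 + k) + (wdeg u + wdeg v) * (c.1 + k)) • j1
        clear ihu ihv ihw e1 e2 e3 j1 b1 b2 b3 q1 q2 q3 r1 r2 r3 n1 n2
        match_scalars <;>
        · try simp only [sg_add, add_mul, mul_add, sg_one, sg_zero, sg_self_mul]
          try ring_nf
          try simp only [sg_zero, sg_sq, sg_cube, sg_pow_four]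
          try ring_nf

end LetterOps
end Operations

/-! ### Enumeration of shuffles by lists. -/

section Shuffles

/-- The list of all shuffles of two lists. -/
def shufs {α : Type*} : List α → List α → List (List α)
  | [], l => [l]
  | a :: u, [] => [a :: u]
  | a :: u, b :: v => (shufs u (b :: v)).map (a :: ·) ++ (shufs (a :: u) v).map (b :: ·)
termination_by u v => u.length + v.length

theorem shufs_nil_left {α : Type*} (l : List α) : shufs [] l = [l] := by simp [shufs]

theorem shufs_nil_right {α : Type*} (l : List α) : shufs l [] = [l] := by
  cases l <;> simp [shufs]

theorem shufs_cons {α : Type*} (a b : α) (u v : List α) :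
    shufs (a :: u) (b :: v) =
      (shufs u (b :: v)).map (a :: ·) ++ (shufs (a :: u) v).map (b :: ·) := by
  rw [shufs]

theorem perm_of_mem_shufs {α : Type*} {u v l : List α} (h : l ∈ shufs u v) : l.Perm (u ++ v) := by
  induction u generalizing v l with
  | nil => rw [shufs_nil_left, List.mem_singleton] at h; simp [h]
  | cons a u ihu =>
    induction v generalizing l with
    | nil => rw [shufs_nil_right, List.mem_singleton] at h; simp [h]
    | cons b v ihv =>
      rw [shufs_cons, List.mem_append, List.mem_map, List.mem_map] at h
      rcases h with ⟨l', hl', rfl⟩ | ⟨l', hl', rfl⟩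
      · exact (ihu hl').cons a
      · exact ((ihv hl').cons b).trans List.perm_middle.symm

theorem nodup_shufs {α : Type*} {u v : List α} (h : (u ++ v).Nodup) : (shufs u v).Nodup := by
  induction u generalizing v with
  | nil => simp [shufs_nil_left]
  | cons a u ihu =>
    induction v with
    | nil => simp [shufs_nil_right]
    | cons b v ihv =>
      rw [shufs_cons, List.nodup_append]
      refine ⟨?_, ?_, ?_⟩
      · refine (ihu ?_).map (List.cons_injective)
        exact (List.nodup_cons.1 h).2
      · refine (ihv ?_).map (List.cons_injective)
        exact (List.nodup_cons.1 (List.perm_middle.nodup_iff.1 h)).2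
      · intro x hx y hy hxy
        rw [List.mem_map] at hx hy
        obtain ⟨x', -, rfl⟩ := hx
        obtain ⟨y', -, rfl⟩ := hy
        injection hxy with hab
        subst hab
        simp at h

/-- The predicate `c` records the word of origin, so a shuffle is a rearrangement that is increasing
within each colour. For the converse, the first entry must be the head of its own list, since that
head is smaller than the rest. Remove it and recurse. -/
theorem mem_shufs {α : Type*} [LinearOrder α] {c : α → Prop} {u v l : List α}
    (hu : u.Pairwise (· < ·)) (hv : v.Pairwise (· < ·)) (huc : ∀ x ∈ u, c x)
    (hvc : ∀ x ∈ v, ¬ c x) :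
    l ∈ shufs u v ↔ l.Perm (u ++ v) ∧ l.Pairwise fun x y => (c x ↔ c y) → x < y := by
  constructor
  · intro h
    refine ⟨perm_of_mem_shufs h, ?_⟩
    induction u generalizing v l with
    | nil =>
      rw [shufs_nil_left, List.mem_singleton] at h
      subst h
      exact hv.imp (S := fun x y => (c x ↔ c y) → x < y) fun h _ => h
    | cons a u ihu =>
      induction v generalizing l with
      | nil =>
        rw [shufs_nil_right, List.mem_singleton] at h
        subst h
        exact hu.imp (S := fun x y => (c x ↔ c y) → x < y) fun h _ => h
      | cons b v ihv =>
        rw [shufs_cons, List.mem_append, List.mem_map, List.mem_map] at h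
        rcases h with ⟨l', hl', rfl⟩ | ⟨l', hl', rfl⟩
        · refine List.pairwise_cons.2 ⟨fun x hx => ?_, ihu (List.pairwise_cons.1 hu).2 hv
            (fun x hx => huc x (List.mem_cons_of_mem _ hx)) hvc hl'⟩
          rcases List.mem_append.1 ((perm_of_mem_shufs hl').mem_iff.1 hx) with hx | hx
          · exact fun _ => (List.pairwise_cons.1 hu).1 x hx
          · exact fun hc => absurd (hc.1 (huc a (by simp))) (hvc x hx)
        · refine List.pairwise_cons.2 ⟨fun x hx => ?_, ihv (List.pairwise_cons.1 hv).2
            (fun x hx => hvc x (List.mem_cons_of_mem _ hx)) hl'⟩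
          rcases List.mem_append.1 ((perm_of_mem_shufs hl').mem_iff.1 hx) with hx | hx
          · exact fun hc => absurd (hc.2 (huc x hx)) (hvc b (by simp))
          · exact fun _ => (List.pairwise_cons.1 hv).1 x hx
  · rintro ⟨hp, hl⟩
    induction u generalizing v l with
    | nil =>
      rw [shufs_nil_left, List.mem_singleton]
      refine List.Perm.eq_of_pairwise (le := (· < ·)) (fun a b _ _ h1 h2 => absurd h1 h2.not_gt) ?_ hv hp
      refine hl.imp_of_mem fun {x y} hx hy h => h ?_
      have h1 := hvc x (by simpa using hp.mem_iff.1 hx)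
      have h2 := hvc y (by simpa using hp.mem_iff.1 hy)
      simp [h1, h2]
    | cons a u ihu =>
      induction v generalizing l with
      | nil =>
        rw [shufs_nil_right, List.mem_singleton]
        rw [List.append_nil] at hp
        refine List.Perm.eq_of_pairwise (le := (· < ·)) (fun a b _ _ h1 h2 => absurd h1 h2.not_gt) ?_ hu hp
        refine hl.imp_of_mem fun {x y} hx hy h => h ?_
        have h1 := huc x (by simpa using hp.mem_iff.1 hx)
        have h2 := huc y (by simpa using hp.mem_iff.1 hy)
        simp [h1, h2]
      | cons b v ihv =>
        rw [shufs_cons, List.mem_append, List.mem_map, List.mem_map]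
        cases l with
        | nil => simp at hp
        | cons x l =>
          have hx : x ∈ (a :: u) ++ (b :: v) := hp.mem_iff.1 (by simp)
          obtain ⟨hl1, hl2⟩ := List.pairwise_cons.1 hl
          rcases List.mem_append.1 hx with hx | hx
          · have hxa : x = a := by
              by_contra hne
              have ha : a ∈ x :: l := hp.mem_iff.2 (by simp)
              have h1 := hl1 a ((List.mem_cons.1 ha).resolve_left (Ne.symm hne))
                (by simp [huc x hx, huc a (by simp)])
              have h2 := (List.pairwise_cons.1 hu).1 x ((List.mem_cons.1 hx).resolve_left hne)
              exact absurd h1 h2.not_gt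
            subst hxa
            refine Or.inl ⟨l, ihu (List.pairwise_cons.1 hu).2 hv
              (fun y hy => huc y (List.mem_cons_of_mem _ hy)) hvc ?_ hl2, rfl⟩
            exact List.perm_cons x |>.1 hp
          · have hxb : x = b := by
              by_contra hne
              have hb : b ∈ x :: l := hp.mem_iff.2 (by simp)
              have h1 := hl1 b ((List.mem_cons.1 hb).resolve_left (Ne.symm hne))
                (by simp [hvc x hx, hvc b (by simp)])
              have h2 := (List.pairwise_cons.1 hv).1 x ((List.mem_cons.1 hx).resolve_left hne)
              exact absurd h1 h2.not_gt
            subst hxb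
            refine Or.inr ⟨l, ihv (List.pairwise_cons.1 hv).2
              (fun y hy => hvc y (List.mem_cons_of_mem _ hy)) ?_ hl2, rfl⟩
            exact List.perm_cons x |>.1 (hp.trans List.perm_middle)

/-- The list of values of σ⁻¹ lists the original places in their new order. Monotonicity of σ on
each block says that places of one block occur there in increasing order. -/
theorem isShuffle_iff {p q : ℕ} (σ : Equiv.Perm (Fin (p + q))) :
    IsShuffle p q σ ↔ (List.ofFn σ.symm).Pairwise fun x y : Fin (p + q) =>
      ((x : ℕ) < p ↔ (y : ℕ) < p) → x < y := by
  rw [List.pairwise_ofFn]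
  constructor
  · intro h s t hst hc
    by_contra hlt
    have hne : σ.symm t ≠ σ.symm s := fun e => hst.ne (σ.symm.injective e).symm
    have hlt' : σ.symm t < σ.symm s := lt_of_le_of_ne (not_lt.1 hlt) hne
    have := h _ _ hlt' (by omega)
    simp only [Equiv.apply_symm_apply] at this
    exact absurd this hst.not_gt
  · intro h i j hij hc
    by_contra hlt
    have hlt' : σ j < σ i := lt_of_le_of_ne (not_lt.1 hlt) fun e => hij.ne (σ.injective e).symm
    have := h hlt' (by simp only [Equiv.symm_apply_apply]; omega)
    simp only [Equiv.symm_apply_apply] at this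
    exact absurd this hij.not_gt

/-- The first `p` places of `p + q`. -/
def firstPlaces (p q : ℕ) : List (Fin (p + q)) := (List.finRange p).map (Fin.castAdd q)

/-- The last `q` places of `p + q`. -/
def lastPlaces (p q : ℕ) : List (Fin (p + q)) := (List.finRange q).map (Fin.natAdd p)

theorem firstPlaces_append_lastPlaces (p q : ℕ) :
    firstPlaces p q ++ lastPlaces p q = List.finRange (p + q) := by
  rw [← List.ofFn_id, List.ofFn_add]
  simp [firstPlaces, lastPlaces, ← List.ofFn_id, List.map_ofFn, Function.comp_def]
  rfl

theorem pairwise_finRange (n : ℕ) : (List.finRange n).Pairwise (· < ·) := by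
  rw [← List.ofFn_id, List.pairwise_ofFn]
  exact fun i j h => h

/-- A permutation is recovered from the list of values of its inverse, and every rearrangement of
all places arises in this way. This turns sums over permutations into recursively computable sums
over lists. -/
theorem sum_shuffles {M : Type*} [AddCommMonoid M] (p q : ℕ) (f : List (Fin (p + q)) → M)
    [DecidablePred (IsShuffle p q)] :
    ∑ σ : Equiv.Perm (Fin (p + q)) with IsShuffle p q σ, f (List.ofFn σ.symm) =
      ((shufs (firstPlaces p q) (lastPlaces p q)).map f).sum := by
  have hn : (firstPlaces p q ++ lastPlaces p q).Nodup := by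
    rw [firstPlaces_append_lastPlaces]; exact List.nodup_finRange _
  rw [← List.sum_toFinset f (nodup_shufs hn)]
  have hpw : (firstPlaces p q ++ lastPlaces p q).Pairwise (· < ·) := by
    rw [firstPlaces_append_lastPlaces]; exact pairwise_finRange _
  have hmem : ∀ l, l ∈ shufs (firstPlaces p q) (lastPlaces p q) ↔
      l.Perm (List.finRange (p + q)) ∧
        l.Pairwise fun x y : Fin (p + q) => ((x : ℕ) < p ↔ (y : ℕ) < p) → x < y := by
    intro l
    rw [← firstPlaces_append_lastPlaces]
    refine mem_shufs (c := fun x : Fin (p + q) => (x : ℕ) < p) (List.pairwise_append.1 hpw).1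
      (List.pairwise_append.1 hpw).2.1 ?_ ?_
    · simp [firstPlaces]
    · simp [lastPlaces]
  refine Finset.sum_bij (fun σ _ => List.ofFn σ.symm) ?_ ?_ ?_ (fun _ _ => rfl)
  · intro σ hσ
    rw [List.mem_toFinset, hmem, ← isShuffle_iff]
    refine ⟨?_, (Finset.mem_filter.1 hσ).2⟩
    rw [List.perm_ext_iff_of_nodup (List.nodup_ofFn.2 σ.symm.injective) (List.nodup_finRange _)]
    intro x
    simp only [List.mem_ofFn, List.mem_finRange, iff_true]
    exact σ.symm.surjective x
  · intro σ _ τ _ h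
    have := List.ofFn_injective h
    exact Equiv.symm_bijective.injective (DFunLike.coe_injective this)
  · intro l hl
    rw [List.mem_toFinset, hmem] at hl
    obtain ⟨hp, hl⟩ := hl
    have hlen : l.length = p + q := by simpa using hp.length_eq
    have hnd : l.Nodup := hp.nodup_iff.2 (List.nodup_finRange _)
    let τ : Fin (p + q) → Fin (p + q) := fun i => l.get (i.cast hlen.symm)
    have hτ : Function.Injective τ := by
      intro i j hij
      have := (List.nodup_iff_injective_get.1 hnd) hij
      simpa [Fin.ext_iff] using this
    have hof : List.ofFn τ = l := by
      refine List.ext_get (by simp [hlen]) ?_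
      intros
      simp [τ]
    let σ : Equiv.Perm (Fin (p + q)) := (Equiv.ofBijective τ (Finite.injective_iff_bijective.1 hτ)).symm
    have hσ : List.ofFn σ.symm = l := by simpa [σ] using hof
    refine ⟨σ, ?_, hσ⟩
    simp only [Finset.mem_filter, Finset.mem_univ, true_and]
    rw [isShuffle_iff, hσ]
    exact hl

end Shuffles

/-! ### Koszul signs as scalars. -/

section Koszul

variable (K : Type*) [Field K]

/-- The Koszul sign as a scalar. -/
def kz {n : ℕ} (deg : Fin n → ℤ) (l : List (Fin n)) : K := ((koszulSign deg l : ℤ) : K)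

theorem kz_nil {n : ℕ} (deg : Fin n → ℤ) : kz K deg [] = 1 := by simp [kz, koszulSign]

theorem kz_cons {n : ℕ} (deg : Fin n → ℤ) (i : Fin n) (l : List (Fin n)) :
    kz K deg (i :: l) = sg K (deg i * ((l.filter (· < i)).map deg).sum) * kz K deg l := by
  rw [kz, koszulSign, kz, Units.val_mul, Int.cast_mul]
  congr 1
  induction l.filter (· < i) with
  | nil => simp
  | cons j l ih =>
    simp only [List.map_cons, List.prod_cons, List.sum_cons, Units.val_mul, Int.cast_mul, ih,
      mul_add, sg_add]
    rfl

variable {K}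

theorem koszulSign_smul {M : Type*} [AddCommGroup M] [Module K M] {n : ℕ} (deg : Fin n → ℤ)
    (l : List (Fin n)) (x : M) : koszulSign deg l • x = kz K deg l • x := by
  rw [kz, Int.cast_smul_eq_zsmul, Units.smul_def]

theorem kz_cons_of_lt {n : ℕ} (deg : Fin n → ℤ) {i : Fin n} {l : List (Fin n)}
    (h : ∀ j ∈ l, i < j) : kz K deg (i :: l) = kz K deg l := by
  rw [kz_cons, List.filter_eq_nil_iff.2 (fun j hj => by simpa using (h j hj).le)]
  simp

theorem kz_of_pairwise {n : ℕ} (deg : Fin n → ℤ) {l : List (Fin n)} (h : l.Pairwise (· < ·)) :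
    kz K deg l = 1 := by
  induction l with
  | nil => exact kz_nil K deg
  | cons i l ih =>
    rw [List.pairwise_cons] at h
    rw [kz_cons_of_lt deg h.1, ih h.2]

/-- Placing i first takes it past exactly the places of u, in whatever order they occur, so only the
sum of their degrees counts. -/
theorem kz_cons_of_perm {n : ℕ} (deg : Fin n → ℤ) {i : Fin n} {l u v : List (Fin n)}
    (hp : l.Perm (u ++ v)) (hu : ∀ j ∈ u, j < i) (hv : ∀ j ∈ v, i < j) :
    kz K deg (i :: l) = sg K (deg i * (u.map deg).sum) * kz K deg l := by
  rw [kz_cons]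
  congr 3
  have h1 := ((hp.filter (· < i)).map deg).sum_eq
  rw [h1, List.filter_append, List.filter_eq_self.2 (fun j hj => by simpa using hu j hj),
    List.filter_eq_nil_iff.2 (fun j hj => by simpa using (hv j hj).le), List.append_nil]

end Koszul

/-! ### Indexed sums over words as recursions on lists. -/

section Formulas

variable {K : Type*} [Field K] {V : Type*} [AddCommGroup V] [Module K V]
  {gr : ℤ → Submodule K V}

theorem tens_letters {n : ℕ} (γ : Fin n → Homog gr) (l : List (Fin n)) :
    tens (letters γ l) = wd (l.map γ) := by
  simp [wd, letters, Function.comp_def]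

theorem wdeg_map {n : ℕ} (γ : Fin n → Homog gr) (l : List (Fin n)) :
    wdeg (l.map γ) = (l.map (degs γ)).sum := by
  simp only [wdeg, List.map_map]; rfl

theorem replaceBlock_succ {n : ℕ} (γ : Fin n → Homog gr) (i : Fin n) (l : List (Fin n))
    (k r : ℕ) (x : V) :
    replaceBlock γ (i :: l) (k + 1) r x = ((γ i).2 : V) :: replaceBlock γ l k r x := by
  simp [replaceBlock, letters, Nat.succ_add_eq_add_succ]
  rw [← add_assoc, List.drop_succ_cons]

theorem replaceBlock_zero {n : ℕ} (γ : Fin n → Homog gr) (l : List (Fin n))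
    (r : ℕ) (x : V) :
    replaceBlock γ l 0 r x = x :: letters γ (l.drop r) := by
  simp [replaceBlock, letters]

/-- Contraction of the first two letters of a word. -/
noncomputable def contractHead {n : ℕ} (γ : Fin n → Homog gr) (Pr : Fin n → Fin n → Prop)
    [∀ i j, Decidable (Pr i j)] (E : Fin n → Fin n → V) (i : Fin n) :
    List (Fin n) → TensorAlgebra K V
  | [] => 0
  | j :: l => if Pr i j then TensorAlgebra.ι K (E i j) * wd (l.map γ) else 0

/-- The signed sum over all contractions of two adjacent letters of a word. -/
noncomputable def contract {n : ℕ} (γ : Fin n → Homog gr) (Pr : Fin n → Fin n → Prop)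
    [∀ i j, Decidable (Pr i j)] (E : Fin n → Fin n → V) (c : ℤ) :
    List (Fin n) → TensorAlgebra K V
  | [] => 0
  | i :: l => sg K (c * (γ i).1) • (TensorAlgebra.ι K ((γ i).2 : V) * contract γ Pr E c l) +
      contractHead γ Pr E i l

/-- The position k = 0 contracts the head, and every later position contracts in the tail and picks
up the sign of the first letter. The constant `c` is the degree of the contraction: 1 for μ and k +
1 for the bracket of letters. -/
theorem sum_contract {n m : ℕ} (γ : Fin n → Homog gr) (Pr : Fin n → Fin n → Prop)
    [∀ i j, Decidable (Pr i j)] (E : Fin n → Fin n → V) (c : ℤ) (f : Fin m → Fin n) :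
    ∑ k : Fin m, ∑ k' : Fin m with k.val + 1 = k'.val ∧ Pr (f k) (f k'),
      sg K (c * ∑ s : Fin m with s < k, degs γ (f s)) •
        (tens (replaceBlock γ (List.ofFn f) k 2 (E (f k) (f k'))) : TensorAlgebra K V) =
    contract γ Pr E c (List.ofFn f) := by
  induction m with
  | zero => simp [contract]
  | succ m ih =>
    have ih' := congrArg (lmul K ((γ (f 0)).2 : V)) (ih (fun s => f s.succ))
    simp only [Finset.sum_filter, List.ofFn_succ, contract] at ih' ⊢
    rw [Fin.sum_univ_succ, add_comm]
    congr 1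
    · rw [← lmul_apply, ← ih', map_sum, Finset.smul_sum]
      refine Finset.sum_congr rfl fun k _ => ?_
      rw [Fin.sum_univ_succ, map_sum, Finset.smul_sum]
      simp only [Fin.val_succ, Fin.val_zero, Nat.add_eq_zero_iff, one_ne_zero, and_false,
        false_and, if_false, zero_add, add_left_inj, Nat.succ_ne_zero]
      refine Finset.sum_congr rfl fun k' _ => ?_
      split_ifs with h
      · rw [replaceBlock_succ, tens_cons, Fin.sum_univ_succ]
        simp only [Fin.succ_lt_succ_iff, Fin.succ_pos, if_true, mul_add, sg_add, map_smul,
          lmul_apply, smul_smul]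
        rfl
      · simp
    · cases m with
      | zero => simp [contractHead]
      | succ m =>
        rw [Fin.sum_univ_succ, Fin.sum_univ_succ, Finset.sum_eq_zero]
        · simp only [contractHead, replaceBlock_zero, List.ofFn_succ, tens_letters, Fin.sum_univ_succ]
          simp [tens_letters, replaceBlock_zero]
        · intro k _
          simp

/-- The signed sum over all applications of a map to a letter of a word. -/
noncomputable def applyAll {n : ℕ} (γ : Fin n → Homog gr) (E : Fin n → V) :
    List (Fin n) → TensorAlgebra K V
  | [] => 0
  | i :: l => sg K (γ i).1 • (TensorAlgebra.ι K ((γ i).2 : V) * applyAll γ E l) +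
      TensorAlgebra.ι K (E i) * wd (l.map γ)

theorem sum_applyAll {n m : ℕ} (γ : Fin n → Homog gr) (E : Fin n → V) (f : Fin m → Fin n) :
    ∑ k : Fin m, sg K (∑ s : Fin m with s < k, degs γ (f s)) •
        (tens (replaceBlock γ (List.ofFn f) k 1 (E (f k))) : TensorAlgebra K V) =
    applyAll γ E (List.ofFn f) := by
  induction m with
  | zero => simp [applyAll]
  | succ m ih =>
    have ih' := congrArg (lmul K ((γ (f 0)).2 : V)) (ih (fun s => f s.succ))
    simp only [Finset.sum_filter, List.ofFn_succ, applyAll] at ih' ⊢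
    rw [Fin.sum_univ_succ, add_comm]
    congr 1
    · rw [← lmul_apply, ← ih', map_sum, Finset.smul_sum]
      refine Finset.sum_congr rfl fun k _ => ?_
      rw [Fin.val_succ, replaceBlock_succ, tens_cons, Fin.sum_univ_succ]
      simp only [Fin.succ_lt_succ_iff, Fin.succ_pos, if_true, sg_add, map_smul,
        lmul_apply, smul_smul]
      rfl
    · simp [replaceBlock_zero, tens_letters]

/-- Both sides satisfy the recursion of `sh_cons`. Taking a first is free because a precedes every
other place, and taking b first costs the sign of passing the whole first word. -/
theorem sum_shufs_wd (h : DirectSum.IsInternal gr) {n : ℕ} (γ : Fin n → Homog gr)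
    (u v : List (Fin n)) (hp : (u ++ v).Pairwise (· < ·)) :
    ((shufs u v).map fun l => kz K (degs γ) l • wd (l.map γ)).sum =
      sh h (wd (u.map γ)) (wd (v.map γ)) := by
  induction u generalizing v with
  | nil =>
    rw [shufs_nil_left]
    simp [kz_of_pairwise _ (show v.Pairwise (· < ·) from hp)]
  | cons a u ihu =>
    induction v with
    | nil =>
      rw [List.append_nil] at hp
      rw [shufs_nil_right]
      simp [kz_of_pairwise _ hp]
    | cons b v ihv =>
      have hp1 : (u ++ b :: v).Pairwise (· < ·) := (List.pairwise_cons.1 hp).2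
      have hp2 : (a :: u ++ v).Pairwise (· < ·) :=
        hp.sublist (List.Sublist.append_left (List.sublist_cons_self b v) _)
      have e1 := congrArg (lmul K ((γ a).2 : V)) (ihu (b :: v) hp1)
      have e2 := congrArg (lmul K ((γ b).2 : V)) (ihv hp2)
      rw [shufs_cons, List.map_append, List.sum_append, List.map_map, List.map_map, List.map_cons,
        List.map_cons, wd_cons, wd_cons, sh_cons h (γ a).2.2 (wd_mem _) (γ b).2.2,
        ← wd_cons, ← wd_cons, ← List.map_cons, ← List.map_cons, ← lmul_apply, ← lmul_apply,
        ← e1, ← e2, map_list_sum, map_list_sum, List.map_map, List.map_map, List.smul_sum,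
        List.map_map]
      congr 2
      · refine List.map_congr_left fun l hl => ?_
        have hl := perm_of_mem_shufs hl
        simp only [Function.comp_apply, List.map_cons, wd_cons, map_smul, lmul_apply]
        rw [kz_cons_of_lt]
        exact fun j hj => (List.pairwise_cons.1 hp).1 j (hl.mem_iff.1 hj)
      · refine List.map_congr_left fun l hl => ?_
        have hl := perm_of_mem_shufs hl
        simp only [Function.comp_apply, List.map_cons, wd_cons, map_smul, lmul_apply, smul_smul]
        rw [kz_cons_of_perm _ hl (fun j hj => (List.pairwise_append.1 hp).2.2 j hj b (by simp))
          (List.pairwise_cons.1 (List.pairwise_append.1 hp).2.1).1]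
        simp [wdeg_map, degs]

end Formulas

/-! ### The explicit formulas agree with the recursive operators. -/

section Formulas

variable {K : Type*} [Field K] {V : Type*} [AddCommGroup V] [Module K V]
  {gr : ℤ → Submodule K V}

namespace LetterOps

variable {k : ℤ} (O : LetterOps gr k)

theorem applyAll_add_contract {n : ℕ} (γ : Fin n → Homog gr) (l : List (Fin n)) :
    applyAll γ (fun i => O.d (γ i).2) l +
      contract γ (fun _ _ => True) (fun i j => O.μ (γ i).2 (γ j).2) 1 l =
    O.tD (wd (l.map γ)) := by
  induction l with
  | nil => simp [applyAll, contract]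
  | cons i l ih =>
    rw [List.map_cons, wd_cons, O.tD_cons (γ i).2.2, ← ih, applyAll, contract]
    have : contractHead γ (fun _ _ => True) (fun i j => O.μ (γ i).2 (γ j).2) i l =
        O.merge (γ i).2 (wd (l.map γ)) := by
      cases l with
      | nil => simp [contractHead]
      | cons j l => simp [contractHead]
    rw [this, one_mul, mul_add, smul_add]
    abel

/-- The letter a may only be contracted with a letter of the second word, so only the shuffles
starting with b contribute, where b has passed u. -/
theorem sum_shufs_contractHead {n : ℕ} (γ : Fin n → Homog gr) (c : Fin n → Prop)
    [DecidablePred c] (E : Fin n → Fin n → V) (a b : Fin n)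
    (u v : List (Fin n)) (hp : (u ++ b :: v).Pairwise (· < ·)) (ha : c a) (hu : ∀ x ∈ u, c x)
    (hb : ¬ c b) :
    ((shufs u (b :: v)).map fun l => kz K (degs γ) l •
      contractHead γ (fun i j => c i ∧ ¬ c j) E a l).sum =
      sg K (wdeg (u.map γ) * (γ b).1) •
        (TensorAlgebra.ι K (E a b) * sh O.graded (wd (u.map γ)) (wd (v.map γ))) := by
  cases u with
  | nil =>
    rw [shufs_nil_left]
    simp [kz_of_pairwise _ (show (b :: v).Pairwise (· < ·) from hp), contractHead, ha, hb]
  | cons a' u =>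
    have hp2 : (a' :: u ++ v).Pairwise (· < ·) :=
      hp.sublist (List.Sublist.append_left (List.sublist_cons_self b v) _)
    rw [shufs_cons, List.map_append, List.sum_append, List.map_map, List.map_map,
      List.sum_eq_zero, zero_add, ← lmul_apply, ← sum_shufs_wd O.graded γ _ _ hp2, map_list_sum,
      List.map_map, List.smul_sum, List.map_map]
    · congr 1
      refine List.map_congr_left fun l hl => ?_
      have hl := perm_of_mem_shufs hl
      simp only [Function.comp_apply, contractHead, ha, hb, not_false_eq_true, and_self, if_true,
        map_smul, lmul_apply, smul_smul]
      rw [kz_cons_of_perm _ hl (fun j hj => (List.pairwise_append.1 hp).2.2 j hj b (by simp))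
        (List.pairwise_cons.1 (List.pairwise_append.1 hp).2.1).1, wdeg_map, mul_comm (degs γ b)]
      rfl
    · simp [contractHead, hu a' (by simp)]

/-- Splitting the shuffles by their first letter reproduces the three terms of `tB_cons`. A
contraction of degree k + 1 passing a letter gives (-1)^{(k+1) deg}. The factor in front absorbs its
k-part, leaving the sign of the recursion. -/
theorem sum_shufs_contract {n : ℕ} (γ : Fin n → Homog gr) (c : Fin n → Prop) [DecidablePred c]
    (u v : List (Fin n)) (hp : (u ++ v).Pairwise (· < ·)) (hu : ∀ x ∈ u, c x)
    (hv : ∀ x ∈ v, ¬ c x) :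
    ((shufs u v).map fun l => kz K (degs γ) l •
      contract γ (fun i j => c i ∧ ¬ c j)
        (fun i j => sg K (k * (γ i).1) • O.β (γ i).2 (γ j).2) (k + 1) l).sum =
      sg K (k * wdeg (u.map γ)) • O.tB (wd (u.map γ)) (wd (v.map γ)) := by
  -- A list drawn from one word only has no contractible adjacent pair. This settles the cases with
  -- an empty word.
  have h0 : ∀ l : List (Fin n), ((∀ x ∈ l, c x) ∨ (∀ x ∈ l, ¬ c x)) →
      contract γ (fun i j => c i ∧ ¬ c j)
        (fun i j => sg K (k * (γ i).1) • O.β (γ i).2 (γ j).2) (k + 1) l = 0 := by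
    intro l
    induction l with
    | nil => intro _; rfl
    | cons i l ih =>
      intro h
      rw [contract, ih]
      · cases l with
        | nil => simp [contractHead]
        | cons j l =>
          have : ¬ (c i ∧ ¬ c j) := by
            rcases h with h | h
            · have := h j (by simp); tauto
            · have := h i (by simp); tauto
          simp only [contractHead, this, if_false, mul_zero, smul_zero, add_zero]
      · exact h.imp (fun h x hx => h x (List.mem_cons_of_mem _ hx))
          (fun h x hx => h x (List.mem_cons_of_mem _ hx))
  induction u generalizing v with
  | nil =>
    rw [shufs_nil_left]
    simp [h0 v (Or.inr hv)]
  | cons a u ihu =>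
    induction v with
    | nil =>
      rw [shufs_nil_right]
      simp [h0 _ (Or.inl hu)]
    | cons b v ihv =>
      have hu' : ∀ x ∈ u, c x := fun x hx => hu x (List.mem_cons_of_mem _ hx)
      have hv' : ∀ x ∈ v, ¬ c x := fun x hx => hv x (List.mem_cons_of_mem _ hx)
      have ha : c a := hu a (by simp)
      have hb : ¬ c b := hv b (by simp)
      have hp1 : (u ++ b :: v).Pairwise (· < ·) := (List.pairwise_cons.1 hp).2
      have hp2 : (a :: u ++ v).Pairwise (· < ·) :=
        hp.sublist (List.Sublist.append_left (List.sublist_cons_self b v) _)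
      have e1 := congrArg (lmul K ((γ a).2 : V)) (ihu (b :: v) hp1 hu' hv)
      have e2 := congrArg (lmul K ((γ b).2 : V)) (ihv hp2 hv')
      have e3 := O.sum_shufs_contractHead γ c
        (fun i j => sg K (k * (γ i).1) • O.β (γ i).2 (γ j).2) a b u v hp1 ha hu' hb
      have hA : ((shufs u (b :: v)).map ((fun l => kz K (degs γ) l •
          contract γ (fun i j => c i ∧ ¬ c j)
          (fun i j => sg K (k * (γ i).1) • O.β (γ i).2 (γ j).2) (k + 1) l) ∘ (a :: ·))).sum =
          sg K ((k + 1) * (γ a).1) • lmul K ((γ a).2 : V) ((shufs u (b :: v)).map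
            fun l => kz K (degs γ) l • contract γ (fun i j => c i ∧ ¬ c j)
            (fun i j => sg K (k * (γ i).1) • O.β (γ i).2 (γ j).2) (k + 1) l).sum +
          ((shufs u (b :: v)).map fun l => kz K (degs γ) l •
            contractHead γ (fun i j => c i ∧ ¬ c j)
            (fun i j => sg K (k * (γ i).1) • O.β (γ i).2 (γ j).2) a l).sum := by
        rw [map_list_sum, List.smul_sum, List.map_map, List.map_map, ← List.sum_map_add]
        congr 1
        refine List.map_congr_left fun l hl => ?_
        have hl := perm_of_mem_shufs hl
        simp only [Function.comp_apply, contract, map_smul, lmul_apply]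
        rw [kz_cons_of_lt _ fun j hj => (List.pairwise_cons.1 hp).1 j (hl.mem_iff.1 hj),
          smul_add, smul_comm]
      have hB : ((shufs (a :: u) v).map ((fun l => kz K (degs γ) l •
          contract γ (fun i j => c i ∧ ¬ c j)
          (fun i j => sg K (k * (γ i).1) • O.β (γ i).2 (γ j).2) (k + 1) l) ∘ (b :: ·))).sum =
          (sg K ((γ b).1 * ((γ a).1 + wdeg (u.map γ))) * sg K ((k + 1) * (γ b).1)) •
            lmul K ((γ b).2 : V) ((shufs (a :: u) v).map
            fun l => kz K (degs γ) l • contract γ (fun i j => c i ∧ ¬ c j)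
            (fun i j => sg K (k * (γ i).1) • O.β (γ i).2 (γ j).2) (k + 1) l).sum := by
        rw [map_list_sum, List.smul_sum, List.map_map, List.map_map]
        congr 1
        refine List.map_congr_left fun l hl => ?_
        have hl := perm_of_mem_shufs hl
        -- A leading b cannot be contracted with its successor, since a contraction needs its first
        -- letter from the first word.
        have h1 : contractHead γ (fun i j => c i ∧ ¬ c j)
            (fun i j => sg K (k * (γ i).1) • O.β (γ i).2 (γ j).2) b l = 0 := by
          cases l with
          | nil => rfl
          | cons j l => simp [contractHead, hb]
        simp only [Function.comp_apply, contract, map_smul, lmul_apply, h1, add_zero]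
        rw [kz_cons_of_perm _ hl (fun j hj => (List.pairwise_append.1 hp).2.2 j hj b (by simp))
          (List.pairwise_cons.1 (List.pairwise_append.1 hp).2.1).1]
        have h2 : (List.map (degs γ) (a :: u)).sum = (γ a).1 + wdeg (u.map γ) := by
          rw [wdeg_map]; simp [degs]
        rw [h2, smul_smul, smul_smul]
        congr 1
        change sg K ((γ b).1 * _) * _ * _ = _
        ring
      rw [shufs_cons, List.map_append, List.sum_append, List.map_map, List.map_map, hA, hB, e1, e2,
        e3, List.map_cons, List.map_cons, wd_cons, wd_cons,
        O.tB_cons (γ a).2.2 (wd_mem _) (γ b).2.2]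
      simp only [map_smul, lmul_apply, wdeg_cons, wd_cons, smul_add, smul_mul_assoc]
      match_scalars <;>
      · try simp only [sg_add, add_mul, mul_add, sg_one, sg_self_mul]
        try ring_nf
        try simp only [sg_zero, sg_sq, sg_cube, sg_pow_four]
        try ring_nf

end LetterOps

theorem sum_degs {n : ℕ} (α : Fin n → Homog gr) :
    ∑ i, degs α i = wdeg ((List.finRange n).map α) := by
  rw [wdeg_map, ← List.ofFn_id, List.map_ofFn, List.sum_ofFn]; rfl

theorem packetOf_eq {n : ℕ} (α : Fin n → Homog gr) :
    packetOf α = (shuffleSubmodule gr).mkQ (wd ((List.finRange n).map α)) := by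
  rw [packetOf, packet, tens_letters]; rfl

theorem symProdOf_eq {n : ℕ} (α : Fin n → Homog gr) (l : List (Fin n)) :
    symProdOf α l = (symSubmodule gr).mkQ (wd (l.map α)) := by
  rw [symProdOf, symProd, tens_letters]; rfl

theorem exists_fin_map (l : List (Homog gr)) :
    ∃ (n : ℕ) (α : Fin n → Homog gr), (List.finRange n).map α = l :=
  ⟨l.length, l.get, by rw [← List.ofFn_id, List.map_ofFn]; exact List.ofFn_get l⟩

theorem map_firstPlaces {p q : ℕ} (α : Fin p → Homog gr) (β : Fin q → Homog gr) :
    (firstPlaces p q).map (Fin.append α β) = (List.finRange p).map α := by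
  simp [firstPlaces, Function.comp_def]

theorem map_lastPlaces {p q : ℕ} (α : Fin p → Homog gr) (β : Fin q → Homog gr) :
    (lastPlaces p q).map (Fin.append α β) = (List.finRange q).map β := by
  simp [lastPlaces, Function.comp_def]

theorem pairwise_places (p q : ℕ) : (firstPlaces p q ++ lastPlaces p q).Pairwise (· < ·) := by
  rw [firstPlaces_append_lastPlaces]; exact pairwise_finRange _

theorem bat_eq (h : DirectSum.IsInternal gr) {p q : ℕ} (α : Fin p → Homog gr)
    (β : Fin q → Homog gr) :
    bat α β = sh h (wd ((List.finRange p).map α)) (wd ((List.finRange q).map β)) := by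
  classical
  have := sum_shufs_wd h (Fin.append α β) (firstPlaces p q) (lastPlaces p q) (pairwise_places p q)
  rw [map_firstPlaces, map_lastPlaces, ← sum_shuffles] at this
  rw [← this, bat]
  refine Finset.sum_congr (by congr) fun σ _ => ?_
  rw [koszulSign_smul (K := K), tens_letters]

end Formulas

/-! ### Descent to the quotient by shuffles. -/

section Quotient

variable {K : Type*} [Field K] {V : Type*} [AddCommGroup V] [Module K V]
  {gr : ℤ → Submodule K V}

variable (gr) in
/-- The span of the words of positive length. -/
def Tplus : Submodule K (TensorAlgebra K V) :=
  Submodule.span K {t | ∃ l : List (Homog gr), l ≠ [] ∧ t = wd l}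

theorem ι_mul_mem_Tplus (h : DirectSum.IsInternal gr) {i : ℤ} {a : V} (ha : a ∈ gr i)
    (t : TensorAlgebra K V) : TensorAlgebra.ι K a * t ∈ Tplus gr := by
  have : ⊤ ≤ (Tplus gr).comap (lmul K a) := by
    rw [← span_words h, Submodule.span_le]
    rintro _ ⟨l, rfl⟩
    exact Submodule.subset_span ⟨⟨i, a, ha⟩ :: l, by simp, by simp⟩
  exact this (Submodule.mem_top (x := t))

theorem span_packetOf (h : DirectSum.IsInternal gr) :
    Submodule.span K (Set.range fun α : (Σ n : ℕ, Fin n → Homog gr) => packetOf α.2) = ⊤ := by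
  rw [eq_top_iff, ← Submodule.range_mkQ, ← Submodule.map_top, ← span_words h, Submodule.map_span,
    Submodule.span_le]
  rintro _ ⟨_, ⟨l, rfl⟩, rfl⟩
  obtain ⟨n, α, rfl⟩ := exists_fin_map l
  exact Submodule.subset_span ⟨⟨n, α⟩, packetOf_eq α⟩

theorem span_symProdOf (h : DirectSum.IsInternal gr) :
    Submodule.span K (Set.range fun α : (Σ n : ℕ, Fin n → Homog gr) =>
      symProdOf α.2 (List.finRange α.1)) = ⊤ := by
  rw [eq_top_iff, ← Submodule.range_mkQ, ← Submodule.map_top, ← span_words h, Submodule.map_span,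
    Submodule.span_le]
  rintro _ ⟨_, ⟨l, rfl⟩, rfl⟩
  obtain ⟨n, α, rfl⟩ := exists_fin_map l
  exact Submodule.subset_span ⟨⟨n, α⟩, symProdOf_eq α _⟩

theorem packetGr_eq (n : ℤ) :
    packetGr gr n = (Tgr gr n).map (shuffleSubmodule gr).mkQ := by
  rw [packetGr, Tgr, Submodule.map_span]
  congr 1
  ext X
  constructor
  · rintro ⟨m, α, hα, rfl⟩
    exact ⟨_, ⟨_, by rw [← hα, sum_degs], rfl⟩, (packetOf_eq α).symm⟩
  · rintro ⟨_, ⟨l, hl, rfl⟩, rfl⟩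
    obtain ⟨m, α, rfl⟩ := exists_fin_map l
    exact ⟨m, α, by rw [sum_degs, hl], (packetOf_eq α).symm⟩

theorem symGr_eq (n : ℤ) :
    symGr gr n = (Tgr gr n).map (symSubmodule gr).mkQ := by
  rw [symGr, Tgr, Submodule.map_span]
  congr 1
  ext X
  constructor
  · rintro ⟨m, α, hα, rfl⟩
    exact ⟨_, ⟨_, by rw [← hα, sum_degs], rfl⟩, (symProdOf_eq α _).symm⟩
  · rintro ⟨_, ⟨l, hl, rfl⟩, rfl⟩
    obtain ⟨m, α, rfl⟩ := exists_fin_map l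
    exact ⟨m, α, by rw [sum_degs, hl], (symProdOf_eq α _).symm⟩

theorem finRange_map_ne_nil {p : ℕ} (hp : 1 ≤ p) (α : Fin p → Homog gr) :
    (List.finRange p).map α ≠ [] := by
  intro h
  have := congrArg List.length h
  simp at this
  omega

theorem isInternal_packetGr (h : DirectSum.IsInternal gr) : DirectSum.IsInternal (packetGr gr) := by
  rw [funext packetGr_eq]
  refine isInternal_quotient h _ ?_
  rintro r (rfl | ⟨p, q, α, β, -, -, rfl⟩)
  · exact ⟨0, one_mem_Tgr⟩
  · rw [bat_eq h]
    exact ⟨_, sh_mem h (wd_mem _) (wd_mem _)⟩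

/-- The relations involve only nonempty words. The span `Tplus` keeps track of this condition for
linear combinations such as the values of `tD` and `tB`. -/
theorem sh_mem_shuffleSubmodule (h : DirectSum.IsInternal gr) {X Y : TensorAlgebra K V}
    (hX : X ∈ Tplus gr) (hY : Y ∈ Tplus gr) : sh h X Y ∈ shuffleSubmodule gr := by
  have h1 : Tplus gr ≤ (shuffleSubmodule gr).comap ((sh h).flip Y) := by
    refine Submodule.span_le.2 ?_
    rintro _ ⟨u, hu, rfl⟩
    have h2 : Tplus gr ≤ (shuffleSubmodule gr).comap (sh h (wd u)) := by
      refine Submodule.span_le.2 ?_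
      rintro _ ⟨v, hv, rfl⟩
      obtain ⟨p, α, rfl⟩ := exists_fin_map u
      obtain ⟨q, β, rfl⟩ := exists_fin_map v
      refine Submodule.subset_span (Or.inr ⟨p, q, α, β, ?_, ?_, (bat_eq h α β).symm⟩)
      · rcases Nat.eq_zero_or_pos p with rfl | hp
        · simp at hu
        · exact hp
      · rcases Nat.eq_zero_or_pos q with rfl | hq
        · simp at hv
        · exact hq
    exact h2 hY
  exact h1 hX

/-- Induction over the generators of the shuffle relations. -/
theorem shuffleSubmodule_le (h : DirectSum.IsInternal gr) {N : Submodule K (TensorAlgebra K V)}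
    (h1 : 1 ∈ N) (h2 : ∀ u v : List (Homog gr), u ≠ [] → v ≠ [] → sh h (wd u) (wd v) ∈ N) :
    shuffleSubmodule gr ≤ N := by
  refine Submodule.span_le.2 ?_
  rintro _ (rfl | ⟨p, q, α, β, hp, hq, rfl⟩)
  · exact h1
  · rw [bat_eq h]
    exact h2 _ _ (finRange_map_ne_nil hp α) (finRange_map_ne_nil hq β)

/-- The bilinear map induced on a quotient. -/
noncomputable def bilinQ {T : Type*} [AddCommGroup T] [Module K T] (N : Submodule K T)
    (F : T →ₗ[K] T →ₗ[K] T) (h1 : ∀ X ∈ N, ∀ Y, F X Y ∈ N) (h2 : ∀ X, ∀ Y ∈ N, F X Y ∈ N) :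
    (T ⧸ N) →ₗ[K] (T ⧸ N) →ₗ[K] (T ⧸ N) :=
  N.liftQ
    { toFun := fun X => N.mapQ N (F X) (fun Y hY => h2 X Y hY)
      map_add' := fun X Y => by ext; simp
      map_smul' := fun r X => by ext; simp }
    (by
      intro X hX
      rw [LinearMap.mem_ker]
      ext Y
      simpa using h1 X hX Y)

namespace LetterOps

variable {k : ℤ} (O : LetterOps gr k)

theorem merge_mem_Tplus (a : Homog gr) (l : List (Homog gr)) :
    O.merge a.2 (wd l) ∈ Tplus gr := by
  cases l with
  | nil => simp
  | cons b l =>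
    rw [wd_cons, merge_ι_mul]
    exact ι_mul_mem_Tplus O.graded (O.μ_mem a.2.2 b.2.2) _

theorem tD_mem_Tplus (l : List (Homog gr)) : O.tD (wd l) ∈ Tplus gr := by
  cases l with
  | nil => simp
  | cons a l =>
    rw [wd_cons, O.tD_cons a.2.2]
    exact add_mem (add_mem (ι_mul_mem_Tplus O.graded (O.d_mem a.2.2) _)
      (Submodule.smul_mem _ _ (ι_mul_mem_Tplus O.graded a.2.2 _))) (O.merge_mem_Tplus a l)

theorem tB_mem_Tplus (u v : List (Homog gr)) : O.tB (wd u) (wd v) ∈ Tplus gr := by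
  cases u with
  | nil => simp
  | cons a u =>
    cases v with
    | nil => simp
    | cons b v =>
      rw [wd_cons, wd_cons, O.tB_cons a.2.2 (wd_mem u) b.2.2]
      exact add_mem (add_mem
        (Submodule.smul_mem _ _ (ι_mul_mem_Tplus O.graded (O.β_mem a.2.2 b.2.2) _))
        (Submodule.smul_mem _ _ (ι_mul_mem_Tplus O.graded a.2.2 _)))
        (Submodule.smul_mem _ _ (ι_mul_mem_Tplus O.graded b.2.2 _))

theorem wd_mem_Tplus {l : List (Homog gr)} (hl : l ≠ []) : wd l ∈ Tplus gr :=
  Submodule.subset_span ⟨l, hl, rfl⟩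

/-- By the derivation rule, a shuffle is sent to shuffles whose factors still have positive length.
The scalar relation is killed. -/
theorem tD_mem_shuffleSubmodule :
    shuffleSubmodule gr ≤ (shuffleSubmodule gr).comap O.tD := by
  refine shuffleSubmodule_le O.graded (by simp) fun u v hu hv => ?_
  rw [Submodule.mem_comap, O.tD_sh_wd]
  exact add_mem (sh_mem_shuffleSubmodule _ (O.tD_mem_Tplus u) (wd_mem_Tplus hv))
    (Submodule.smul_mem _ _ (sh_mem_shuffleSubmodule _ (wd_mem_Tplus hu) (O.tD_mem_Tplus v)))

theorem tB_mem_shuffleSubmodule_left (X : TensorAlgebra K V) (hX : X ∈ shuffleSubmodule gr)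
    (Y : TensorAlgebra K V) : O.tB X Y ∈ shuffleSubmodule gr := by
  have h1 : ⊤ ≤ (shuffleSubmodule gr).comap (O.tB X) := by
    rw [← span_words O.graded, Submodule.span_le]
    rintro _ ⟨w, rfl⟩
    have h2 : shuffleSubmodule gr ≤ (shuffleSubmodule gr).comap (O.tB.flip (wd w)) := by
      refine shuffleSubmodule_le O.graded (by simp) fun u v hu hv => ?_
      rw [Submodule.mem_comap, LinearMap.flip_apply, O.tB_sh_wd]
      exact add_mem
        (Submodule.smul_mem _ _
          (sh_mem_shuffleSubmodule _ (wd_mem_Tplus hu) (O.tB_mem_Tplus v w)))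
        (Submodule.smul_mem _ _
          (sh_mem_shuffleSubmodule _ (O.tB_mem_Tplus u w) (wd_mem_Tplus hv)))
    exact h2 hX
  exact h1 (Submodule.mem_top (x := Y))

/-- Graded symmetry of `tB` reduces this to the first argument. -/
theorem tB_mem_shuffleSubmodule_right (X : TensorAlgebra K V)
    (Y : TensorAlgebra K V) (hY : Y ∈ shuffleSubmodule gr) : O.tB X Y ∈ shuffleSubmodule gr := by
  have h1 : ⊤ ≤ (shuffleSubmodule gr).comap (O.tB.flip Y) := by
    rw [← span_words O.graded, Submodule.span_le]
    rintro _ ⟨w, rfl⟩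
    have h2 : shuffleSubmodule gr ≤ (shuffleSubmodule gr).comap (O.tB (wd w)) := by
      refine shuffleSubmodule_le O.graded (by simp) fun u v hu hv => ?_
      rw [Submodule.mem_comap, O.tB_comm (wd_mem w) (sh_mem O.graded (wd_mem u) (wd_mem v))]
      refine Submodule.smul_mem _ _ (O.tB_mem_shuffleSubmodule_left _ ?_ _)
      exact sh_mem_shuffleSubmodule _ (wd_mem_Tplus hu) (wd_mem_Tplus hv)
    exact h2 hY
  exact h1 (Submodule.mem_top (x := X))

/-- The differential on packets. -/
noncomputable def pD : Packets gr →ₗ[K] Packets gr :=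
  (shuffleSubmodule gr).mapQ _ O.tD O.tD_mem_shuffleSubmodule

/-- The bracket on packets. -/
noncomputable def pB : Packets gr →ₗ[K] Packets gr →ₗ[K] Packets gr :=
  bilinQ _ O.tB O.tB_mem_shuffleSubmodule_left O.tB_mem_shuffleSubmodule_right

@[simp] theorem pD_mk (X : TensorAlgebra K V) :
    O.pD ((shuffleSubmodule gr).mkQ X) = (shuffleSubmodule gr).mkQ (O.tD X) := rfl

@[simp] theorem pB_mk (X Y : TensorAlgebra K V) :
    O.pB ((shuffleSubmodule gr).mkQ X) ((shuffleSubmodule gr).mkQ Y) =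
      (shuffleSubmodule gr).mkQ (O.tB X Y) := rfl

theorem tD_tD (X : TensorAlgebra K V) : O.tD (O.tD X) = 0 := by
  have : O.tD ∘ₗ O.tD = 0 := ext_words O.graded fun l => by simpa using O.tD_tD_wd l
  exact congr($this X)

theorem tD_tB {m : ℤ} {X : TensorAlgebra K V} (hX : X ∈ Tgr gr m) (Y : TensorAlgebra K V) :
    O.tD (O.tB X Y) = -O.tB (O.tD X) Y - sg K (m + k) • O.tB X (O.tD Y) := by
  refine eq_on_Tgr (F := O.tD ∘ₗ O.tB.flip Y)
    (G := -(O.tB.flip Y ∘ₗ O.tD) - sg K (m + k) • O.tB.flip (O.tD Y)) ?_ hX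
  rintro l rfl
  have : O.tD ∘ₗ O.tB (wd l) = -O.tB (O.tD (wd l)) - sg K (wdeg l + k) • O.tB (wd l) ∘ₗ O.tD :=
    ext_words O.graded fun v => by simpa using O.tD_tB_wd l v
  simpa using congr($this Y)

theorem tB_jacobi {m n l : ℤ} {X Y Z : TensorAlgebra K V} (hX : X ∈ Tgr gr m) (hY : Y ∈ Tgr gr n)
    (hZ : Z ∈ Tgr gr l) :
    sg K ((m + k) * (l + k)) • O.tB (O.tB X Y) Z +
      sg K ((n + k) * (m + k)) • O.tB (O.tB Y Z) X +
      sg K ((l + k) * (n + k)) • O.tB (O.tB Z X) Y = 0 := by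
  refine eq_on_Tgr (F := sg K ((m + k) * (l + k)) • O.tB (O.tB X Y) +
      sg K ((n + k) * (m + k)) • (O.tB.flip X ∘ₗ O.tB Y) +
      sg K ((l + k) * (n + k)) • (O.tB.flip Y ∘ₗ O.tB.flip X)) (G := 0) ?_ hZ
  rintro w rfl
  simp only [LinearMap.add_apply, LinearMap.smul_apply, LinearMap.comp_apply,
    LinearMap.flip_apply, LinearMap.zero_apply]
  refine eq_on_Tgr (F := sg K ((m + k) * (wdeg w + k)) • (O.tB.flip (wd w) ∘ₗ O.tB X) +
      sg K ((n + k) * (m + k)) • (O.tB.flip X ∘ₗ O.tB.flip (wd w)) +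
      sg K ((wdeg w + k) * (n + k)) • (O.tB (O.tB (wd w) X))) (G := 0) ?_ hY
  rintro v rfl
  simp only [LinearMap.add_apply, LinearMap.smul_apply, LinearMap.comp_apply,
    LinearMap.flip_apply, LinearMap.zero_apply]
  refine eq_on_Tgr (F := sg K ((m + k) * (wdeg w + k)) • (O.tB.flip (wd w) ∘ₗ O.tB.flip (wd v)) +
      sg K ((wdeg v + k) * (m + k)) • O.tB (O.tB (wd v) (wd w)) +
      sg K ((wdeg w + k) * (wdeg v + k)) • (O.tB.flip (wd v) ∘ₗ O.tB (wd w))) (G := 0) ?_ hX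
  rintro u rfl
  exact O.jacobi_wd u v w

theorem pD_pD (X : Packets gr) : O.pD (O.pD X) = 0 := by
  obtain ⟨X, rfl⟩ := Submodule.mkQ_surjective _ X
  rw [pD_mk, pD_mk, tD_tD, map_zero]

theorem pD_mem {m : ℤ} {X : Packets gr} (hX : X ∈ packetGr gr m) :
    O.pD X ∈ packetGr gr (m + 1) := by
  rw [packetGr_eq] at hX ⊢
  obtain ⟨X, hX, rfl⟩ := hX
  exact ⟨_, O.tD_mem hX, rfl⟩

theorem pB_mem {m n : ℤ} {X Y : Packets gr} (hX : X ∈ packetGr gr m) (hY : Y ∈ packetGr gr n) :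
    O.pB X Y ∈ packetGr gr (m + n + (k + 1)) := by
  rw [packetGr_eq] at hX hY ⊢
  obtain ⟨X, hX, rfl⟩ := hX
  obtain ⟨Y, hY, rfl⟩ := hY
  exact ⟨_, O.tB_mem hX hY, rfl⟩

theorem pB_comm {m n : ℤ} {X Y : Packets gr} (hX : X ∈ packetGr gr m) (hY : Y ∈ packetGr gr n) :
    O.pB X Y = sg K ((m + k) * (n + k)) • O.pB Y X := by
  rw [packetGr_eq] at hX hY
  obtain ⟨X, hX, rfl⟩ := hX
  obtain ⟨Y, hY, rfl⟩ := hY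
  rw [pB_mk, pB_mk, O.tB_comm hX hY, map_smul]

theorem pD_pB {m : ℤ} {X : Packets gr} (hX : X ∈ packetGr gr m) (Y : Packets gr) :
    O.pD (O.pB X Y) = -O.pB (O.pD X) Y - sg K (m + k) • O.pB X (O.pD Y) := by
  rw [packetGr_eq] at hX
  obtain ⟨X, hX, rfl⟩ := hX
  obtain ⟨Y, rfl⟩ := Submodule.mkQ_surjective _ Y
  simp only [pB_mk, pD_mk, O.tD_tB hX, map_sub, map_neg, map_smul]

theorem pB_jacobi {m n l : ℤ} {X Y Z : Packets gr} (hX : X ∈ packetGr gr m)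
    (hY : Y ∈ packetGr gr n) (hZ : Z ∈ packetGr gr l) :
    sg K ((m + k) * (l + k)) • O.pB (O.pB X Y) Z +
      sg K ((n + k) * (m + k)) • O.pB (O.pB Y Z) X +
      sg K ((l + k) * (n + k)) • O.pB (O.pB Z X) Y = 0 := by
  rw [packetGr_eq] at hX hY hZ
  obtain ⟨X, hX, rfl⟩ := hX
  obtain ⟨Y, hY, rfl⟩ := hY
  obtain ⟨Z, hZ, rfl⟩ := hZ
  have := congrArg (shuffleSubmodule gr).mkQ (O.tB_jacobi hX hY hZ)
  simp only [map_add, map_smul, map_zero] at this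
  exact this

end LetterOps

end Quotient

/-! ### The operations of A with the degrees of the shifted grading. -/

namespace DiffABAlgebra

variable {K A : Type*} [Field K] [AddCommGroup A] [Module K A] {a b : ℤ}
  (P : DiffABAlgebra K A a b)

theorem grV_internal : DirectSum.IsInternal P.grV := isInternal_shift P.graded _

/-- An element of degree i here has |x| + a = i + 1 and |x| + b = i + (b - a) + 1. These
substitutions produce the exponents in this group of lemmas. -/
theorem mul_comm_sg {i j : ℤ} {x y : A} (hx : x ∈ P.grV i) (hy : y ∈ P.grV j) :
    P.mul x y = sg K ((i + 1) * (j + 1)) • P.mul y x := by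
  rw [P.mul_comm hx hy, negOnePow_smul (K := K)]
  congr 2
  ring

theorem br_antisymm_sg {i j : ℤ} {x y : A} (hx : x ∈ P.grV i) (hy : y ∈ P.grV j) :
    P.br x y = -(sg K ((i + (b - a) + 1) * (j + (b - a) + 1)) • P.br y x) := by
  rw [P.br_antisymm hx hy, negOnePow_smul (K := K)]
  congr 3
  ring

theorem jacobi_sg {i j l : ℤ} {x y z : A} (hx : x ∈ P.grV i) (hy : y ∈ P.grV j)
    (hz : z ∈ P.grV l) :
    sg K ((i + (b - a) + 1) * (l + (b - a) + 1)) • P.br (P.br x y) z +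
      sg K ((j + (b - a) + 1) * (i + (b - a) + 1)) • P.br (P.br y z) x +
      sg K ((l + (b - a) + 1) * (j + (b - a) + 1)) • P.br (P.br z x) y = 0 := by
  rw [← P.jacobi hx hy hz]
  simp only [negOnePow_smul (K := K)]
  congr 4 <;> ring

theorem leibniz_sg {i j : ℤ} {x y : A} (z : A) (hx : x ∈ P.grV i) (hy : y ∈ P.grV j) :
    P.br x (P.mul y z) = P.mul (P.br x y) z +
      sg K ((j + 1) * (i + (b - a) + 1)) • P.mul y (P.br x z) := by
  rw [P.leibniz z hx hy, negOnePow_smul (K := K)]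
  congr 3
  ring

theorem d_mul_sg {i : ℤ} {x : A} (y : A) (hx : x ∈ P.grV i) :
    P.d (P.mul x y) = P.mul (P.d x) y + sg K (i + 1) • P.mul x (P.d y) := by
  rw [P.d_mul y hx, negOnePow_smul (K := K)]
  congr 3
  ring

theorem d_br_sg {i : ℤ} {x : A} (y : A) (hx : x ∈ P.grV i) :
    P.d (P.br x y) = P.br (P.d x) y + sg K (i + (b - a) + 1) • P.br x (P.d y) := by
  rw [P.d_br y hx, negOnePow_smul (K := K)]
  congr 3
  ring

theorem grV_cast {i j : ℤ} {x : A} (hx : x ∈ P.gr i) (e : i = j + (-a + 1)) : x ∈ P.grV j := by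
  subst e; exact hx

theorem d_mem_grV {i : ℤ} {x : A} (hx : x ∈ P.grV i) : P.d x ∈ P.grV (i + 1) :=
  P.grV_cast (P.d_mem hx) (by ring)

theorem mul_mem_grV {i j : ℤ} {x y : A} (hx : x ∈ P.grV i) (hy : y ∈ P.grV j) :
    P.mul x y ∈ P.grV (i + j + 1) :=
  P.grV_cast (P.mul_mem hx hy) (by ring)

theorem br_mem_grV {i j : ℤ} {x y : A} (hx : x ∈ P.grV i) (hy : y ∈ P.grV j) :
    P.br x y ∈ P.grV (i + j + (b - a) + 1) :=
  P.grV_cast (P.br_mem hx hy) (by ring)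

/-- The operations of a differential graded `(a,b)`-algebra, with the signs of `A[-a+1]`. -/
noncomputable def letterOps : LetterOps P.grV (b - a) where
  graded := P.grV_internal
  d := P.d
  μ := P.mul ∘ₗ sgn P.grV_internal 1
  β := P.br ∘ₗ sgn P.grV_internal 1
  d_mem := P.d_mem_grV
  μ_mem hx hy := by
    rw [LinearMap.comp_apply, sgn_apply _ _ hx, map_smul, LinearMap.smul_apply]
    exact Submodule.smul_mem _ _ (P.mul_mem_grV hx hy)
  β_mem hx hy := by
    rw [LinearMap.comp_apply, sgn_apply _ _ hx, map_smul, LinearMap.smul_apply]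
    exact Submodule.smul_mem _ _ (P.br_mem_grV hx hy)
  d_d := P.d_d
  μ_comm hx hy := by
    simp only [LinearMap.comp_apply, sgn_apply _ _ hx, sgn_apply _ _ hy, map_smul,
      LinearMap.smul_apply]
    rw [P.mul_comm_sg hx hy]
    match_scalars
    simp only [sg_add, add_mul, mul_add, sg_one]
    ring_nf
    try simp only [sg_one, sg_sq, sg_cube, sg_pow_four]
    try ring_nf
  μ_assoc {i x} y z hx := by
    -- The twist in front of yz depends on the degree of y, which is not assumed homogeneous, so y
    -- is decomposed.
    revert z
    refine induction_homog P.grV_internal (p := fun y => ∀ z : A,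
      (P.mul ∘ₗ sgn P.grV_internal 1) ((P.mul ∘ₗ sgn P.grV_internal 1) x y) z =
      -(sg K i • (P.mul ∘ₗ sgn P.grV_internal 1) x ((P.mul ∘ₗ sgn P.grV_internal 1) y z))) ?_ ?_ ?_ y
    · intro z; simp
    · intro y y' h h' z
      simp only [map_add, LinearMap.add_apply, h z, h' z, smul_add, neg_add]
    · intro j y hy z
      simp only [LinearMap.comp_apply, sgn_apply _ _ hx, sgn_apply _ _ hy, map_smul,
        LinearMap.smul_apply, sgn_apply _ _ (P.mul_mem_grV hx hy), P.mul_assoc]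
      match_scalars
      simp only [sg_add, add_mul, mul_add, sg_one]
      ring_nf
      try simp only [sg_one, sg_sq, sg_cube, sg_pow_four]
      try ring_nf
  d_μ y hx := by
    simp only [LinearMap.comp_apply, sgn_apply _ _ hx, map_smul, sgn_apply _ _ (P.d_mem_grV hx),
      LinearMap.smul_apply, P.d_mul_sg y hx]
    match_scalars <;>
    · try simp only [sg_add, add_mul, mul_add, sg_one]
      try ring_nf
      try simp only [sg_one, sg_sq, sg_cube, sg_pow_four]
      try ring_nf
  β_comm hx hy := by
    simp only [LinearMap.comp_apply, sgn_apply _ _ hx, sgn_apply _ _ hy, map_smul,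
      LinearMap.smul_apply]
    rw [P.br_antisymm_sg hx hy]
    generalize b - a = k
    match_scalars
    simp only [sg_add, add_mul, mul_add, sg_one, sg_self_mul]
    ring_nf
    try simp only [sg_one, sg_sq, sg_cube, sg_pow_four]
    try ring_nf
  d_β y hx := by
    simp only [LinearMap.comp_apply, sgn_apply _ _ hx, map_smul, sgn_apply _ _ (P.d_mem_grV hx),
      LinearMap.smul_apply, P.d_br_sg y hx]
    generalize b - a = k
    match_scalars <;>
    · try simp only [sg_add, add_mul, mul_add, sg_one]
      try ring_nf
      try simp only [sg_one, sg_sq, sg_cube, sg_pow_four]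
      try ring_nf
  β_μ z hx hy := by
    simp only [LinearMap.comp_apply, sgn_apply _ _ hx, sgn_apply _ _ hy, map_smul,
      LinearMap.smul_apply, sgn_apply _ _ (P.br_mem_grV hx hy), P.leibniz_sg z hx hy]
    generalize b - a = k
    match_scalars <;>
    · try simp only [sg_add, add_mul, mul_add, sg_one]
      try ring_nf
      try simp only [sg_one, sg_sq, sg_cube, sg_pow_four]
      try ring_nf
  jacobi {i j l x y z} hx hy hz := by
    have := P.jacobi_sg hx hy hz
    simp only [LinearMap.comp_apply, sgn_apply _ _ hx, sgn_apply _ _ hy, sgn_apply _ _ hz,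
      map_smul, LinearMap.smul_apply, sgn_apply _ _ (P.br_mem_grV hx hy),
      sgn_apply _ _ (P.br_mem_grV hy hz), sgn_apply _ _ (P.br_mem_grV hz hx)]
    revert this
    generalize b - a = k
    intro this
    -- This sign is the ratio between each term written with β and the corresponding term of the
    -- original identity. It is the same for the three cyclic terms.
    linear_combination (norm := skip) sg K (i + j + l + k) • this
    match_scalars <;>
    · try simp only [sg_add, add_mul, mul_add, sg_one, sg_self_mul]
      try ring_nf
      try simp only [sg_sq, sg_cube, sg_pow_four]
      try ring_nf

theorem letterOps_μ (x y : Homog P.grV) : P.letterOps.μ x.2 y.2 = P.mu x y := by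
  simp [letterOps, mu, sgn_apply _ _ x.2.2, negOnePow_smul (K := K)]

theorem letterOps_β (x y : Homog P.grV) :
    sg K ((b - a) * x.1) • P.letterOps.β x.2 y.2 = P.ell x y := by
  simp [letterOps, ell, sgn_apply _ _ x.2.2, negOnePow_smul (K := K), smul_smul, ← sg_add]
  congr 2
  ring

theorem pD_packetOf {n : ℕ} (α : Fin n → Homog P.grV) :
    P.letterOps.pD (packetOf α) = P.DFormula α := by
  rw [packetOf_eq, LetterOps.pD_mk, ← LetterOps.applyAll_add_contract, map_add, DFormula]
  congr 1
  · rw [← List.ofFn_id, ← sum_applyAll, map_sum]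
    refine Finset.sum_congr rfl fun k _ => ?_
    rw [map_smul, negOnePow_smul (K := K)]
    rfl
  · have := sum_contract α (fun _ _ => True)
      (fun i j => P.letterOps.μ (α i).2 (α j).2) 1 id
    rw [← List.ofFn_id, ← this, map_sum]
    refine Finset.sum_congr rfl fun k _ => ?_
    simp only [and_true]
    rw [map_sum]
    refine Finset.sum_congr rfl fun k' _ => ?_
    rw [map_smul, negOnePow_smul (K := K), one_mul]
    simp only [id_eq, letterOps_μ]
    rfl

theorem D_eq : P.D = P.letterOps.pD :=
  linearExt_eq (span_packetOf P.grV_internal) _ fun α => P.pD_packetOf α.2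

theorem pB_packetOf {p q : ℕ} (α : Fin p → Homog P.grV) (β : Fin q → Homog P.grV) :
    P.letterOps.pB (sgn (isInternal_packetGr P.grV_internal) (b - a) (packetOf α)) (packetOf β) =
      P.ell2Formula α β := by
  classical
  have hα : packetOf α ∈ packetGr P.grV (wdeg ((List.finRange p).map α)) :=
    Submodule.subset_span ⟨p, α, sum_degs α, rfl⟩
  have key := P.letterOps.sum_shufs_contract (Fin.append α β)
    (fun i : Fin (p + q) => (i : ℕ) < p) (firstPlaces p q) (lastPlaces p q) (pairwise_places p q)
    (by simp [firstPlaces]) (by simp [lastPlaces])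
  rw [map_firstPlaces, map_lastPlaces, ← sum_shuffles] at key
  rw [sgn_apply _ _ hα, map_smul, LinearMap.smul_apply, packetOf_eq, packetOf_eq,
    LetterOps.pB_mk, ← map_smul, ← key, map_sum, ell2Formula]
  refine Finset.sum_congr (by congr) fun σ _ => ?_
  rw [map_smul, ← sum_contract, map_sum, Finset.smul_sum]
  refine Finset.sum_congr rfl fun k _ => ?_
  rw [map_sum, Finset.smul_sum]
  simp only [not_lt, and_assoc]
  refine Finset.sum_congr (by congr) fun k' _ => ?_
  rw [map_smul, mul_smul, koszulSign_smul (K := K), negOnePow_smul (K := K), letterOps_β]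
  rfl

theorem ell2_eq :
    P.ell2 = P.letterOps.pB ∘ₗ sgn (isInternal_packetGr P.grV_internal) (b - a) := by
  refine linearExt_eq (span_packetOf P.grV_internal) _ fun α => ?_
  refine (linearExt_eq (span_packetOf P.grV_internal) _ fun β => ?_).symm
  exact P.pB_packetOf α.2 β.2

theorem gr'_internal : DirectSum.IsInternal P.gr' :=
  isInternal_shift (isInternal_packetGr P.grV_internal) _

theorem gr''_internal : DirectSum.IsInternal P.gr'' :=
  isInternal_shift (isInternal_packetGr P.grV_internal) _

theorem gr'_of_gr'' {x : ℤ} {X : P.H} (hX : X ∈ P.gr'' x) : X ∈ P.gr' (x + 1) := by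
  have : x + 1 + (a - b - 1) = x + (a - b) := by ring
  rw [gr', shift, this]
  exact hX

/-- Three signs accumulate: x'' and (a-b-1)x' from the two twists, and (b-a)dg(X) from `ell2_eq`.
With x' = x'' + 1 and dg(X) = x'' + a - b, their sum is always odd. -/
theorem ell2''_eq : P.ell2'' = -P.letterOps.pB := by
  refine ext_homog P.gr''_internal fun x X hX => ?_
  have hX' := P.gr'_of_gr'' hX
  have hX0 : X ∈ packetGr P.grV (x + (a - b)) := hX
  rw [ell2'', signTwist_eq P.gr''_internal, LinearMap.comp_apply, sgn_apply _ _ hX, ell2',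
    signTwist_eq P.gr'_internal, map_smul, LinearMap.comp_apply, sgn_apply _ _ hX', ell2_eq,
    map_smul, LinearMap.comp_apply, sgn_apply _ _ hX0, map_smul, smul_smul, smul_smul, ← sg_add,
    ← sg_add, LinearMap.neg_apply, ← neg_one_smul K, ← sg_one K]
  congr 1
  refine sg_congr K ?_
  push_cast
  generalize (a : ZMod 2) = a
  generalize (b : ZMod 2) = b
  generalize (x : ZMod 2) = x
  revert a b x
  decide

theorem ell2''_mem {x y : ℤ} {X Y : P.H} (hX : X ∈ P.gr'' x) (hY : Y ∈ P.gr'' y) :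
    P.ell2'' X Y ∈ P.gr'' (x + y + 1) := by
  rw [ell2''_eq, LinearMap.neg_apply, LinearMap.neg_apply]
  refine neg_mem ?_
  have := P.letterOps.pB_mem hX hY
  have e : x + (a - b) + (y + (a - b)) + (b - a + 1) = x + y + 1 + (a - b) := by ring
  rw [e] at this
  exact this

theorem D_mem {x : ℤ} {X : P.H} (hX : X ∈ P.gr'' x) : P.D X ∈ P.gr'' (x + 1) := by
  rw [D_eq]
  have := P.letterOps.pD_mem hX
  rw [add_right_comm] at this
  exact this

theorem D_D (X : P.H) : P.D (P.D X) = 0 := by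
  rw [D_eq, LetterOps.pD_pD]

theorem ell2''_comm {x y : ℤ} {X Y : P.H} (hX : X ∈ P.gr'' x) (hY : Y ∈ P.gr'' y) :
    P.ell2'' X Y = sg K (x * y) • P.ell2'' Y X := by
  have := P.letterOps.pB_comm hX hY
  simp only [ell2''_eq, LinearMap.neg_apply, this, smul_neg]
  congr 3
  ring

theorem ell2''_jacobi {x y z : ℤ} {X Y Z : P.H} (hX : X ∈ P.gr'' x) (hY : Y ∈ P.gr'' y)
    (hZ : Z ∈ P.gr'' z) :
    sg K (x * z) • P.ell2'' (P.ell2'' X Y) Z + sg K (y * x) • P.ell2'' (P.ell2'' Y Z) X +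
      sg K (z * y) • P.ell2'' (P.ell2'' Z X) Y = 0 := by
  have := P.letterOps.pB_jacobi hX hY hZ
  simp only [ell2''_eq, LinearMap.neg_apply, map_neg, neg_neg]
  rw [← this]
  congr 4 <;> ring

theorem D_ell2'' {x : ℤ} {X : P.H} (hX : X ∈ P.gr'' x) (Y : P.H) :
    P.D (P.ell2'' X Y) = -P.ell2'' (P.D X) Y + sg K (1 + x) • P.ell2'' X (P.D Y) := by
  have := P.letterOps.pD_pB hX Y
  have e : x + (a - b) + (b - a) = x := by ring
  simp only [ell2''_eq, D_eq, LinearMap.neg_apply, map_neg, this, e, sg_add, sg_one]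
  module

end DiffABAlgebra

/-! ### The unital graded symmetric algebra and recursion on it. -/

section SymmetricAlgebra

variable {K : Type*} [Field K] {W : Type*} [AddCommGroup W] [Module K W]
  {gr : ℤ → Submodule K W}

variable (gr) in
/-- The relations of graded commutativity. -/
def commRel : Set (TensorAlgebra K W) :=
  {t | ∃ (u v : List W) (x y : Homog gr),
    t = tens (u ++ (x.2 : W) :: (y.2 : W) :: v) -
      (x.1 * y.1).negOnePow • tens (u ++ (y.2 : W) :: (x.2 : W) :: v)}

variable (gr) in
/-- The span of the relations of graded commutativity. -/
def commSubmodule : Submodule K (TensorAlgebra K W) := Submodule.span K (commRel gr)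

variable (gr) in
/-- The graded symmetric algebra. -/
abbrev SymAlg : Type _ := TensorAlgebra K W ⧸ commSubmodule gr

theorem ι_mul_mem_commSubmodule (x : W) {t : TensorAlgebra K W} (ht : t ∈ commSubmodule gr) :
    TensorAlgebra.ι K x * t ∈ commSubmodule gr := by
  have : commSubmodule gr ≤ (commSubmodule gr).comap (lmul K x) := by
    refine Submodule.span_le.2 ?_
    rintro _ ⟨u, v, y, z, rfl⟩
    refine Submodule.subset_span ⟨x :: u, v, y, z, ?_⟩
    simp only [lmul_apply, mul_sub, List.cons_append, tens_cons, negOnePow_smul (K := K),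
      mul_smul_comm]
  exact this ht

/-- Multiplication by an element of `W` in the graded symmetric algebra. -/
noncomputable def smul' : W →ₗ[K] SymAlg gr →ₗ[K] SymAlg gr where
  toFun x := (commSubmodule gr).mapQ _ (lmul K x) fun _ ht => ι_mul_mem_commSubmodule x ht
  map_add' x y := by
    refine Submodule.linearMap_qext _ (LinearMap.ext fun t => ?_)
    change (commSubmodule gr).mkQ (lmul K (x + y) t) =
      (commSubmodule gr).mkQ (lmul K x t) + (commSubmodule gr).mkQ (lmul K y t)
    rw [map_add, LinearMap.add_apply, map_add]
  map_smul' r x := by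
    refine Submodule.linearMap_qext _ (LinearMap.ext fun t => ?_)
    change (commSubmodule gr).mkQ (lmul K (r • x) t) = r • (commSubmodule gr).mkQ (lmul K x t)
    rw [map_smul, LinearMap.smul_apply, map_smul]

theorem smul'_mk (x : W) (t : TensorAlgebra K W) :
    smul' x ((commSubmodule gr).mkQ t) = (commSubmodule gr).mkQ (TensorAlgebra.ι K x * t) := rfl

/-- The unit of the graded symmetric algebra. -/
noncomputable def sone : SymAlg gr := (commSubmodule gr).mkQ 1

/-- The product of a word in the graded symmetric algebra. -/
noncomputable def sw (l : List (Homog gr)) : SymAlg gr := (commSubmodule gr).mkQ (wd l)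

theorem sw_nil : sw ([] : List (Homog gr)) = sone := rfl

theorem sw_cons (x : Homog gr) (l : List (Homog gr)) : sw (x :: l) = smul' (gr := gr) x.2 (sw l) := by
  rw [sw, wd_cons]; rfl

theorem ext_sw {M : Type*} [AddCommGroup M] [Module K M] (h : DirectSum.IsInternal gr)
    {F G : SymAlg gr →ₗ[K] M} (hFG : ∀ l : List (Homog gr), F (sw l) = G (sw l)) : F = G := by
  refine Submodule.linearMap_qext _ (ext_words h fun l => ?_)
  exact hFG l

theorem ext_smul' {M : Type*} [AddCommGroup M] [Module K M] (h : DirectSum.IsInternal gr)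
    {F G : SymAlg gr →ₗ[K] M} (h1 : F sone = G sone)
    (hr : ∀ i, ∀ x ∈ gr i, ∀ Y, F Y = G Y → F (smul' x Y) = G (smul' x Y)) : F = G := by
  refine ext_sw h fun l => ?_
  induction l with
  | nil => exact h1
  | cons x l ih => rw [sw_cons]; exact hr _ _ x.2.2 _ ih

theorem smul'_comm {i j : ℤ} {x y : W} (hx : x ∈ gr i) (hy : y ∈ gr j) (Y : SymAlg gr)
    (h : DirectSum.IsInternal gr) : smul' x (smul' y Y) = sg K (i * j) • smul' y (smul' x Y) := by
  have : smul' x ∘ₗ smul' y = sg K (i * j) • (smul' (gr := gr) y ∘ₗ smul' x) := by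
    refine ext_sw h fun l => ?_
    simp only [LinearMap.comp_apply, LinearMap.smul_apply, sw, smul'_mk, ← map_smul]
    rw [← sub_eq_zero, ← map_sub]
    refine (Submodule.Quotient.mk_eq_zero _).2 (Submodule.subset_span ?_)
    refine ⟨[], l.map fun x => (x.2 : W), ⟨i, x, hx⟩, ⟨j, y, hy⟩, ?_⟩
    simp [wd, negOnePow_smul (K := K)]
  exact congr($this Y)

section fold

variable {M : Type*} [AddCommGroup M] [Module K M] (g : W →ₗ[K] M →ₗ[K] M) (m : M)

/-- The prefix of a relation only applies further operators to both terms, so the condition `hg` at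
the place of the swap suffices. -/
theorem commSubmodule_le_ker (hg : ∀ i j, ∀ x ∈ gr i, ∀ y ∈ gr j, ∀ m,
    g x (g y m) = sg K (i * j) • g y (g x m)) :
    commSubmodule gr ≤ LinearMap.ker (fold g m) := by
  refine Submodule.span_le.2 ?_
  rintro _ ⟨u, v, x, y, rfl⟩
  rw [SetLike.mem_coe, LinearMap.mem_ker, map_sub, sub_eq_zero, negOnePow_smul (K := K), map_smul]
  induction u with
  | nil => simp [hg _ _ _ x.2.2 _ y.2.2]
  | cons z u ih => simp [ih]

/-- The linear map `F` on the graded symmetric algebra with `F 1 = m` and `F (x Y) = g x (F Y)`. -/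
noncomputable def sfold (hg : ∀ i j, ∀ x ∈ gr i, ∀ y ∈ gr j, ∀ m,
    g x (g y m) = sg K (i * j) • g y (g x m)) : SymAlg gr →ₗ[K] M :=
  (commSubmodule gr).liftQ (fold g m) (commSubmodule_le_ker g m hg)

variable (hg : ∀ i j, ∀ x ∈ gr i, ∀ y ∈ gr j, ∀ m, g x (g y m) = sg K (i * j) • g y (g x m))

theorem sfold_one : sfold g m hg sone = m := fold_one g m

theorem sfold_smul' (x : W) (Y : SymAlg gr) :
    sfold g m hg (smul' x Y) = g x (sfold g m hg Y) := by
  obtain ⟨t, rfl⟩ := Submodule.mkQ_surjective _ Y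
  exact fold_ι_mul g m x t

end fold

/-- Existence of the linear map `F` on the graded symmetric algebra with `F 1 = m` and
`F (x Y) = ρ x (F Y) + G x Y`. -/
theorem exists_spara {M : Type*} [AddCommGroup M] [Module K M] (h : DirectSum.IsInternal gr)
    (ρ : W →ₗ[K] M →ₗ[K] M)
    (G : W →ₗ[K] SymAlg gr →ₗ[K] M) (m : M)
    (hρ : ∀ i j, ∀ x ∈ gr i, ∀ y ∈ gr j, ∀ m, ρ x (ρ y m) = sg K (i * j) • ρ y (ρ x m))
    (hG : ∀ i j, ∀ x ∈ gr i, ∀ y ∈ gr j, ∀ Y, ρ x (G y Y) + G x (smul' y Y) =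
      sg K (i * j) • (ρ y (G x Y) + G y (smul' x Y))) :
    ∃ F : SymAlg gr →ₗ[K] M, F sone = m ∧ ∀ x Y, F (smul' x Y) = ρ x (F Y) + G x Y := by
  -- The recursion runs on pairs consisting of Y and its value, so that G can use Y. The hypothesis
  -- `hG` makes the two orders of adding letters agree.
  let g : W →ₗ[K] (SymAlg gr × M) →ₗ[K] (SymAlg gr × M) :=
    LinearMap.mk₂ K (fun x s => (smul' x s.1, ρ x s.2 + G x s.1))
      (fun x y s => by ext <;> simp; abel) (fun r x s => by ext <;> simp)
      (fun x s t => by ext <;> simp; abel) (fun r x s => by ext <;> simp)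
  have hg1 : ∀ x s, g x s = (smul' x s.1, ρ x s.2 + G x s.1) := fun x s => rfl
  have hg : ∀ i j, ∀ x ∈ gr i, ∀ y ∈ gr j, ∀ m, g x (g y m) = sg K (i * j) • g y (g x m) := by
    intro i j x hx y hy s
    simp only [hg1, map_add, add_assoc, hG i j x hx y hy, hρ i j x hx y hy,
      smul'_comm hx hy _ h, Prod.smul_mk, smul_add]
  have hfst : LinearMap.fst K _ _ ∘ₗ sfold g (sone, m) hg = LinearMap.id := by
    refine ext_smul' h ?_ ?_
    · simp [sfold_one]
    · intro i x hx Y hY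
      simp only [LinearMap.comp_apply, LinearMap.fst_apply, LinearMap.id_apply] at hY ⊢
      rw [sfold_smul', hg1, hY]
  refine ⟨LinearMap.snd K _ _ ∘ₗ sfold g (sone, m) hg, by simp [sfold_one], fun x Y => ?_⟩
  have := congr($hfst Y)
  simp only [LinearMap.comp_apply, LinearMap.fst_apply, LinearMap.id_apply] at this
  simp only [LinearMap.comp_apply, LinearMap.snd_apply, sfold_smul', hg1, this]

/-! ### The grading -/

variable (gr) in
/-- The grading of the graded symmetric algebra. -/
def Sgr (n : ℤ) : Submodule K (SymAlg gr) := (Tgr gr n).map (commSubmodule gr).mkQ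

theorem smul'_mem {i n : ℤ} {x : W} (hx : x ∈ gr i) {Y : SymAlg gr} (hY : Y ∈ Sgr gr n) :
    smul' x Y ∈ Sgr gr (i + n) := by
  obtain ⟨t, ht, rfl⟩ := hY
  exact ⟨_, ι_mul_mem hx ht, rfl⟩

theorem sone_mem : (sone : SymAlg gr) ∈ Sgr gr 0 := ⟨1, one_mem_Tgr, rfl⟩

theorem sw_mem (l : List (Homog gr)) : sw l ∈ Sgr gr (wdeg l) := ⟨_, wd_mem l, rfl⟩

theorem mem_of_sw {M : Type*} [AddCommGroup M] [Module K M]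
    {F : SymAlg gr →ₗ[K] M} {N : Submodule K M} {n : ℤ}
    (hF : ∀ l : List (Homog gr), wdeg l = n → F (sw l) ∈ N) {Y : SymAlg gr}
    (hY : Y ∈ Sgr gr n) : F Y ∈ N := by
  obtain ⟨t, ht, rfl⟩ := hY
  exact mem_of_words (F := F ∘ₗ (commSubmodule gr).mkQ) hF ht

variable (gr) in
/-- The relations between homogeneous words. -/
def homogRel : Set (TensorAlgebra K W) :=
  {t | ∃ (u v : List (Homog gr)) (x y : Homog gr),
    t = wd (u ++ x :: y :: v) - sg K (x.1 * y.1) • wd (u ++ y :: x :: v)}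

theorem tens_append (u v : List W) :
    (tens (u ++ v) : TensorAlgebra K W) = tens u * tens v := by simp [tens]

theorem wd_append (u v : List (Homog gr)) : wd (u ++ v) = wd u * wd v := by
  simp [wd, tens_append]

theorem wdeg_append (u v : List (Homog gr)) : wdeg (u ++ v) = wdeg u + wdeg v := by
  simp [wdeg]

/-- Bilinearity in the prefix and the suffix reduces them to homogeneous words. The gradedness of
the quotient needs homogeneous generators. -/
theorem span_homogRel (h : DirectSum.IsInternal gr) :
    Submodule.span K (homogRel gr) = commSubmodule gr := by
  refine le_antisymm (Submodule.span_mono ?_) (Submodule.span_le.2 ?_)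
  · rintro _ ⟨u, v, x, y, rfl⟩
    exact ⟨u.map fun x => (x.2 : W), v.map fun x => (x.2 : W), x, y, by
      simp [wd, negOnePow_smul (K := K)]⟩
  · rintro _ ⟨u, v, x, y, rfl⟩
    have key : ∀ s t : TensorAlgebra K W,
        s * ((TensorAlgebra.ι K (x.2 : W) * TensorAlgebra.ι K (y.2 : W) -
          sg K (x.1 * y.1) • (TensorAlgebra.ι K (y.2 : W) * TensorAlgebra.ι K (x.2 : W))) * t) ∈
          Submodule.span K (homogRel gr) := by
      intro s t
      have h1 : ⊤ ≤ (Submodule.span K (homogRel gr)).comap ((LinearMap.mul K _).flip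
          ((TensorAlgebra.ι K (x.2 : W) * TensorAlgebra.ι K (y.2 : W) -
          sg K (x.1 * y.1) • (TensorAlgebra.ι K (y.2 : W) * TensorAlgebra.ι K (x.2 : W))) * t)) := by
        rw [← span_words h, Submodule.span_le]
        rintro _ ⟨u, rfl⟩
        have h2 : ⊤ ≤ (Submodule.span K (homogRel gr)).comap (LinearMap.mul K _ (wd u) ∘ₗ
            LinearMap.mul K _ (TensorAlgebra.ι K (x.2 : W) * TensorAlgebra.ι K (y.2 : W) -
            sg K (x.1 * y.1) •
              (TensorAlgebra.ι K (y.2 : W) * TensorAlgebra.ι K (x.2 : W)))) := by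
          rw [← span_words h, Submodule.span_le]
          rintro _ ⟨v, rfl⟩
          refine Submodule.subset_span ⟨u, v, x, y, ?_⟩
          simp [wd_append, sub_mul, mul_sub, mul_assoc]
        exact h2 (Submodule.mem_top (x := t))
      exact h1 (Submodule.mem_top (x := s))
    convert key (tens u) (tens v) using 1
    simp [tens_append, sub_mul, mul_sub, mul_assoc, negOnePow_smul (K := K)]

theorem homogRel_homogeneous {r : TensorAlgebra K W} (hr : r ∈ homogRel gr) :
    ∃ n, r ∈ Tgr gr n := by
  obtain ⟨u, v, x, y, rfl⟩ := hr
  refine ⟨wdeg (u ++ x :: y :: v), sub_mem (wd_mem _) (Submodule.smul_mem _ _ ?_)⟩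
  refine Tgr_cast (wd_mem _) ?_
  simp only [wdeg_append, wdeg_cons]
  ring

theorem isInternal_Sgr (h : DirectSum.IsInternal gr) : DirectSum.IsInternal (Sgr gr) := by
  have := isInternal_quotient h (homogRel gr) fun r hr => homogRel_homogeneous hr
  rw [span_homogRel h] at this
  exact this

theorem symSubmodule_eq : symSubmodule gr = Submodule.span K {1} ⊔ commSubmodule gr := by
  rw [symSubmodule, Submodule.span_union]; rfl

theorem isInternal_symGr (h : DirectSum.IsInternal gr) : DirectSum.IsInternal (symGr gr) := by
  have := isInternal_quotient h ({1} ∪ homogRel gr) (by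
    rintro r (rfl | hr)
    · exact ⟨0, one_mem_Tgr⟩
    · exact homogRel_homogeneous hr)
  rw [Submodule.span_union, span_homogRel h, ← symSubmodule_eq] at this
  rw [funext symGr_eq]
  exact this

/-- The projection of the graded symmetric algebra onto `S⁺`. -/
noncomputable def toPlus : SymAlg gr →ₗ[K] SymPlus gr :=
  Submodule.factor (by rw [symSubmodule_eq]; exact le_sup_right)

theorem toPlus_one : toPlus (sone : SymAlg gr) = 0 :=
  (Submodule.Quotient.mk_eq_zero _).2 (Submodule.subset_span (Or.inl rfl))

theorem toPlus_sw {n : ℕ} (X : Fin n → Homog gr) (l : List (Fin n)) :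
    toPlus (sw (l.map X)) = symProdOf X l := (symProdOf_eq X l).symm

theorem toPlus_mem {n : ℤ} {Y : SymAlg gr} (hY : Y ∈ Sgr gr n) : toPlus Y ∈ symGr gr n := by
  obtain ⟨t, ht, rfl⟩ := hY
  rw [symGr_eq]
  exact ⟨t, ht, rfl⟩

theorem symGr_eq_map (n : ℤ) : symGr gr n = (Sgr gr n).map toPlus := by
  rw [symGr_eq, Sgr, ← Submodule.map_comp]
  rfl

/-- The map induced on `S⁺` by a map that vanishes on the unit. -/
noncomputable def plus {M : Type*} [AddCommGroup M] [Module K M] (F : SymAlg gr →ₗ[K] M)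
    (hF : F sone = 0) : SymPlus gr →ₗ[K] M :=
  (symSubmodule gr).liftQ (F ∘ₗ (commSubmodule gr).mkQ) (by
    rw [symSubmodule_eq, sup_le_iff]
    constructor
    · rw [Submodule.span_singleton_le_iff_mem]
      exact hF
    · intro t ht
      rw [LinearMap.mem_ker, LinearMap.comp_apply, Submodule.mkQ_apply,
        (Submodule.Quotient.mk_eq_zero _).2 ht, map_zero])

theorem plus_toPlus {M : Type*} [AddCommGroup M] [Module K M] (F : SymAlg gr →ₗ[K] M)
    (hF : F sone = 0) (Y : SymAlg gr) : plus F hF (toPlus Y) = F Y := by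
  obtain ⟨t, rfl⟩ := Submodule.mkQ_surjective _ Y
  rfl

theorem ext_toPlus {M : Type*} [AddCommGroup M] [Module K M] {F G : SymPlus gr →ₗ[K] M}
    (h : F ∘ₗ toPlus = G ∘ₗ toPlus) : F = G := by
  ext1
  exact congr($h ∘ₗ (commSubmodule gr).mkQ)

/-! ### Signs -/

variable (h : DirectSum.IsInternal gr)

/-- The map `Y ↦ (-1)^{k |Y|} Y` of the graded symmetric algebra. -/
noncomputable def ssgn (k : ℤ) : SymAlg gr →ₗ[K] SymAlg gr := sgn (isInternal_Sgr h) k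

theorem ssgn_apply (k : ℤ) {n : ℤ} {Y : SymAlg gr} (hY : Y ∈ Sgr gr n) :
    ssgn h k Y = sg K (k * n) • Y := sgn_apply _ _ hY

theorem ssgn_one (k : ℤ) : ssgn h k sone = sone := by simp [ssgn_apply h k sone_mem]

theorem ssgn_smul' (k : ℤ) {i : ℤ} {x : W} (hx : x ∈ gr i) (Y : SymAlg gr) :
    ssgn h k (smul' x Y) = sg K (k * i) • smul' x (ssgn h k Y) := by
  have : ssgn h k ∘ₗ smul' x = sg K (k * i) • smul' x ∘ₗ ssgn h k := by
    refine ext_sw h fun l => ?_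
    simp only [LinearMap.comp_apply, LinearMap.smul_apply, ssgn_apply h k (sw_mem l),
      ssgn_apply h k (smul'_mem hx (sw_mem l)), map_smul, smul_smul, mul_add, sg_add]
  exact congr($this Y)

theorem ssgn_comm {e : ℤ} {F : SymAlg gr →ₗ[K] SymAlg gr}
    (hF : ∀ n, ∀ Y ∈ Sgr gr n, F Y ∈ Sgr gr (n + e)) (k : ℤ) (Y : SymAlg gr) :
    ssgn h k (F Y) = sg K (k * e) • F (ssgn h k Y) := by
  have : ssgn h k ∘ₗ F = sg K (k * e) • F ∘ₗ ssgn h k := by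
    refine ext_sw h fun l => ?_
    simp only [LinearMap.comp_apply, LinearMap.smul_apply, ssgn_apply h k (sw_mem l),
      ssgn_apply h k (hF _ _ (sw_mem l)), map_smul, smul_smul, mul_add, sg_add]
    rw [mul_comm]
  exact congr($this Y)

theorem ssgn_add (k l : ℤ) (Y : SymAlg gr) : ssgn h (k + l) Y = ssgn h k (ssgn h l Y) := by
  have : ssgn h (k + l) = ssgn h k ∘ₗ ssgn h l := by
    refine ext_sw h fun u => ?_
    simp only [LinearMap.comp_apply, ssgn_apply h _ (sw_mem u), map_smul, smul_smul, add_mul,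
      sg_add]
    rw [mul_comm]
  exact congr($this Y)

theorem sgn_toPlus (k : ℤ) (Y : SymAlg gr) :
    sgn (isInternal_symGr h) k (toPlus Y) = toPlus (ssgn h k Y) := by
  have : sgn (isInternal_symGr h) k ∘ₗ toPlus = toPlus ∘ₗ ssgn h k := by
    refine ext_sw h fun l => ?_
    simp only [LinearMap.comp_apply, ssgn_apply h _ (sw_mem l), map_smul,
      sgn_apply _ _ (toPlus_mem (sw_mem l))]
  exact congr($this Y)

end SymmetricAlgebra

/-! ### Extending the differential and the bracket to the symmetric algebra. -/

section Extension

variable {K : Type*} [Field K] {W : Type*} [AddCommGroup W] [Module K W]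
  {gr : ℤ → Submodule K W}

/-- `F` is an operator of degree `e` on the graded symmetric algebra with `F 1 = 0` and
`F (x Y) = G x Y + (-1)^{e |x|} x F(Y)`. -/
structure IsExt (F : SymAlg gr →ₗ[K] SymAlg gr) (G : W →ₗ[K] SymAlg gr →ₗ[K] SymAlg gr)
    (e : ℤ) : Prop where
  one : F sone = 0
  mul : ∀ {i : ℤ} {x : W}, x ∈ gr i → ∀ Y,
    F (smul' x Y) = G x Y + sg K (e * i) • smul' x (F Y)
  mem : ∀ n, ∀ Y ∈ Sgr gr n, F Y ∈ Sgr gr (n + e)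

theorem Sgr_cast {m n : ℤ} {Y : SymAlg gr} (hY : Y ∈ Sgr gr m) (hmn : m = n) : Y ∈ Sgr gr n :=
  hmn ▸ hY

theorem isExt_of_rec {F : SymAlg gr →ₗ[K] SymAlg gr}
    {G : W →ₗ[K] SymAlg gr →ₗ[K] SymAlg gr} {e : ℤ} (h1 : F sone = 0)
    (hmul : ∀ {i : ℤ} {x : W}, x ∈ gr i → ∀ Y,
      F (smul' x Y) = G x Y + sg K (e * i) • smul' x (F Y))
    (hG : ∀ i, ∀ x ∈ gr i, ∀ n, ∀ Y ∈ Sgr gr n, G x Y ∈ Sgr gr (i + n + e)) : IsExt F G e := by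
  refine ⟨h1, hmul, fun n Y hY => ?_⟩
  refine mem_of_sw (F := F) (fun l hl => ?_) hY
  clear hY
  subst hl
  induction l with
  | nil => rw [sw_nil, h1]; exact zero_mem _
  | cons x l ih =>
    rw [sw_cons, hmul x.2.2, wdeg_cons]
    refine add_mem (hG _ _ x.2.2 _ _ (sw_mem l)) (Submodule.smul_mem _ _ ?_)
    exact Sgr_cast (smul'_mem x.2.2 ih) (by ring)

/-- The condition `hc` says that the recursion gives the same value on xyY and on ±yxY. -/
theorem exists_isExt (h : DirectSum.IsInternal gr) (G : W →ₗ[K] SymAlg gr →ₗ[K] SymAlg gr) (e : ℤ)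
    (hc : ∀ i j, ∀ x ∈ gr i, ∀ y ∈ gr j, ∀ Y,
      sg K (e * i) • smul' x (G y Y) + G x (smul' y Y) =
        sg K (i * j) • (sg K (e * j) • smul' y (G x Y) + G y (smul' x Y)))
    (hG : ∀ i, ∀ x ∈ gr i, ∀ n, ∀ Y ∈ Sgr gr n, G x Y ∈ Sgr gr (i + n + e)) :
    ∃ F, IsExt F G e := by
  have hρ : ∀ {i : ℤ} {x : W}, x ∈ gr i → ∀ Y : SymAlg gr,
      (smul' ∘ₗ sgn h e) x Y = sg K (e * i) • smul' x Y := fun hx Y => by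
    rw [LinearMap.comp_apply, sgn_apply h e hx, map_smul, LinearMap.smul_apply]
  obtain ⟨F, h1, hF⟩ := exists_spara h (smul' ∘ₗ sgn h e) G 0
    (fun i j x hx y hy Y => by
      simp only [hρ hx, hρ hy, map_smul, smul'_comm hx hy Y h, smul_smul]
      congr 1; ring)
    (fun i j x hx y hy Y => by rw [hρ hx, hρ hy]; exact hc i j x hx y hy Y)
  exact ⟨F, isExt_of_rec h1 (fun hx Y => by rw [hF, hρ hx, add_comm]) hG⟩

/-- A graded space with a differential and a graded symmetric bracket, both of degree `1`,
that satisfies the identities of a shifted differential graded Lie algebra. -/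
structure ShiftedLie (gr : ℤ → Submodule K W) where
  graded : DirectSum.IsInternal gr
  D : W →ₗ[K] W
  B : W →ₗ[K] W →ₗ[K] W
  D_mem : ∀ x, ∀ X ∈ gr x, D X ∈ gr (x + 1)
  B_mem : ∀ x y, ∀ X ∈ gr x, ∀ Y ∈ gr y, B X Y ∈ gr (x + y + 1)
  D_D : ∀ X, D (D X) = 0
  B_comm : ∀ x y, ∀ X ∈ gr x, ∀ Y ∈ gr y, B X Y = sg K (x * y) • B Y X
  jacobi : ∀ x y z, ∀ X ∈ gr x, ∀ Y ∈ gr y, ∀ Z ∈ gr z,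
    sg K (x * z) • B (B X Y) Z + sg K (y * x) • B (B Y Z) X + sg K (z * y) • B (B Z X) Y = 0
  D_B : ∀ x, ∀ X ∈ gr x, ∀ Y, D (B X Y) = -B (D X) Y + sg K (1 + x) • B X (D Y)

namespace ShiftedLie

variable (S : ShiftedLie gr)

theorem exists_m : ∃ F, IsExt F (smul' (gr := gr) ∘ₗ S.D) 1 := by
  refine exists_isExt S.graded _ 1 (fun i j x hx y hy Y => ?_) (fun i x hx n Y hY => ?_)
  · simp only [LinearMap.comp_apply, smul'_comm hx (S.D_mem _ _ hy) Y S.graded,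
      smul'_comm (S.D_mem _ _ hx) hy Y S.graded]
    match_scalars <;>
    · try simp only [sg_add, add_mul, mul_add, sg_one, sg_zero, sg_self_mul, one_mul, mul_one]
      try ring_nf
      try simp only [sg_zero, sg_one, sg_sq, sg_cube, sg_pow_four]
      try ring_nf
  · exact Sgr_cast (smul'_mem (S.D_mem _ _ hx) hY) (by ring)

/-- The operator of the graded symmetric algebra that extends `D`. -/
noncomputable def mS : SymAlg gr →ₗ[K] SymAlg gr := S.exists_m.choose

theorem mS_ext : IsExt S.mS (smul' ∘ₗ S.D) 1 := S.exists_m.choose_spec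

theorem exists_ad : ∃ F : SymAlg gr →ₗ[K] W →ₗ[K] SymAlg gr, F sone = 0 ∧
    ∀ i j, ∀ x ∈ gr i, ∀ y ∈ gr j, ∀ Y, F (smul' y Y) x =
      smul' (S.B x y) Y + sg K ((i + 1) * j) • smul' y (F Y x) := by
  -- The recursion takes values in maps out of W, so all operators ad x are built at once, linearly
  -- in x. The sign (-1)^{(i+1)j} splits into (-1)^j and the operator `sgn j` acting on x.
  let ρ : W →ₗ[K] (W →ₗ[K] SymAlg gr) →ₗ[K] (W →ₗ[K] SymAlg gr) :=
    byDegree S.graded fun j => LinearMap.mk₂ K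
      (fun y φ => sg K j • smul' y ∘ₗ φ ∘ₗ sgn S.graded j)
      (fun x y φ => by ext; simp) (fun r x φ => by ext; simp [smul_comm _ r])
      (fun x φ ψ => by ext; simp) (fun r x φ => by ext; simp [smul_comm _ r])
  have hρ : ∀ {i j : ℤ} {x y : W}, x ∈ gr i → y ∈ gr j → ∀ φ,
      ρ y φ x = sg K ((i + 1) * j) • smul' y (φ x) := by
    intro i j x y hx hy φ
    simp only [ρ, byDegree_apply S.graded _ hy, LinearMap.mk₂_apply, LinearMap.smul_apply,
      LinearMap.comp_apply, sgn_apply S.graded j hx, map_smul, smul_smul, ← sg_add]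
    congr 2; ring
  let G : W →ₗ[K] SymAlg gr →ₗ[K] (W →ₗ[K] SymAlg gr) :=
    LinearMap.mk₂ K (fun y Z => smul'.flip Z ∘ₗ S.B.flip y)
      (fun x y φ => by ext; simp) (fun r x φ => by ext; simp)
      (fun x φ ψ => by ext; simp) (fun r x φ => by ext; simp)
  have hG : ∀ x y Z, G y Z x = smul' (S.B x y) Z := fun x y Z => rfl
  obtain ⟨F, h1, hF⟩ := exists_spara S.graded ρ G 0
    (fun i j x hx y hy φ => by
      refine ext_homog S.graded fun k w hw => ?_
      simp only [LinearMap.smul_apply, hρ hw hx, hρ hw hy, map_smul,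
        smul'_comm hx hy _ S.graded, smul_smul]
      congr 1; ring)
    (fun i j x hx y hy Y => by
      refine ext_homog S.graded fun k w hw => ?_
      simp only [LinearMap.smul_apply, LinearMap.add_apply, hρ hw hx, hρ hw hy, hG,
        smul'_comm (S.B_mem _ _ _ hw _ hx) hy _ S.graded,
        smul'_comm hx (S.B_mem _ _ _ hw _ hy) _ S.graded]
      match_scalars <;>
      · try simp only [sg_add, add_mul, mul_add, sg_one, sg_zero, sg_self_mul, one_mul, mul_one]
        try ring_nf
        try simp only [sg_zero, sg_one, sg_sq, sg_cube, sg_pow_four]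
        try ring_nf)
  refine ⟨F, h1, fun i j x hx y hy Y => ?_⟩
  rw [hF, LinearMap.add_apply, hρ hx hy, hG, add_comm]

/-- The operators `ad x` of the graded symmetric algebra that extend `B x`. -/
noncomputable def ad : W →ₗ[K] SymAlg gr →ₗ[K] SymAlg gr := S.exists_ad.choose.flip

theorem ad_ext {i : ℤ} {x : W} (hx : x ∈ gr i) :
    IsExt (S.ad x) (smul' ∘ₗ S.B x) (i + 1) := by
  refine isExt_of_rec ?_ (fun hy Y => ?_) (fun j y hy n Y hY => ?_)
  · rw [ad, LinearMap.flip_apply, S.exists_ad.choose_spec.1, LinearMap.zero_apply]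
  · exact S.exists_ad.choose_spec.2 _ _ _ hx _ hy Y
  · exact Sgr_cast (smul'_mem (S.B_mem _ _ _ hx _ hy) hY) (by ring)

/-- Compatibility with commutativity is the graded symmetry of B. -/
theorem exists_l : ∃ F, IsExt F S.ad 1 := by
  refine exists_isExt S.graded _ 1 (fun i j x hx y hy Y => ?_) (fun i x hx n Y hY => ?_)
  · simp only [(S.ad_ext hx).mul hy, (S.ad_ext hy).mul hx, LinearMap.comp_apply,
      S.B_comm _ _ _ hx _ hy, map_smul, LinearMap.smul_apply]
    match_scalars <;>
    · try simp only [sg_add, add_mul, mul_add, sg_one, sg_zero, sg_self_mul, one_mul, mul_one]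
      try ring_nf
      try simp only [sg_zero, sg_one, sg_sq, sg_cube, sg_pow_four]
      try ring_nf
  · exact Sgr_cast ((S.ad_ext hx).mem _ _ hY) (by ring)

/-- The operator of the graded symmetric algebra that extends `B`. -/
noncomputable def lS : SymAlg gr →ₗ[K] SymAlg gr := S.exists_l.choose

theorem lS_ext : IsExt S.lS S.ad 1 := S.exists_l.choose_spec

theorem mS_mS (Y : SymAlg gr) : S.mS (S.mS Y) = 0 := by
  have : S.mS ∘ₗ S.mS = 0 := by
    refine ext_smul' S.graded (by simp [S.mS_ext.one]) fun i x hx Y hY => ?_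
    simp only [LinearMap.comp_apply, LinearMap.zero_apply] at hY ⊢
    simp only [S.mS_ext.mul hx, S.mS_ext.mul (S.D_mem _ _ hx), map_add, map_smul, hY,
      LinearMap.comp_apply, S.D_D, map_zero, LinearMap.zero_apply]
    match_scalars
    simp only [sg_add, mul_add, sg_one, one_mul, mul_one]
    ring
  exact congr($this Y)

/-- The Jacobi identity, rewritten by symmetry as an identity of operators applied to z, which is
the form that extends to products. -/
theorem jacobi_left {i j : ℤ} {x y : W} (hx : x ∈ gr i) (hy : y ∈ gr j) (z : W) :
    S.B (S.B x y) z + sg K ((i + 1) * j) • S.B y (S.B x z) + sg K i • S.B x (S.B y z) = 0 := by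
  have : S.B (S.B x y) + sg K ((i + 1) * j) • S.B y ∘ₗ S.B x + sg K i • S.B x ∘ₗ S.B y = 0 := by
    refine ext_homog S.graded fun k z hz => ?_
    simp only [LinearMap.add_apply, LinearMap.smul_apply, LinearMap.comp_apply,
      LinearMap.zero_apply]
    have e := S.jacobi _ _ _ _ hx _ hy _ hz
    rw [S.B_comm _ _ _ (S.B_mem _ _ _ hy _ hz) _ hx, S.B_comm _ _ _ hz _ hx, map_smul,
      LinearMap.smul_apply, S.B_comm _ _ _ (S.B_mem _ _ _ hx _ hz) _ hy] at e
    linear_combination (norm := skip) (sg K (i * k)) • e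
    match_scalars <;>
    · try simp only [sg_add, add_mul, mul_add, sg_one, sg_zero, sg_self_mul, one_mul, mul_one]
      try ring_nf
      try simp only [sg_zero, sg_one, sg_sq, sg_cube, sg_pow_four]
      try ring_nf
  exact congr($this z)

/-- The left side is itself a derivation-like operator: on zY it is its value on z times Y, which is
zero by `jacobi_left`, plus z times its value on Y. -/
theorem ad_B {i j : ℤ} {x y : W} (hx : x ∈ gr i) (hy : y ∈ gr j) (Y : SymAlg gr) :
    S.ad (S.B x y) Y + sg K ((i + 1) * j) • S.ad y (S.ad x Y) + sg K i • S.ad x (S.ad y Y) = 0 := by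
  have hB := S.B_mem _ _ _ hx _ hy
  have : S.ad (S.B x y) + sg K ((i + 1) * j) • S.ad y ∘ₗ S.ad x +
      sg K i • S.ad x ∘ₗ S.ad y = 0 := by
    refine ext_smul' S.graded ?_ fun k z hz Y hY => ?_
    · simp [(S.ad_ext hx).one, (S.ad_ext hy).one, (S.ad_ext hB).one]
    · simp only [LinearMap.add_apply, LinearMap.smul_apply, LinearMap.comp_apply,
        LinearMap.zero_apply] at hY ⊢
      have e1 := congr(smul' $(S.jacobi_left hx hy z) Y)
      have e2 := congr(smul' z $hY)
      simp only [map_add, map_smul, LinearMap.add_apply, LinearMap.smul_apply, map_zero,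
        LinearMap.zero_apply] at e1 e2
      simp only [(S.ad_ext hx).mul hz, (S.ad_ext hy).mul hz, (S.ad_ext hB).mul hz,
        (S.ad_ext hx).mul (S.B_mem _ _ _ hy _ hz), (S.ad_ext hy).mul (S.B_mem _ _ _ hx _ hz),
        map_add, map_smul, LinearMap.comp_apply]
      linear_combination (norm := skip) e1 + sg K ((i + j) * k) • e2
      match_scalars <;>
      · try simp only [sg_add, add_mul, mul_add, sg_one, sg_zero, sg_self_mul, one_mul, mul_one]
        try ring_nf
        try simp only [sg_zero, sg_one, sg_sq, sg_cube, sg_pow_four]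
        try ring_nf
  exact congr($this Y)

/-- A graded commutator. On zY the new terms are the left side of `ad_B` for x and z, and the rest
is the induction hypothesis. -/
theorem lS_ad {i : ℤ} {x : W} (hx : x ∈ gr i) (Y : SymAlg gr) :
    S.lS (S.ad x Y) + sg K i • S.ad x (S.lS Y) = 0 := by
  have : S.lS ∘ₗ S.ad x + sg K i • S.ad x ∘ₗ S.lS = 0 := by
    refine ext_smul' S.graded ?_ fun k z hz Y hY => ?_
    · simp [(S.ad_ext hx).one, S.lS_ext.one]
    · simp only [LinearMap.add_apply, LinearMap.smul_apply, LinearMap.comp_apply,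
        LinearMap.zero_apply] at hY ⊢
      have e1 := S.ad_B hx hz Y
      have e2 := congr(smul' z $hY)
      simp only [map_add, map_smul, map_zero] at e2
      simp only [(S.ad_ext hx).mul hz, S.lS_ext.mul hz, S.lS_ext.mul (S.B_mem _ _ _ hx _ hz),
        map_add, map_smul, LinearMap.comp_apply]
      linear_combination (norm := skip) e1 + sg K (i * k) • e2
      match_scalars <;>
      · try simp only [sg_add, add_mul, mul_add, sg_one, sg_zero, sg_self_mul, one_mul, mul_one]
        try ring_nf
        try simp only [sg_zero, sg_one, sg_sq, sg_cube, sg_pow_four]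
        try ring_nf
  exact congr($this Y)

/-- On xY the square is the commutator of `lS_ad` plus x times the square on Y, because the sign
(-1)^x occurs twice there. -/
theorem lS_lS (Y : SymAlg gr) : S.lS (S.lS Y) = 0 := by
  have : S.lS ∘ₗ S.lS = 0 := by
    refine ext_smul' S.graded (by simp [S.lS_ext.one]) fun i x hx Y hY => ?_
    simp only [LinearMap.comp_apply, LinearMap.zero_apply] at hY ⊢
    have e := S.lS_ad hx Y
    simp only [S.lS_ext.mul hx, map_add, map_smul, hY, one_mul, map_zero, smul_zero, add_zero]
    exact e
  exact congr($this Y)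

/-- The commutator of m with ad x is governed on a letter by the rule `D_B`, and it extends to
products by the recursions. -/
theorem mS_ad {i : ℤ} {x : W} (hx : x ∈ gr i) (Y : SymAlg gr) :
    S.mS (S.ad x Y) + S.ad (S.D x) Y + sg K i • S.ad x (S.mS Y) = 0 := by
  have hD := S.D_mem _ _ hx
  have : S.mS ∘ₗ S.ad x + S.ad (S.D x) + sg K i • S.ad x ∘ₗ S.mS = 0 := by
    refine ext_smul' S.graded ?_ fun k z hz Y hY => ?_
    · simp [(S.ad_ext hx).one, (S.ad_ext hD).one, S.mS_ext.one]
    · simp only [LinearMap.add_apply, LinearMap.smul_apply, LinearMap.comp_apply,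
        LinearMap.zero_apply] at hY ⊢
      have e2 := congr(smul' z $hY)
      simp only [map_add, map_smul, map_zero] at e2
      simp only [(S.ad_ext hx).mul hz, S.mS_ext.mul hz, S.mS_ext.mul (S.B_mem _ _ _ hx _ hz),
        (S.ad_ext hD).mul hz, (S.ad_ext hx).mul (S.D_mem _ _ hz), S.D_B _ _ hx,
        map_add, map_smul, map_neg, LinearMap.comp_apply, LinearMap.add_apply,
        LinearMap.smul_apply, LinearMap.neg_apply]
      linear_combination (norm := skip) sg K (i * k) • e2
      match_scalars <;>
      · try simp only [sg_add, add_mul, mul_add, sg_one, sg_zero, sg_self_mul, one_mul, mul_one]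
        try ring_nf
        try simp only [sg_zero, sg_one, sg_sq, sg_cube, sg_pow_four]
        try ring_nf
  exact congr($this Y)

theorem mS_lS (Y : SymAlg gr) : S.mS (S.lS Y) + S.lS (S.mS Y) = 0 := by
  have : S.mS ∘ₗ S.lS + S.lS ∘ₗ S.mS = 0 := by
    refine ext_smul' S.graded (by simp [S.lS_ext.one, S.mS_ext.one]) fun i x hx Y hY => ?_
    simp only [LinearMap.comp_apply, LinearMap.zero_apply, LinearMap.add_apply] at hY ⊢
    have e1 := S.mS_ad hx Y
    have e2 := congr(smul' x $hY)
    simp only [map_add, map_zero] at e2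
    simp only [S.lS_ext.mul hx, S.mS_ext.mul hx, S.lS_ext.mul (S.D_mem _ _ hx), map_add, map_smul,
      LinearMap.comp_apply]
    linear_combination (norm := skip) e1 + e2
    match_scalars <;>
    · try simp only [sg_add, add_mul, mul_add, sg_one, sg_zero, sg_self_mul, one_mul, mul_one]
      try ring_nf
      try simp only [sg_zero, sg_one, sg_sq, sg_cube, sg_pow_four]
      try ring_nf
  exact congr($this Y)

end ShiftedLie
end Extension

/-! ### The graded flip and the grading of a tensor square. -/

section Flip

variable {K : Type*} [Field K] {M : Type*} [AddCommGroup M] [Module K M]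
  {gr : ℤ → Submodule K M}

theorem ext_tmul_homog {N : Type*} [AddCommGroup N] [Module K N] (h : DirectSum.IsInternal gr)
    {F G : M ⊗[K] M →ₗ[K] N}
    (hFG : ∀ i j, ∀ x ∈ gr i, ∀ y ∈ gr j, F (x ⊗ₜ y) = G (x ⊗ₜ y)) : F = G := by
  refine TensorProduct.ext (ext_homog h fun i x hx => ext_homog h fun j y hy => ?_)
  exact hFG i j x hx y hy

theorem flip_tmul (h : DirectSum.IsInternal gr) {i j : ℤ} {x y : M} (hx : x ∈ gr i)
    (hy : y ∈ gr j) : flip gr (x ⊗ₜ[K] y) = sg K (i * j) • (y ⊗ₜ[K] x) := by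
  have hF : ∀ {i j : ℤ} {x y : M}, x ∈ gr i → y ∈ gr j →
      TensorProduct.lift (byDegree h fun i => (TensorProduct.mk K M M).flip.compl₂ (sgn h i))
        (x ⊗ₜ[K] y) = sg K (i * j) • (y ⊗ₜ[K] x) := fun {i j x y} hx hy => by
    simp [byDegree_apply h _ hx, sgn_apply h i hy, TensorProduct.smul_tmul']
  have := linearExt_apply (K := K)
    (g := fun p : Homog gr × Homog gr => (p.1.2 : M) ⊗ₜ[K] (p.2.2 : M))
    (f := fun p => (p.1.1 * p.2.1).negOnePow • ((p.2.2 : M) ⊗ₜ[K] (p.1.2 : M)))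
    ⟨_, fun p => by
      rw [hF p.1.2.2 p.2.2.2, negOnePow_smul (K := K)]⟩ (⟨i, x, hx⟩, ⟨j, y, hy⟩)
  rw [negOnePow_smul (K := K)] at this
  exact this

variable (gr) in
/-- The grading of a tensor square. -/
def tensorGr (k : ℤ) : Submodule K (M ⊗[K] M) :=
  Submodule.span K {t | ∃ (i j : ℤ) (Y Z : M),
    Y ∈ gr i ∧ Z ∈ gr j ∧ i + j = k ∧ t = Y ⊗ₜ[K] Z}

end Flip

/-! ### The unital coproduct and the co-Leibniz rule. -/

section Coproduct

variable {K : Type*} [Field K] {W : Type*} [AddCommGroup W] [Module K W]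
  {gr : ℤ → Submodule K W} (h : DirectSum.IsInternal gr)

/-- Multiplication by `Δ(x) = x ⊗ 1 + 1 ⊗ x` in the tensor square of the graded symmetric
algebra. -/
noncomputable def smulTwo : W →ₗ[K] SymAlg gr ⊗[K] SymAlg gr →ₗ[K] SymAlg gr ⊗[K] SymAlg gr :=
  byDegree h fun i =>
    (TensorProduct.mapBilinear (RingHom.id K) (SymAlg gr) (SymAlg gr) (SymAlg gr)
      (SymAlg gr)).flip LinearMap.id ∘ₗ smul' +
    TensorProduct.mapBilinear (RingHom.id K) (SymAlg gr) (SymAlg gr) (SymAlg gr) (SymAlg gr)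
      (ssgn h i) ∘ₗ smul'

theorem smulTwo_apply {i : ℤ} {x : W} (hx : x ∈ gr i) :
    smulTwo h x = TensorProduct.map (smul' x) LinearMap.id +
      TensorProduct.map (ssgn h i) (smul' x) := by
  rw [smulTwo, byDegree_apply h _ hx]
  rfl

theorem smulTwo_tmul {i : ℤ} {x : W} (hx : x ∈ gr i) (Y Z : SymAlg gr) :
    smulTwo h x (Y ⊗ₜ Z) = smul' x Y ⊗ₜ Z + ssgn h i Y ⊗ₜ smul' x Z := by
  rw [smulTwo_apply h hx]; rfl

/-- Primitive elements x ⊗ 1 + 1 ⊗ x graded commute in the tensor square, so the coproduct respects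
the relations. -/
theorem smulTwo_comm {i j : ℤ} {x y : W} (hx : x ∈ gr i) (hy : y ∈ gr j)
    (t : SymAlg gr ⊗[K] SymAlg gr) :
    smulTwo h x (smulTwo h y t) = sg K (i * j) • smulTwo h y (smulTwo h x t) := by
  induction t using TensorProduct.induction_on with
  | zero => simp
  | add s t hs ht => simp only [map_add, hs, ht, smul_add]
  | tmul Y Z =>
    have e : ssgn h i (ssgn h j Y) = ssgn h j (ssgn h i Y) := by
      rw [← ssgn_add, add_comm, ssgn_add]
    simp only [smulTwo_tmul h hx, smulTwo_tmul h hy, map_add, smul'_comm hx hy _ h,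
      ssgn_smul' h _ hx, ssgn_smul' h _ hy, e, ← TensorProduct.smul_tmul', TensorProduct.tmul_smul,
      smul_add]
    match_scalars <;>
    · try simp only [sg_add, add_mul, mul_add, sg_one, sg_zero, sg_self_mul, one_mul, mul_one]
      try ring_nf
      try simp only [sg_zero, sg_one, sg_sq, sg_cube, sg_pow_four]
      try ring_nf

/-- The coproduct of the graded symmetric algebra. -/
noncomputable def coprodS : SymAlg gr →ₗ[K] SymAlg gr ⊗[K] SymAlg gr :=
  sfold (smulTwo h) (sone ⊗ₜ sone) fun _ _ _ hx _ hy t => smulTwo_comm h hx hy t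

theorem coprodS_one : coprodS h sone = sone ⊗ₜ sone := sfold_one _ _ _

theorem coprodS_smul' (x : W) (Y : SymAlg gr) :
    coprodS h (smul' x Y) = smulTwo h x (coprodS h Y) := sfold_smul' _ _ _ _ _

theorem smulTwo_mem {i n : ℤ} {x : W} (hx : x ∈ gr i) {t : SymAlg gr ⊗[K] SymAlg gr}
    (ht : t ∈ tensorGr (Sgr gr) n) : smulTwo h x t ∈ tensorGr (Sgr gr) (i + n) := by
  have : tensorGr (Sgr gr) n ≤ (tensorGr (Sgr gr) (i + n)).comap (smulTwo h x) := by
    refine Submodule.span_le.2 ?_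
    rintro _ ⟨j, k, Y, Z, hY, hZ, rfl, rfl⟩
    rw [SetLike.mem_coe, Submodule.mem_comap, smulTwo_tmul h hx, ssgn_apply h i hY]
    refine add_mem (Submodule.subset_span ⟨i + j, k, _, _, smul'_mem hx hY, hZ, by ring, rfl⟩)
      (Submodule.subset_span ⟨j, i + k, _, _, Submodule.smul_mem _ _ hY, smul'_mem hx hZ,
        by ring, rfl⟩)
  exact this ht

theorem coprodS_mem {n : ℤ} {Y : SymAlg gr} (hY : Y ∈ Sgr gr n) :
    coprodS h Y ∈ tensorGr (Sgr gr) n := by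
  refine mem_of_sw (F := coprodS h) (fun l hl => ?_) hY
  clear hY
  subst hl
  induction l with
  | nil =>
    rw [sw_nil, coprodS_one]
    exact Submodule.subset_span ⟨0, 0, _, _, sone_mem, sone_mem, rfl, rfl⟩
  | cons x l ih =>
    rw [sw_cons, coprodS_smul', wdeg_cons]
    exact smulTwo_mem h x.2.2 ih

theorem flip_smulTwo {i : ℤ} {x : W} (hx : x ∈ gr i) (t : SymAlg gr ⊗[K] SymAlg gr) :
    flip (Sgr gr) (smulTwo h x t) = smulTwo h x (flip (Sgr gr) t) := by
  have hS := isInternal_Sgr h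
  have : flip (Sgr gr) ∘ₗ smulTwo h x = smulTwo h x ∘ₗ flip (Sgr gr) := by
    refine ext_tmul_homog hS fun j k Y hY Z hZ => ?_
    simp only [LinearMap.comp_apply, smulTwo_tmul h hx, map_add, ssgn_apply h i hY,
      flip_tmul hS hY hZ, flip_tmul hS (smul'_mem hx hY) hZ, ← TensorProduct.smul_tmul', map_smul,
      flip_tmul hS hY (smul'_mem hx hZ), ssgn_apply h i hZ]
    match_scalars <;>
    · try simp only [sg_add, add_mul, mul_add, sg_one, sg_zero, sg_self_mul, one_mul, mul_one]
      try ring_nf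
      try simp only [sg_zero, sg_one, sg_sq, sg_cube, sg_pow_four]
      try ring_nf
  exact congr($this t)

theorem flip_coprodS (Y : SymAlg gr) : flip (Sgr gr) (coprodS h Y) = coprodS h Y := by
  have : flip (Sgr gr) ∘ₗ coprodS h = coprodS h := by
    refine ext_smul' h ?_ fun i x hx Y hY => ?_
    · rw [LinearMap.comp_apply, coprodS_one, flip_tmul (isInternal_Sgr h) sone_mem sone_mem]
      simp
    · simp only [LinearMap.comp_apply] at hY ⊢
      rw [coprodS_smul', flip_smulTwo h hx, hY]
  exact congr($this Y)

/-- Needed for coassociativity: adding a letter puts a sign operator on the first factor, to which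
the coproduct is then applied. -/
theorem coprodS_ssgn (k : ℤ) (Y : SymAlg gr) :
    coprodS h (ssgn h k Y) = TensorProduct.map (ssgn h k) (ssgn h k) (coprodS h Y) := by
  have : coprodS h ∘ₗ ssgn h k = TensorProduct.map (ssgn h k) (ssgn h k) ∘ₗ coprodS h := by
    refine ext_smul' h ?_ fun i x hx Y hY => ?_
    · simp [coprodS_one, ssgn_one]
    · simp only [LinearMap.comp_apply] at hY ⊢
      rw [ssgn_smul' h k hx, map_smul, coprodS_smul', coprodS_smul', hY]
      generalize coprodS h Y = t
      induction t using TensorProduct.induction_on with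
      | zero => simp
      | add s t hs ht => simp only [map_add, smul_add, hs, ht]
      | tmul Y Z =>
        have e : ssgn h i (ssgn h k Y) = ssgn h k (ssgn h i Y) := by
          rw [← ssgn_add, add_comm, ssgn_add]
        simp only [smulTwo_tmul h hx, TensorProduct.map_tmul, map_add, ssgn_smul' h _ hx, e,
          smul_add, ← TensorProduct.smul_tmul', TensorProduct.tmul_smul]
  exact congr($this Y)

theorem coassoc_coprodS (Y : SymAlg gr) :
    TensorProduct.assoc K (SymAlg gr) (SymAlg gr) (SymAlg gr)
      (TensorProduct.map (coprodS h) LinearMap.id (coprodS h Y)) =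
    TensorProduct.map LinearMap.id (coprodS h) (coprodS h Y) := by
  have : (TensorProduct.assoc K (SymAlg gr) (SymAlg gr) (SymAlg gr)).toLinearMap ∘ₗ
      TensorProduct.map (coprodS h) LinearMap.id ∘ₗ coprodS h =
      TensorProduct.map LinearMap.id (coprodS h) ∘ₗ coprodS h := by
    refine ext_smul' h ?_ fun i x hx Y hY => ?_
    · simp [coprodS_one]
    · simp only [LinearMap.comp_apply, LinearEquiv.coe_coe] at hY ⊢
      -- `T` is multiplication by x ⊗ 1 ⊗ 1 + 1 ⊗ x ⊗ 1 + 1 ⊗ 1 ⊗ x. Both iterated coproducts turn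
      -- multiplication by x into `T`, so they satisfy the same recursion.
      obtain ⟨T, hT⟩ : ∃ T : SymAlg gr ⊗[K] (SymAlg gr ⊗[K] SymAlg gr) →ₗ[K]
          SymAlg gr ⊗[K] (SymAlg gr ⊗[K] SymAlg gr), ∀ Y t,
          T (Y ⊗ₜ t) = smul' x Y ⊗ₜ t + ssgn h i Y ⊗ₜ smulTwo h x t :=
        ⟨TensorProduct.map (smul' x) LinearMap.id + TensorProduct.map (ssgn h i) (smulTwo h x),
          fun Y t => rfl⟩
      have e1 : ∀ t : SymAlg gr ⊗[K] SymAlg gr,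
          TensorProduct.map LinearMap.id (coprodS h) (smulTwo h x t) =
          T (TensorProduct.map LinearMap.id (coprodS h) t) := by
        intro t
        induction t using TensorProduct.induction_on with
        | zero => simp
        | add s t hs ht => simp only [map_add, hs, ht]
        | tmul Y Z => simp [smulTwo_tmul h hx, coprodS_smul', hT]
      have e2 : ∀ t : SymAlg gr ⊗[K] SymAlg gr,
          TensorProduct.assoc K (SymAlg gr) (SymAlg gr) (SymAlg gr)
            (TensorProduct.map (coprodS h) LinearMap.id (smulTwo h x t)) =
          T (TensorProduct.assoc K (SymAlg gr) (SymAlg gr) (SymAlg gr)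
            (TensorProduct.map (coprodS h) LinearMap.id t)) := by
        intro t
        induction t using TensorProduct.induction_on with
        | zero => simp
        | add s t hs ht => simp only [map_add, hs, ht]
        | tmul Y Z =>
          simp only [smulTwo_tmul h hx, map_add, TensorProduct.map_tmul, coprodS_smul',
            coprodS_ssgn, LinearMap.id_apply]
          generalize coprodS h Y = s
          induction s using TensorProduct.induction_on with
          | zero => simp
          | add s t hs ht =>
            simp only [map_add, TensorProduct.add_tmul] at hs ht ⊢
            rw [← hs, ← ht]
            abel
          | tmul U V =>
            simp [smulTwo_tmul h hx, hT, TensorProduct.add_tmul, TensorProduct.tmul_add, add_assoc]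
      rw [coprodS_smul', e1, e2, hY]
  exact congr($this Y)

/-- The operator `F ⊗ 1 + 1 ⊗ F` for an operator `F` of degree `e`. -/
noncomputable def onTwo (F : SymAlg gr →ₗ[K] SymAlg gr) (e : ℤ) :
    SymAlg gr ⊗[K] SymAlg gr →ₗ[K] SymAlg gr ⊗[K] SymAlg gr :=
  TensorProduct.map F LinearMap.id + TensorProduct.map (ssgn h e) F

theorem onTwo_tmul (F : SymAlg gr →ₗ[K] SymAlg gr) (e : ℤ) (Y Z : SymAlg gr) :
    onTwo h F e (Y ⊗ₜ Z) = F Y ⊗ₜ Z + ssgn h e Y ⊗ₜ F Z := rfl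

/-- On xY the rule for `G x` gives the first term. The terms of F with x in front match by
induction, and the mixed terms, where F and x act on different factors, cancel because F has degree
e. -/
theorem IsExt.onTwo_coprodS {F : SymAlg gr →ₗ[K] SymAlg gr}
    {G : W →ₗ[K] SymAlg gr →ₗ[K] SymAlg gr} {e : ℤ} (hF : IsExt F G e)
    (hG : ∀ i, ∀ x ∈ gr i, ∀ Y, onTwo h (G x) (i + e) (coprodS h Y) = coprodS h (G x Y))
    (Y : SymAlg gr) : onTwo h F e (coprodS h Y) = coprodS h (F Y) := by
  have : onTwo h F e ∘ₗ coprodS h = coprodS h ∘ₗ F := by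
    refine ext_smul' h ?_ fun i x hx Y hY => ?_
    · simp [coprodS_one, onTwo_tmul, hF.one]
    · simp only [LinearMap.comp_apply] at hY ⊢
      rw [hF.mul hx, map_add, map_smul, coprodS_smul', coprodS_smul', ← hY, ← hG i x hx]
      generalize coprodS h Y = t
      induction t using TensorProduct.induction_on with
      | zero => simp
      | add s t hs ht =>
        simp only [map_add, smul_add] at hs ht ⊢
        rw [hs, ht]
        abel
      | tmul Y Z =>
        simp only [smulTwo_tmul h hx, onTwo_tmul, map_add, hF.mul hx, ssgn_smul' h _ hx,
          ssgn_comm h hF.mem, ssgn_add, ← TensorProduct.smul_tmul', TensorProduct.tmul_smul,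
          smul_add, TensorProduct.add_tmul, TensorProduct.tmul_add]
        have c : ssgn h i (ssgn h e Y) = ssgn h e (ssgn h i Y) := by
          rw [← ssgn_add, add_comm, ssgn_add]
        rw [c]
        match_scalars <;>
        · try simp only [sg_add, add_mul, mul_add, sg_one, sg_zero, sg_self_mul, one_mul, mul_one]
          try ring_nf
          try simp only [sg_zero, sg_one, sg_sq, sg_cube, sg_pow_four]
          try ring_nf
  exact congr($this Y)

/-- Primitivity of x written as a co-Leibniz rule. It starts the chain: multiplication, then m and
ad x, then ℓ''. -/
theorem onTwo_smul' {i : ℤ} {x : W} (hx : x ∈ gr i) (Y : SymAlg gr) :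
    onTwo h (smul' x) i (coprodS h Y) = coprodS h (smul' x Y) := by
  rw [coprodS_smul', smulTwo_apply h hx]; rfl

end Coproduct

/-! ### The co-Leibniz rule for m, ad x and ℓ''. -/

namespace ShiftedLie

variable {K : Type*} [Field K] {W : Type*} [AddCommGroup W] [Module K W]
  {gr : ℤ → Submodule K W} (S : ShiftedLie gr)

theorem mS_coprodS (Y : SymAlg gr) :
    onTwo S.graded S.mS 1 (coprodS S.graded Y) = coprodS S.graded (S.mS Y) :=
  S.mS_ext.onTwo_coprodS S.graded
    (fun _ x hx Y => onTwo_smul' S.graded (S.D_mem _ x hx) Y) Y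

theorem ad_coprodS {i : ℤ} {x : W} (hx : x ∈ gr i) (Y : SymAlg gr) :
    onTwo S.graded (S.ad x) (i + 1) (coprodS S.graded Y) = coprodS S.graded (S.ad x Y) :=
  (S.ad_ext hx).onTwo_coprodS S.graded (fun j y hy Y => by
    have := onTwo_smul' S.graded (S.B_mem _ _ x hx y hy) Y
    rwa [show i + j + 1 = j + (i + 1) by ring] at this) Y

theorem lS_coprodS (Y : SymAlg gr) :
    onTwo S.graded S.lS 1 (coprodS S.graded Y) = coprodS S.graded (S.lS Y) :=
  S.lS_ext.onTwo_coprodS S.graded (fun _ _ hx Y => S.ad_coprodS hx Y) Y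

end ShiftedLie

/-! ### Removing the first place from Koszul signs and from sets of places. -/

section Places

variable {K : Type*} [Field K]

theorem filter_lt_map_succ {n : ℕ} (i : Fin n) (l : List (Fin n)) :
    (l.map Fin.succ).filter (· < i.succ) = (l.filter (· < i)).map Fin.succ := by
  simp [List.filter_map, Function.comp_def]

theorem kz_map_succ {n : ℕ} (deg : Fin (n + 1) → ℤ) (l : List (Fin n)) :
    kz K deg (l.map Fin.succ) = kz K (fun i => deg i.succ) l := by
  induction l with
  | nil => simp [kz_nil]
  | cons i l ih =>
    rw [List.map_cons, kz_cons, kz_cons, ih, filter_lt_map_succ, List.map_map]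
    rfl

/-- Place 0 precedes all others, so its only contribution is the sign for the places of u put before
it. -/
theorem kz_map_succ_zero {n : ℕ} (deg : Fin (n + 1) → ℤ) (u v : List (Fin n)) :
    kz K deg (u.map Fin.succ ++ 0 :: v.map Fin.succ) =
      sg K (deg 0 * (u.map fun i => deg i.succ).sum) * kz K (fun i => deg i.succ) (u ++ v) := by
  induction u with
  | nil =>
    rw [List.map_nil, List.nil_append, kz_cons_of_lt, kz_map_succ]
    · simp
    · simp [Fin.succ_pos]
  | cons i u ih =>
    rw [List.map_cons, List.cons_append, kz_cons, ih, List.cons_append, kz_cons, List.filter_append,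
      List.filter_cons_of_pos (by simp [Fin.succ_pos]), filter_lt_map_succ, filter_lt_map_succ,
      List.filter_append, ← mul_assoc, ← mul_assoc, ← sg_add, ← sg_add]
    congr 2
    simp only [List.map_append, List.map_cons, List.sum_append, List.sum_cons, List.map_map,
      Function.comp_def]
    ring

theorem places_of_zero_mem {n : ℕ} {I : Finset (Fin (n + 1))} {J : Finset (Fin n)} (h0 : 0 ∈ I)
    (hJ : ∀ i : Fin n, i.succ ∈ I ↔ i ∈ J) : places I = 0 :: (places J).map Fin.succ := by
  rw [places, List.finRange_succ, List.filter_cons_of_pos (by simpa using h0), List.filter_map,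
    places]
  simp [Function.comp_def, hJ]

theorem places_of_zero_notMem {n : ℕ} {I : Finset (Fin (n + 1))} {J : Finset (Fin n)} (h0 : 0 ∉ I)
    (hJ : ∀ i : Fin n, i.succ ∈ I ↔ i ∈ J) : places I = (places J).map Fin.succ := by
  rw [places, List.finRange_succ, List.filter_cons_of_neg (by simpa using h0), List.filter_map,
    places]
  simp [Function.comp_def, hJ]

theorem places_univ (n : ℕ) : places (Finset.univ : Finset (Fin n)) = List.finRange n := by
  simp [places]

theorem places_compl_zero (n : ℕ) :
    places ({0}ᶜ : Finset (Fin (n + 1))) = (List.finRange n).map Fin.succ := by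
  rw [places_of_zero_notMem (J := Finset.univ) (by simp) (by simp [Fin.succ_ne_zero]), places_univ]

theorem places_compl_succ {n : ℕ} (i : Fin n) :
    places ({i.succ}ᶜ : Finset (Fin (n + 1))) = 0 :: (places {i}ᶜ).map Fin.succ :=
  places_of_zero_mem (by simp [(Fin.succ_ne_zero i).symm]) (by simp)

theorem places_compl_zero_succ {n : ℕ} (j : Fin n) :
    places ({0, j.succ}ᶜ : Finset (Fin (n + 1))) = (places {j}ᶜ).map Fin.succ :=
  places_of_zero_notMem (by simp) (by simp [Fin.succ_ne_zero])

theorem places_compl_succ_succ {n : ℕ} (i j : Fin n) :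
    places ({i.succ, j.succ}ᶜ : Finset (Fin (n + 1))) = 0 :: (places {i, j}ᶜ).map Fin.succ :=
  places_of_zero_mem (by simp [(Fin.succ_ne_zero _).symm]) (by simp)

theorem sum_finset_succ {M : Type*} [AddCommMonoid M] {n : ℕ} (G : Finset (Fin (n + 1)) → M) :
    ∑ I, G I = ∑ J : Finset (Fin n),
      (G (insert 0 (J.map (Fin.succEmb n))) + G (J.map (Fin.succEmb n))) := by
  rw [Finset.sum_add_distrib, ← Finset.sum_filter_add_sum_filter_not _ (fun I => 0 ∈ I)]
  congr 1
  · refine Finset.sum_nbij' (fun I => Finset.univ.filter fun i => i.succ ∈ I)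
      (fun J => insert 0 (J.map (Fin.succEmb n))) (by simp) (by simp) ?_ ?_ ?_
    · intro I hI
      ext i
      cases i using Fin.cases <;> simp_all
    · intro J _
      ext i
      simp
    · intro I hI
      congr 1
      ext i
      cases i using Fin.cases <;> simp_all
  · refine Finset.sum_nbij' (fun I => Finset.univ.filter fun i => i.succ ∈ I)
      (fun J => J.map (Fin.succEmb n)) (by simp) (by simp) ?_ ?_ ?_
    · intro I hI
      ext i
      cases i using Fin.cases <;> simp_all
    · intro J _
      ext i
      simp
    · intro I hI
      congr 1
      ext i
      cases i using Fin.cases <;> simp_all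

end Places

/-! ### Explicit values on products, and passage to the quotient by the unit. -/

section Explicit

variable {K : Type*} [Field K] {W : Type*} [AddCommGroup W] [Module K W]
  {gr : ℤ → Submodule K W}

theorem sw_finRange_succ {n : ℕ} (X : Fin (n + 1) → Homog gr) :
    sw ((List.finRange (n + 1)).map X) =
      smul' (gr := gr) (X 0).2 (sw ((List.finRange n).map fun i => X i.succ)) := by
  rw [List.finRange_succ, List.map_cons, sw_cons, List.map_map]
  rfl

/-- Peeling off X_0 separates the term i = 0 from the others. In the others X_0 must be moved back
behind f(X_i). -/
theorem IsExt.apply_sw (h : DirectSum.IsInternal gr) {F : SymAlg gr →ₗ[K] SymAlg gr}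
    {f : W →ₗ[K] W} {e : ℤ} (hF : IsExt F (smul' ∘ₗ f) e)
    (hf : ∀ i, ∀ x ∈ gr i, f x ∈ gr (i + e)) {n : ℕ} (X : Fin n → Homog gr) :
    F (sw ((List.finRange n).map X)) = ∑ i, kz K (degs X) (i :: places {i}ᶜ) •
      smul' (f (X i).2) (sw ((places {i}ᶜ).map X)) := by
  induction n with
  | zero => exact hF.one
  | succ n ih =>
    rw [sw_finRange_succ, hF.mul (X 0).2.2, ih, Fin.sum_univ_succ, places_compl_zero]
    congr 1
    · have := kz_map_succ_zero (K := K) (degs X) [] (List.finRange n)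
      simp only [List.map_nil, List.nil_append, List.sum_nil, mul_zero, sg_zero, one_mul] at this
      rw [this, kz_of_pairwise _ (pairwise_finRange n), one_smul, List.map_map]
      rfl
    · rw [map_sum, Finset.smul_sum]
      refine Finset.sum_congr rfl fun i _ => ?_
      have := kz_map_succ_zero (K := K) (degs X) [i] (places {i}ᶜ)
      simp only [List.map_cons, List.map_nil, List.cons_append, List.nil_append, List.sum_cons,
        List.sum_nil, add_zero] at this
      rw [places_compl_succ, this, List.map_cons, sw_cons, map_smul,
        smul'_comm (X 0).2.2 (hf _ _ (X i.succ).2.2) _ h, List.map_map, smul_smul, smul_smul]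
      congr 1
      rw [show (fun i => degs X i.succ) = degs fun i => X i.succ from rfl,
        show degs X 0 = (X 0).1 from rfl, show degs X i.succ = (X i.succ).1 from rfl, mul_add,
        sg_add, mul_comm (X 0).1 e]
      -- The sign (-1)^{e x_0} occurs twice and cancels: once when F passes X_0, and once when X_0
      -- passes f(X_i), whose degree is raised by e.
      linear_combination (sg K ((X 0).1 * (X i.succ).1) *
        kz K (degs fun i => X i.succ) (i :: places {i}ᶜ)) * sg_mul_self K (e * (X 0).1)

theorem ShiftedLie.lS_sw (S : ShiftedLie gr) {n : ℕ} (X : Fin n → Homog gr) :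
    S.lS (sw ((List.finRange n).map X)) = ∑ i, ∑ j with i < j,
      kz K (degs X) (i :: j :: places {i, j}ᶜ) •
        smul' (S.B (X i).2 (X j).2) (sw ((places {i, j}ᶜ).map X)) := by
  induction n with
  | zero => exact S.lS_ext.one
  | succ n ih =>
    have had := (S.ad_ext (X 0).2.2).apply_sw S.graded (fun j y hy => by
      have := S.B_mem _ _ _ (X 0).2.2 _ hy
      rwa [show (X 0).1 + j + 1 = j + ((X 0).1 + 1) by ring] at this) fun i => X i.succ
    rw [sw_finRange_succ, S.lS_ext.mul (X 0).2.2, ih, had, Fin.sum_univ_succ]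
    simp only [Finset.sum_filter, Fin.sum_univ_succ, lt_self_iff_false, if_false, Fin.succ_pos,
      if_true, Fin.not_lt_zero, Fin.succ_lt_succ_iff, zero_add]
    congr 1
    · refine Finset.sum_congr rfl fun j _ => ?_
      have := kz_map_succ_zero (K := K) (degs X) [] (j :: places {j}ᶜ)
      simp only [List.map_cons, List.map_nil, List.nil_append, List.sum_nil, mul_zero, sg_zero,
        one_mul] at this
      rw [places_compl_zero_succ, this, List.map_map]
      rfl
    · rw [map_sum, Finset.smul_sum]
      refine Finset.sum_congr rfl fun i _ => ?_
      rw [map_sum, Finset.smul_sum]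
      refine Finset.sum_congr rfl fun j _ => ?_
      split_ifs
      · have := kz_map_succ_zero (K := K) (degs X) [i, j] (places {i, j}ᶜ)
        simp only [List.map_cons, List.map_nil, List.cons_append, List.nil_append, List.sum_cons,
          List.sum_nil, add_zero] at this
        rw [places_compl_succ_succ, this, List.map_cons, sw_cons, map_smul,
          smul'_comm (X 0).2.2 (S.B_mem _ _ _ (X i.succ).2.2 _ (X j.succ).2.2) _ S.graded,
          List.map_map, smul_smul, smul_smul]
        congr 1
        rw [show (fun i => degs X i.succ) = degs fun i => X i.succ from rfl,
          show degs X 0 = (X 0).1 from rfl, show degs X i.succ = (X i.succ).1 from rfl,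
          show degs X j.succ = (X j.succ).1 from rfl]
        simp only [sg_add, mul_add, one_mul, mul_one]
        linear_combination (sg K ((X 0).1 * (X i.succ).1) * sg K ((X 0).1 * (X j.succ).1) *
          kz K (degs fun i => X i.succ) (i :: j :: places {i, j}ᶜ)) * sg_mul_self K (X 0).1
      · simp

/-- The summands X_0 ⊗ 1 and 1 ⊗ X_0 correspond to the subsets that contain 0 and those that do not.
-/
theorem coprodS_sw (h : DirectSum.IsInternal gr) {n : ℕ} (X : Fin n → Homog gr) :
    coprodS h (sw ((List.finRange n).map X)) = ∑ I : Finset (Fin n),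
      kz K (degs X) (places I ++ places Iᶜ) •
        (sw ((places I).map X) ⊗ₜ[K] sw ((places Iᶜ).map X)) := by
  induction n with
  | zero =>
    rw [Fintype.sum_eq_single ∅ (fun I hI => absurd (Subsingleton.elim _ _) hI)]
    exact (coprodS_one h).trans (by simp [places, kz_nil, sw_nil])
  | succ n ih =>
    rw [sw_finRange_succ, coprodS_smul', ih, map_sum, sum_finset_succ]
    refine Finset.sum_congr rfl fun J _ => ?_
    rw [places_of_zero_mem (I := insert 0 (J.map (Fin.succEmb n))) (J := J) (by simp) (by simp),
      places_of_zero_notMem (I := (insert 0 (J.map (Fin.succEmb n)))ᶜ) (J := Jᶜ) (by simp)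
        (by simp [Fin.succ_ne_zero]),
      places_of_zero_mem (I := (J.map (Fin.succEmb n))ᶜ) (J := Jᶜ) (by simp) (by simp),
      places_of_zero_notMem (I := J.map (Fin.succEmb n)) (J := J) (by simp) (by simp),
      kz_map_succ_zero]
    have := kz_map_succ_zero (K := K) (degs X) [] (places J ++ places Jᶜ)
    simp only [List.map_append, List.map_nil, List.nil_append, List.sum_nil, mul_zero, sg_zero,
      one_mul] at this
    rw [List.cons_append, this, map_smul, smulTwo_tmul h (X 0).2.2, ssgn_apply h _ (sw_mem _),
      List.map_cons, List.map_cons, sw_cons, sw_cons, List.map_map, List.map_map, wdeg_map,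
      smul_add, ← TensorProduct.smul_tmul', smul_smul, mul_comm (sg K _)]
    rfl

/-! ### The operators of `S⁺` -/

theorem symProd_cons {n : ℕ} (x : W) (X : Fin n → Homog gr) (l : List (Fin n)) :
    symProd gr (x :: letters X l) = toPlus (smul' x (sw (l.map X))) := by
  rw [symProd, tens_cons, tens_letters]
  rfl

/-- Since F kills the unit it induces an operator on S⁺, and this operator has the values of the
formula. That proves existence and intertwines the two levels, so identities can be checked before
dividing by the unit. -/
theorem extendOne_toPlus (h : DirectSum.IsInternal gr) {F : SymAlg gr →ₗ[K] SymAlg gr}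
    {f : W →ₗ[K] W} {e : ℤ} (hF : IsExt F (smul' ∘ₗ f) e)
    (hf : ∀ i, ∀ x ∈ gr i, f x ∈ gr (i + e)) :
    (∀ (n : ℕ) (X : Fin n → Homog gr),
      extendOne gr f (symProdOf X (List.finRange n)) = extendOneFormula f X) ∧
    ∀ Y, extendOne gr f (toPlus Y) = toPlus (F Y) := by
  have key : ∀ (n : ℕ) (X : Fin n → Homog gr),
      toPlus (F (sw ((List.finRange n).map X))) = extendOneFormula f X := by
    intro n X
    rw [hF.apply_sw h hf, map_sum]
    simp only [extendOneFormula, koszulSign_smul (K := K), symProd_cons, map_smul]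
  have h1 : (toPlus ∘ₗ F) sone = 0 := by rw [LinearMap.comp_apply, hF.one, map_zero]
  have h2 : extendOne gr f = plus (toPlus ∘ₗ F) h1 := by
    refine linearExt_eq (span_symProdOf h) _ fun X => ?_
    rw [← toPlus_sw, plus_toPlus]
    exact key _ _
  constructor
  · intro n X
    rw [h2, ← toPlus_sw, plus_toPlus]
    exact key n X
  · intro Y
    rw [h2, plus_toPlus]
    rfl

theorem ShiftedLie.extendTwo_toPlus (S : ShiftedLie gr) :
    (∀ (n : ℕ) (X : Fin n → Homog gr),
      extendTwo gr S.B (symProdOf X (List.finRange n)) = extendTwoFormula S.B X) ∧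
    ∀ Y, extendTwo gr S.B (toPlus Y) = toPlus (S.lS Y) := by
  have key : ∀ (n : ℕ) (X : Fin n → Homog gr),
      toPlus (S.lS (sw ((List.finRange n).map X))) = extendTwoFormula S.B X := by
    intro n X
    rw [S.lS_sw]
    simp only [extendTwoFormula, koszulSign_smul (K := K), symProd_cons, map_smul, map_sum]
  have h1 : (toPlus ∘ₗ S.lS) sone = 0 := by rw [LinearMap.comp_apply, S.lS_ext.one, map_zero]
  have h2 : extendTwo gr S.B = plus (toPlus ∘ₗ S.lS) h1 := by
    refine linearExt_eq (span_symProdOf S.graded) _ fun X => ?_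
    rw [← toPlus_sw, plus_toPlus]
    exact key _ _
  constructor
  · intro n X
    rw [h2, ← toPlus_sw, plus_toPlus]
    exact key n X
  · intro Y
    rw [h2, plus_toPlus]
    rfl

theorem coproduct_toPlus (h : DirectSum.IsInternal gr) :
    (∀ (n : ℕ) (X : Fin n → Homog gr),
      coproduct gr (symProdOf X (List.finRange n)) = coproductFormula X) ∧
    ∀ Y, coproduct gr (toPlus Y) = TensorProduct.map toPlus toPlus (coprodS h Y) := by
  have key : ∀ (n : ℕ) (X : Fin n → Homog gr),
      TensorProduct.map toPlus toPlus (coprodS h (sw ((List.finRange n).map X))) =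
        coproductFormula X := by
    intro n X
    rw [coprodS_sw, map_sum, coproductFormula, Finset.sum_filter]
    refine Finset.sum_congr rfl fun I _ => ?_
    rw [map_smul, TensorProduct.map_tmul, koszulSign_smul (K := K), toPlus_sw, toPlus_sw]
    have h0 : symProdOf X [] = 0 := by
      rw [← toPlus_sw]
      exact toPlus_one
    split_ifs with hI
    · rfl
    -- The terms with I or its complement empty have the unit as a factor and vanish in S⁺, so the
    -- reduced coproduct remains.
    · rw [not_and_or, not_not, not_not] at hI
      rcases hI with hI | hI <;> simp [hI, places, h0]
  have h1 : (TensorProduct.map toPlus toPlus ∘ₗ coprodS h) sone = 0 := by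
    rw [LinearMap.comp_apply, coprodS_one, TensorProduct.map_tmul, toPlus_one,
      TensorProduct.zero_tmul]
  have h2 : coproduct gr = plus (TensorProduct.map toPlus toPlus ∘ₗ coprodS h) h1 := by
    refine linearExt_eq (span_symProdOf h) _ fun X => ?_
    rw [← toPlus_sw, plus_toPlus]
    exact key _ _
  constructor
  · intro n X
    rw [h2, ← toPlus_sw, plus_toPlus]
    exact key n X
  · intro Y
    rw [h2, plus_toPlus]
    rfl

end Explicit

/-! ### Transport of the coalgebra identities to S⁺. -/

section CoalgebraPlus

variable {K : Type*} [Field K] {W : Type*} [AddCommGroup W] [Module K W]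
  {gr : ℤ → Submodule K W}

theorem isCoderivation_of_toPlus (h : DirectSum.IsInternal gr) {F : SymAlg gr →ₗ[K] SymAlg gr}
    {G : SymPlus gr →ₗ[K] SymPlus gr} (hG : ∀ Y, G (toPlus Y) = toPlus (F Y))
    (hdeg : ∀ n, ∀ Y ∈ Sgr gr n, F Y ∈ Sgr gr (n + 1))
    (hF : ∀ Y, onTwo h F 1 (coprodS h Y) = coprodS h (F Y)) : IsCoderivation gr G := by
  constructor
  · intro i X hX
    rw [symGr_eq_map] at hX ⊢
    obtain ⟨Y, hY, rfl⟩ := hX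
    exact ⟨F Y, hdeg _ _ hY, (hG Y).symm⟩
  · refine ext_toPlus (LinearMap.ext fun Y => ?_)
    simp only [LinearMap.comp_apply, hG, (coproduct_toPlus h).2, ← hF]
    generalize coprodS h Y = t
    rw [signTwist_eq (isInternal_symGr h)]
    induction t using TensorProduct.induction_on with
    | zero => simp
    | add s t hs ht => simp only [map_add, hs, ht]
    | tmul Y Z =>
      simp only [onTwo_tmul, TensorProduct.map_tmul, LinearMap.add_apply, map_add, hG,
        LinearMap.comp_apply, LinearMap.id_apply]
      exact congr(toPlus (F Y) ⊗ₜ[K] toPlus Z + $(sgn_toPlus h 1 Y) ⊗ₜ[K] toPlus (F Z))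

theorem coproduct_mem (h : DirectSum.IsInternal gr) {n : ℤ} {X : SymPlus gr}
    (hX : X ∈ symGr gr n) : coproduct gr X ∈ tensorGr (symGr gr) n := by
  rw [symGr_eq_map] at hX
  obtain ⟨Y, hY, rfl⟩ := hX
  rw [(coproduct_toPlus h).2]
  have : tensorGr (Sgr gr) n ≤
      (tensorGr (symGr gr) n).comap (TensorProduct.map toPlus toPlus) := by
    refine Submodule.span_le.2 ?_
    rintro _ ⟨i, j, Y, Z, hY, hZ, hij, rfl⟩
    exact Submodule.subset_span ⟨i, j, _, _, toPlus_mem hY, toPlus_mem hZ, hij, rfl⟩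
  exact this (coprodS_mem h hY)

theorem flip_coproduct (h : DirectSum.IsInternal gr) :
    flip (symGr gr) ∘ₗ coproduct gr = coproduct gr := by
  refine ext_toPlus (LinearMap.ext fun Y => ?_)
  simp only [LinearMap.comp_apply, (coproduct_toPlus h).2]
  conv_rhs => rw [← flip_coprodS h]
  have : flip (symGr gr) ∘ₗ TensorProduct.map toPlus toPlus =
      TensorProduct.map toPlus toPlus ∘ₗ flip (Sgr gr) := by
    refine ext_tmul_homog (isInternal_Sgr h) fun i j Y hY Z hZ => ?_
    rw [LinearMap.comp_apply, LinearMap.comp_apply, TensorProduct.map_tmul,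
      flip_tmul (isInternal_Sgr h) hY hZ,
      flip_tmul (isInternal_symGr h) (toPlus_mem hY) (toPlus_mem hZ), map_smul,
      TensorProduct.map_tmul]
  exact congr($this (coprodS h Y))

theorem coassoc_coproduct (h : DirectSum.IsInternal gr) :
    (TensorProduct.assoc K (SymPlus gr) (SymPlus gr) (SymPlus gr)).toLinearMap ∘ₗ
      TensorProduct.map (coproduct gr) LinearMap.id ∘ₗ coproduct gr =
    TensorProduct.map LinearMap.id (coproduct gr) ∘ₗ coproduct gr := by
  refine ext_toPlus (LinearMap.ext fun Y => ?_)
  simp only [LinearMap.comp_apply, (coproduct_toPlus h).2, LinearEquiv.coe_coe]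
  have e1 : ∀ t : SymAlg gr ⊗[K] SymAlg gr,
      TensorProduct.map LinearMap.id (coproduct gr) (TensorProduct.map toPlus toPlus t) =
      TensorProduct.map toPlus (TensorProduct.map toPlus toPlus)
        (TensorProduct.map LinearMap.id (coprodS h) t) := by
    intro t
    induction t using TensorProduct.induction_on with
    | zero => simp
    | add s t hs ht => simp only [map_add, hs, ht]
    | tmul Y Z => simp [(coproduct_toPlus h).2]
  have e2 : ∀ t : SymAlg gr ⊗[K] SymAlg gr,
      TensorProduct.assoc K (SymPlus gr) (SymPlus gr) (SymPlus gr)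
        (TensorProduct.map (coproduct gr) LinearMap.id (TensorProduct.map toPlus toPlus t)) =
      TensorProduct.map toPlus (TensorProduct.map toPlus toPlus)
        (TensorProduct.assoc K (SymAlg gr) (SymAlg gr) (SymAlg gr)
          (TensorProduct.map (coprodS h) LinearMap.id t)) := by
    intro t
    induction t using TensorProduct.induction_on with
    | zero => simp
    | add s t hs ht => simp only [map_add, hs, ht]
    | tmul Y Z =>
      simp only [TensorProduct.map_tmul, (coproduct_toPlus h).2, LinearMap.id_apply]
      generalize coprodS h Y = s
      induction s using TensorProduct.induction_on with
      | zero => simp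
      | add s t hs ht => simp only [map_add, TensorProduct.add_tmul, hs, ht]
      | tmul U V => simp
  rw [e1, e2, coassoc_coprodS]

end CoalgebraPlus

/-! ### Application to `H[a-b]`. -/

namespace DiffABAlgebra

variable {K A : Type*} [Field K] [AddCommGroup A] [Module K A] {a b : ℤ}
  (P : DiffABAlgebra K A a b)

/-- The operators `D` and `ℓ''_2` of `H[a-b]`. -/
noncomputable def shiftedLie : ShiftedLie P.gr'' where
  graded := P.gr''_internal
  D := P.D
  B := P.ell2''
  D_mem _ _ hX := P.D_mem hX
  B_mem _ _ _ hX _ hY := P.ell2''_mem hX hY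
  D_D := P.D_D
  B_comm _ _ _ hX _ hY := P.ell2''_comm hX hY
  jacobi _ _ _ _ hX _ hY _ hZ := P.ell2''_jacobi hX hY hZ
  D_B _ _ hX Y := P.D_ell2'' hX Y

theorem m_apply' : (∀ (n : ℕ) (X : Fin n → Homog P.gr''),
      P.m (symProdOf X (List.finRange n)) = extendOneFormula P.D X) ∧
    ∀ Y, P.m (toPlus Y) = toPlus (P.shiftedLie.mS Y) :=
  extendOne_toPlus P.gr''_internal P.shiftedLie.mS_ext P.shiftedLie.D_mem

theorem l''_apply' : (∀ (n : ℕ) (X : Fin n → Homog P.gr''),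
      P.l'' (symProdOf X (List.finRange n)) = extendTwoFormula P.ell2'' X) ∧
    ∀ Y, P.l'' (toPlus Y) = toPlus (P.shiftedLie.lS Y) :=
  P.shiftedLie.extendTwo_toPlus

theorem wellDefined : P.WellDefined where
  graded := P.gr''_internal
  D_apply n α := by rw [P.D_eq, P.pD_packetOf]
  ell2_apply p q α β := by rw [P.ell2_eq]; exact P.pB_packetOf α β
  ell2'_apply x' X hX Y := by
    rw [ell2', signTwist_eq P.gr'_internal, LinearMap.comp_apply, sgn_apply _ _ hX, map_smul,
      LinearMap.smul_apply, negOnePow_smul (K := K)]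
  ell2''_apply x'' X hX Y := by
    rw [ell2'', signTwist_eq P.gr''_internal, LinearMap.comp_apply, sgn_apply _ _ hX, map_smul,
      LinearMap.smul_apply, negOnePow_smul (K := K), one_mul]
  m_apply := P.m_apply'.1
  l''_apply := P.l''_apply'.1

theorem isCoderivation_m : IsCoderivation P.gr'' P.m :=
  isCoderivation_of_toPlus P.gr''_internal P.m_apply'.2 P.shiftedLie.mS_ext.mem
    P.shiftedLie.mS_coprodS

theorem isCoderivation_l'' : IsCoderivation P.gr'' P.l'' :=
  isCoderivation_of_toPlus P.gr''_internal P.l''_apply'.2 P.shiftedLie.lS_ext.mem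
    P.shiftedLie.lS_coprodS

theorem m_comp_m : P.m ∘ₗ P.m = 0 := by
  refine ext_toPlus (LinearMap.ext fun Y => ?_)
  simp [P.m_apply'.2, P.shiftedLie.mS_mS]

theorem l''_comp_l'' : P.l'' ∘ₗ P.l'' = 0 := by
  refine ext_toPlus (LinearMap.ext fun Y => ?_)
  simp [P.l''_apply'.2, P.shiftedLie.lS_lS]

theorem m_comp_l''_add : P.m ∘ₗ P.l'' + P.l'' ∘ₗ P.m = 0 := by
  refine ext_toPlus (LinearMap.ext fun Y => ?_)
  simp [P.l''_apply'.2, P.m_apply'.2, ← map_add, P.shiftedLie.mS_lS]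

theorem isCoderivation_Q : IsCoderivation P.gr'' P.Q where
  degree_one i X hX :=
    add_mem (P.isCoderivation_m.degree_one i X hX) (P.isCoderivation_l''.degree_one i X hX)
  coleibniz := by
    have e1 := P.isCoderivation_m.coleibniz
    have e2 := P.isCoderivation_l''.coleibniz
    rw [Q, LinearMap.comp_add, ← e1, ← e2, TensorProduct.map_add_left, TensorProduct.map_add_right,
      ← LinearMap.add_comp]
    congr 1
    abel

theorem isLInfinity : IsLInfinity P.gr'' P.Q where
  graded := isInternal_symGr P.gr''_internal
  coproduct_apply := (coproduct_toPlus P.gr''_internal).1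
  coproduct_degree _ _ hX := coproduct_mem P.gr''_internal hX
  cocommutative := flip_coproduct P.gr''_internal
  coassociative := coassoc_coproduct P.gr''_internal
  coderivation := P.isCoderivation_Q
  sq_zero := by
    have e := P.m_comp_l''_add
    -- The square of Q consists of the two squares and the anticommutator of m and ℓ'', each of
    -- which vanishes.
    rw [Q, LinearMap.add_comp, LinearMap.comp_add, LinearMap.comp_add, P.m_comp_m, P.l''_comp_l'',
      zero_add, add_zero, e]

end DiffABAlgebra

end ABHomotopy

theorem proposition4p3 {K A : Type*} [Field K] [AddCommGroup A] [Module K A] (a b : ℤ)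
    (P : ABHomotopy.DiffABAlgebra K A a b) :
    P.WellDefined ∧
    -- degrees: the bracket and `D` have degree one on `H[a-b]`
    (∀ (x y : ℤ), ∀ X ∈ P.gr'' x, ∀ Y ∈ P.gr'' y, P.ell2'' X Y ∈ P.gr'' (x + y + 1)) ∧
    (∀ (x : ℤ), ∀ X ∈ P.gr'' x, P.D X ∈ P.gr'' (x + 1)) ∧
    -- (i) graded symmetry
    (∀ (x y : ℤ), ∀ X ∈ P.gr'' x, ∀ Y ∈ P.gr'' y,
      P.ell2'' X Y = (x * y).negOnePow • P.ell2'' Y X) ∧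
    -- (ii) graded Jacobi identity
    (∀ (x y z : ℤ), ∀ X ∈ P.gr'' x, ∀ Y ∈ P.gr'' y, ∀ Z ∈ P.gr'' z,
      (x * z).negOnePow • P.ell2'' (P.ell2'' X Y) Z +
        (y * x).negOnePow • P.ell2'' (P.ell2'' Y Z) X +
        (z * y).negOnePow • P.ell2'' (P.ell2'' Z X) Y = 0) ∧
    -- (iii) compatibility with `D`
    (∀ (x : ℤ), ∀ X ∈ P.gr'' x, ∀ Y : P.H,
      P.D (P.ell2'' X Y) =
        -P.ell2'' (P.D X) Y + (1 + x).negOnePow • P.ell2'' X (P.D Y)) ∧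
    -- `m` and `ℓ''` are coderivations of square zero
    ABHomotopy.IsCoderivation P.gr'' P.m ∧ P.m ∘ₗ P.m = 0 ∧
    ABHomotopy.IsCoderivation P.gr'' P.l'' ∧ P.l'' ∘ₗ P.l'' = 0 ∧
    -- `(S⁺(H[a-b]), Δ, Q)` is an `L∞` algebra; in particular `Q` squares to zero
    ABHomotopy.IsLInfinity P.gr'' P.Q := by
  refine ⟨P.wellDefined, P.shiftedLie.B_mem, P.shiftedLie.D_mem, fun x y X hX Y hY => ?_,
    fun x y z X hX Y hY Z hZ => ?_, fun x X hX Y => ?_, P.isCoderivation_m, P.m_comp_m,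
    P.isCoderivation_l'', P.l''_comp_l'', P.isLInfinity⟩
  · rw [ABHomotopy.negOnePow_smul (K := K)]
    exact P.ell2''_comm hX hY
  · simp only [ABHomotopy.negOnePow_smul (K := K)]
    exact P.ell2''_jacobi hX hY hZ
  · rw [ABHomotopy.negOnePow_smul (K := K)]
    exact P.D_ell2'' hX Y
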